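/- Let $K$ be an algebraically closed field, let $n\ge 1$ and let $\le$ be a partial order on $\Lambda=\{1,\dots,n\}$. All algebras are finite-dimensional $K$-algebras and all modules are finite-dimensional left modules. For a module $L$ over an algebra $B$, $\mathrm{End}_B(L)^{op}$ denotes the algebra of $B$-endomorphisms of $L$ with the product $F\circ G=(L\xrightarrow{G}L\xrightarrow{F}L)$. An algebra is basic if its regular module is a direct sum of pairwise non-isomorphic indecomposable modules. The module $L$ is multiplicity-free if it is a direct sum of pairwise non-isomorphic indecomposable modules, and it is a generator-cogenerator if every indecomposable projective and every indecomposable injective $B$-module is isomorphic to a direct summand of $L$. *1-quasi-hereditary algebras.* Let $A$ be a basic algebra whose vertices are identified with $\Lambda$, i.e. a complete family $(e_i)_{i\in\Lambda}$ of orthogonal primitive idempotents with pairwise non-isomorphic projective modules $P(i)=Ae_i$ is given. Put $S(i)=\mathrm{top}\,P(i)$ and $I(i)=\mathrm{Hom}_K(e_iA,K)$; let $[M:S(k)]$ be the Jordan–Hölder multiplicity of $S(k)$ in $M$; let $\Delta(i)$ be the largest factor module of $P(i)$ with $[\Delta(i):S(k)]=0$ for all $k\not\le i$, and let $\nabla(i)$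 be the $K$-dual of the standard module $\Delta_{A^{op}}(i)$ of $A^{op}$. A module is $\Delta$-good if it has a filtration whose subquotients are isomorphic to modules $\Delta(k)$; $(M:\Delta(k))$ is the number of subquotients isomorphic to $\Delta(k)$. Then $(A,\le)$ is quasi-hereditary if for all $i$: $[\Delta(i):S(i)]=1$, $P(i)$ is $\Delta$-good, $(P(i):\Delta(k))=0$ for all $k\not\ge i$, and $(P(i):\Delta(i))=1$. It is 1-quasi-hereditary if moreover (1) $1$ is the smallest element of $(\Lambda,\le)$ and there is a largest element $m$; (2) $[\Delta(i):S(j)]=(P(j):\Delta(i))=1$ whenever $j\le i$; (3) $\mathrm{soc}\,P(j)\cong\mathrm{top}\,I(j)\cong S(1)$ for all $j$; (4) for all $i$ there are a monomorphism $\Delta(i)\hookrightarrow\Delta(m)$ and an epimorphism $\nabla(m)\twoheadrightarrow\nabla(i)$. *Condition $[\le]$.* A pair $(B,L)$ satisfies $[\le]$ if $B$ is local and self-injective with $\dim_KB=n$, and $L\cong\bigoplus_{i\in\Lambda}L(i)$ as $B$-modules, where the $L(i)$ are two-sided ideals of $B$, local as left modules, with $L(1)=B$ and, for all $i,j\in\Lambda$: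 (a) there is an epimorphism of left $B$-modules $L(i)\twoheadrightarrow L(j)$ if and only if $i\le j$; (b) $\mathrm{rad}\,L(i)=\sum_{i<j}L(j)$. **Theorem A.** Let $B$ be a basic algebra, $L$ a $B$-module and $A\cong\mathrm{End}_B(L)^{op}$. Then the following are equivalent: (i) $L$ is a multiplicity-free generator-cogenerator, and $(A,\le)$ is 1-quasi-hereditary for some identification of the vertices of $A$ with $\Lambda$; (ii) $(B,L)$ satisfies $[\le]$. Here the labels correspond: if an identification $(e_i)_{i\in\Lambda}$ of the vertices of $A$ with $\Lambda$ is given, then $L$ is a multiplicity-free generator-cogenerator and $(A,\le)$ is 1-quasi-hereditary for this identification if and only if $B$ is local and self-injective with $\dim_KB=n$ and there are ideals $L(i)$ as in $[\le]$ with $e_iL\cong L(i)$ for all $i\in\Lambda$ (where $A$ acts on $L$ through the given isomorphism). Moreover, $[B,L]\mapsto[\mathrm{End}_B(L)^{op}]$ is a bijection from the isomorphism classes of pairs $(B,L)$ satisfying $[\le]$ to the isomorphism classes of algebras $A$ such that $(A,\le)$ is 1-quasi-hereditary for some identification of the vertices of $A$ with $\Lambda$. (Two pairs $(B,L)$, $(B',L')$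 are isomorphic if there are an algebra isomorphism $\sigma:B\to B'$ and an additive isomorphism $f:L\to L'$ with $f(bx)=\sigma(b)f(x)$.) -/

import Mathlib

universe u v

namespace OneQH

section Modules

variable (R : Type u) [Ring R]

/-- A module is indecomposable if it is nonzero and is not the direct sum of two nonzero
submodules. -/
def IsIndecomposable (M : Type u) [AddCommGroup M] [Module R M] : Prop :=
  Nontrivial M ∧ ∀ N N' : Submodule R M, IsCompl N N' → N = ⊥ ∨ N' = ⊥

/-- `X` is isomorphic to a direct summand of `M`. -/
def IsDirectSummand (X M : Type u) [AddCommGroup X] [Module R X] [AddCommGroup M] [Module R M] :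
    Prop :=
  ∃ (s : X →ₗ[R] M) (p : M →ₗ[R] X), p ∘ₗ s = LinearMap.id

/-- `M` is a finite direct sum of pairwise non-isomorphic indecomposable modules. -/
def IsMultiplicityFree (M : Type u) [AddCommGroup M] [Module R M] : Prop :=
  ∃ (k : ℕ) (N : Fin k → Submodule R M), DirectSum.IsInternal N ∧
    (∀ a, IsIndecomposable R (N a)) ∧ ∀ a b, Nonempty (N a ≃ₗ[R] N b) → a = b

/-- An algebra is basic if its regular module is a direct sum of pairwise non-isomorphic
indecomposable (projective) modules. -/
def IsBasic : Prop := IsMultiplicityFree R R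

/-- `M` is a generator-cogenerator: every finitely generated indecomposable module which is
projective or injective is a direct summand of `M`. -/
def IsGeneratorCogenerator (M : Type u) [AddCommGroup M] [Module R M] : Prop :=
  ∀ (X : Type u) [AddCommGroup X] [Module R X], Module.Finite R X → IsIndecomposable R X →
    (Module.Projective R X ∨ Module.Injective R X) → IsDirectSummand R X M

/-- The socle: the sum of all simple submodules. -/
def socle (M : Type u) [AddCommGroup M] [Module R M] : Submodule R M :=
  sSup {N : Submodule R M | IsSimpleModule R N}

/-- The top `M / rad M`. Here `Module.jacobson R M` is the intersection of all
maximal submodules of `M`. -/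
abbrev Top (M : Type u) [AddCommGroup M] [Module R M] : Type u :=
  M ⧸ Module.jacobson R M

/-- A (finitely generated) module is local if it has exactly one maximal submodule. -/
def IsLocalModule (M : Type u) [AddCommGroup M] [Module R M] : Prop :=
  ∃! N : Submodule R M, IsCoatom N

variable {R}

/-- `F` is a filtration `0 = F 0 ⊆ F 1 ⊆ ... ⊆ F r = M`. -/
def IsFiltration {M : Type u} [AddCommGroup M] [Module R M] {r : ℕ}
    (F : Fin (r + 1) → Submodule R M) : Prop :=
  Monotone F ∧ F 0 = ⊥ ∧ F (Fin.last r) = ⊤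

/-- The subquotient `F (t + 1) / F t`. -/
abbrev Subquotient {M : Type u} [AddCommGroup M] [Module R M] {r : ℕ}
    (F : Fin (r + 1) → Submodule R M) (t : Fin r) : Type u :=
  F t.succ ⧸ (F t.castSucc).submoduleOf (F t.succ)

/-- The number of subquotients of `F` that are isomorphic to `X`. -/
noncomputable def countSubquotients {M : Type u} [AddCommGroup M] [Module R M] {r : ℕ}
    (F : Fin (r + 1) → Submodule R M) (X : Type u) [AddCommGroup X] [Module R X] : ℕ :=
  Nat.card {t : Fin r // Nonempty (Subquotient F t ≃ₗ[R] X)}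

variable (R)

/-- `[M : S] = m`: the module `M` has a composition series in which exactly `m` factors are
isomorphic to `S` (by the Jordan-Hölder theorem, `m` does not depend on the series). -/
def JHMultiplicity (M S : Type u) [AddCommGroup M] [Module R M] [AddCommGroup S] [Module R S]
    (m : ℕ) : Prop :=
  ∃ (r : ℕ) (F : Fin (r + 1) → Submodule R M), IsFiltration F ∧
    (∀ t, IsSimpleModule R (Subquotient F t)) ∧ countSubquotients F S = m

end Modules

section Vertices

variable {Λ : Type v} {R : Type u} [Ring R]

/-- The projective module `P(i) = R e_i`. -/
abbrev Proj (e : Λ → R) (i : Λ) : Type u := Ideal.span {e i}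

/-- An identification of the vertices of the quiver of the basic algebra `R` with `Λ`: a complete
family of orthogonal primitive idempotents `e_i` such that the indecomposable projective modules
`R e_i` are pairwise non-isomorphic. -/
def IsVertexLabelling [Fintype Λ] (e : Λ → R) : Prop :=
  CompleteOrthogonalIdempotents e ∧ (∀ i, IsIndecomposable R (Proj e i)) ∧
    ∀ i j, Nonempty (Proj e i ≃ₗ[R] Proj e j) → i = j

/-- The simple module `S(i)`, the top of `P(i)`. -/
abbrev Simp (e : Λ → R) (i : Λ) : Type u := Top R (Proj e i)

variable [PartialOrder Λ]

/-- The smallest submodule `N` of `P(i)` such that `[P(i)/N : S(k)] = 0` for all `k` with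
`k ≰ i`. -/
def standardKernel (e : Λ → R) (i : Λ) : Submodule R (Proj e i) :=
  sInf {N | ∀ k, ¬ k ≤ i → JHMultiplicity R (Proj e i ⧸ N) (Simp e k) 0}

/-- The standard module `Δ(i)`: the largest factor module of `P(i)` all of whose composition
factors are of the form `S(k)` with `k ≤ i`. -/
abbrev Standard (e : Λ → R) (i : Λ) : Type u := Proj e i ⧸ standardKernel e i

/-- `M` has a filtration with all subquotients isomorphic to standard modules, exactly `m` of them
isomorphic to `Δ(i)`; that is, `M` is `Δ`-good with `(M : Δ(i)) = m`. -/
def StandardMultiplicity (e : Λ → R) (M : Type u) [AddCommGroup M] [Module R M] (i : Λ) (m : ℕ) :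
    Prop :=
  ∃ (r : ℕ) (F : Fin (r + 1) → Submodule R M), IsFiltration F ∧
    (∀ t, ∃ k, Nonempty (Subquotient F t ≃ₗ[R] Standard e k)) ∧
    countSubquotients F (Standard e i) = m

/-- The algebra `R`, whose vertices are labelled by the poset `Λ` through `e`, is
quasi-hereditary. -/
def IsQuasiHereditary [Fintype Λ] (e : Λ → R) : Prop :=
  IsVertexLabelling e ∧ ∀ i,
    JHMultiplicity R (Standard e i) (Simp e i) 1 ∧
    (∀ k, ¬ i ≤ k → StandardMultiplicity e (Proj e i) k 0) ∧
    StandardMultiplicity e (Proj e i) i 1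

end Vertices

section Duality

open MulOpposite

variable (K : Type u) [Field K] {A : Type u} [Ring A] [Algebra K A]

/-- The standard duality `D = Hom_K(-, K)` from right `A`-modules (that is, left modules over the
opposite algebra) to left `A`-modules. -/
def StdDual (_A : Type u) (M : Type u) [AddCommGroup M] [Module K M] : Type u :=
  M →ₗ[K] K

section

variable {K} {M : Type u} [AddCommGroup M] [Module K M]

/-- The underlying linear form. -/
def StdDual.form (φ : StdDual K A M) : M →ₗ[K] K := φ

instance StdDual.instAddCommGroup : AddCommGroup (StdDual K A M) :=
  (LinearMap.addCommGroup : AddCommGroup (M →ₗ[K] K))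

variable [Module Aᵐᵒᵖ M] [IsScalarTower K Aᵐᵒᵖ M]

/-- The `K`-linear map `m ↦ m a` on a right `A`-module. -/
def rightMul (a : A) : M →ₗ[K] M where
  toFun m := op a • m
  map_add' x y := smul_add _ x y
  map_smul' c x := smul_comm (op a) c x

/-- The left action `(a • φ)(m) = φ(m a)`. -/
instance StdDual.instModule : Module A (StdDual K A M) where
  smul a φ := (φ.form.comp (rightMul a) : M →ₗ[K] K)
  one_smul φ := LinearMap.ext fun m => congrArg φ.form (one_smul Aᵐᵒᵖ m)
  mul_smul a b φ := LinearMap.ext fun m => congrArg φ.form (mul_smul (op b) (op a) m)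
  smul_zero _ := LinearMap.ext fun _ => rfl
  smul_add _ _ _ := LinearMap.ext fun _ => rfl
  add_smul a b φ := LinearMap.ext fun m =>
    (congrArg φ.form (add_smul (op a) (op b) m)).trans (φ.form.map_add (op a • m) (op b • m))
  zero_smul φ := LinearMap.ext fun m =>
    (congrArg φ.form (zero_smul Aᵐᵒᵖ m)).trans φ.form.map_zero

end

variable {Λ : Type v}

/-- The same idempotents, as idempotents of the opposite algebra. -/
def opLabel (e : Λ → A) : Λ → Aᵐᵒᵖ := fun i => op (e i)

/-- The injective module `I(i) = D(e_i A)`. -/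
abbrev Inj (e : Λ → A) (i : Λ) : Type u := StdDual K A (Proj (opLabel e) i)

/-- The costandard module `∇(i)`, the dual of the standard module of the opposite algebra. -/
abbrev Costandard [PartialOrder Λ] (e : Λ → A) (i : Λ) : Type u :=
  StdDual K A (Standard (opLabel e) i)

/-- The algebra `A`, whose vertices are labelled by the poset `Λ` through `e`, is
1-quasi-hereditary; `one` names the smallest element of `Λ`, and `top` the largest one. -/
def IsOneQuasiHereditary [Fintype Λ] [PartialOrder Λ] (one : Λ) (e : Λ → A) : Prop :=
  IsQuasiHereditary e ∧ (∀ i, one ≤ i) ∧ ∃ top : Λ, (∀ i, i ≤ top) ∧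
    (∀ i j, j ≤ i → JHMultiplicity A (Standard e i) (Simp e j) 1 ∧
      StandardMultiplicity e (Proj e j) i 1) ∧
    (∀ j, Nonempty (socle A (Proj e j) ≃ₗ[A] Simp e one) ∧
      Nonempty (Top A (Inj K e j) ≃ₗ[A] Simp e one)) ∧
    ∀ i, (∃ f : Standard e i →ₗ[A] Standard e top, Function.Injective f) ∧
      ∃ g : Costandard K e top →ₗ[A] Costandard K e i, Function.Surjective g

end Duality

section Condition

variable {Λ : Type v} [PartialOrder Λ]

/-- The conditions on the family of ideals `L(i)` of `B` (an `Ideal` is a left ideal):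
they are two-sided and local, `L(1) = B`, there is an epimorphism of left modules from
`L(i)` to `L(j)` iff `i ≤ j`, and the radical of `L(i)` is the sum of the `L(j)` with `i < j`. -/
structure IsOrderedIdealFamily {B : Type u} [Ring B] (one : Λ) (I : Λ → Ideal B) : Prop where
  twoSided : ∀ i, (I i).IsTwoSided
  isLocal : ∀ i, IsLocalModule B (I i)
  eq_top : I one = ⊤
  surj_iff : ∀ i j, (∃ f : I i →ₗ[B] I j, Function.Surjective f) ↔ i ≤ j
  rad_eq : ∀ i, (Module.jacobson B (I i)).map (I i).subtype = ⨆ j, ⨆ _ : i < j, I j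

/-- `B` is a local self-injective algebra of dimension `n = |Λ|`. -/
def IsLocalSelfInjectiveOfCard (K : Type u) [Field K] (Λ : Type v) [Fintype Λ]
    (B : Type u) [Ring B] [Algebra K B] : Prop :=
  IsLocalRing B ∧ Module.Injective B B ∧ Module.finrank K B = Fintype.card Λ

/-- The pair `(B, L)` satisfies the condition attached to the order of `Λ`. -/
def SatisfiesOrderCondition (K : Type u) [Field K] [Fintype Λ] (one : Λ)
    (B : Type u) [Ring B] [Algebra K B] (L : Type u) [AddCommGroup L] [Module B L] : Prop :=
  IsLocalSelfInjectiveOfCard K Λ B ∧ ∃ I : Λ → Ideal B, IsOrderedIdealFamily one I ∧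
    Nonempty (L ≃ₗ[B] DirectSum Λ fun i => I i)

end Condition

section EndomorphismAlgebra

/-- The algebra `End_B(L)^op` whose product is `F ∘ G = (L → L → L)`, first `G` and then `F`, so
that `L` is a left module over it. This is the multiplication of `Module.End B L`. -/
abbrev EndAlg (B : Type u) [Ring B] (L : Type u) [AddCommGroup L] [Module B L] : Type u :=
  Module.End B L

end EndomorphismAlgebra

section IsomorphismClasses

variable (K : Type u) [Field K] {Λ : Type v} [Fintype Λ] [PartialOrder Λ] (one : Λ)

/-- A finite dimensional algebra that is 1-quasi-hereditary with respect to the order of `Λ`, for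
some identification of its vertices with `Λ` (in particular it is basic). -/
structure OneQHAlgebra where
  carrier : Type u
  [ring : Ring carrier]
  [algebra : Algebra K carrier]
  [finite : Module.Finite K carrier]
  isOneQH : ∃ e : Λ → carrier, IsOneQuasiHereditary K one e

attribute [instance] OneQHAlgebra.ring OneQHAlgebra.algebra OneQHAlgebra.finite

/-- A finite dimensional algebra `B` with a finite dimensional `B`-module `L`, such that `(B, L)`
satisfies the condition attached to the order of `Λ`. -/
structure OrderedPair where
  alg : Type u
  [ring : Ring alg]
  [algebra : Algebra K alg]
  [finite : Module.Finite K alg]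
  mod : Type u
  [addCommGroup : AddCommGroup mod]
  [moduleK : Module K mod]
  [module : Module alg mod]
  [isScalarTower : IsScalarTower K alg mod]
  [finiteMod : Module.Finite K mod]
  satisfies : SatisfiesOrderCondition K one alg mod

attribute [instance] OrderedPair.ring OrderedPair.algebra OrderedPair.finite
  OrderedPair.addCommGroup OrderedPair.moduleK OrderedPair.module OrderedPair.isScalarTower
  OrderedPair.finiteMod

/-- Isomorphism of algebras. -/
def OneQHAlgebra.isoSetoid : Setoid (OneQHAlgebra K one) where
  r X Y := Nonempty (X.carrier ≃ₐ[K] Y.carrier)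
  iseqv :=
    { refl := fun _ => ⟨AlgEquiv.refl⟩
      symm := fun ⟨f⟩ => ⟨f.symm⟩
      trans := fun ⟨f⟩ ⟨g⟩ => ⟨f.trans g⟩ }

/-- Isomorphism of pairs: an isomorphism of algebras together with a compatible isomorphism of
modules. -/
def OrderedPair.isoSetoid : Setoid (OrderedPair K one) where
  r X Y := ∃ (σ : X.alg ≃ₐ[K] Y.alg) (f : X.mod ≃+ Y.mod), ∀ b x, f (b • x) = σ b • f x
  iseqv :=
    { refl := fun _ => ⟨AlgEquiv.refl, AddEquiv.refl _, fun _ _ => rfl⟩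
      symm := fun ⟨σ, f, h⟩ => ⟨σ.symm, f.symm, fun b x => by
        apply f.injective
        rw [h, AddEquiv.apply_symm_apply, AddEquiv.apply_symm_apply, AlgEquiv.apply_symm_apply]⟩
      trans := fun ⟨σ, f, h⟩ ⟨τ, g, h'⟩ => ⟨σ.trans τ, f.trans g, fun b x => by
        rw [AddEquiv.trans_apply, h, h', AddEquiv.trans_apply, AlgEquiv.trans_apply]⟩ }

/-- Isomorphism classes of 1-quasi-hereditary algebras. -/
def OneQHAlgebra.IsoClass : Type _ := Quotient (OneQHAlgebra.isoSetoid K one)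

/-- Isomorphism classes of pairs. -/
def OrderedPair.IsoClass : Type _ := Quotient (OrderedPair.isoSetoid K one)

variable {K one}

/-- The class `[A]`. -/
def OneQHAlgebra.isoClass (A : OneQHAlgebra K one) : OneQHAlgebra.IsoClass K one :=
  Quotient.mk _ A

/-- The class `[B, L]`. -/
def OrderedPair.isoClass (X : OrderedPair K one) : OrderedPair.IsoClass K one :=
  Quotient.mk _ X

end IsomorphismClasses

end OneQH

/-! The proof passes through `IsCore`, a description of `A` by elements that is symmetric under
passing to the opposite algebra. Since Δ(m) = P(m) for the largest vertex m, a monomorphism Δ(i) →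
Δ(m) is right multiplication by some `x i` in e_i A e_m; dually, an epimorphism ∇(m) → ∇(i) gives `y
i` in e_m A e_i. Jordan–Hölder multiplicities are dimensions of vertex spaces, so conditions (1) and
(2) amount to dim e_j A e_i = #{k | i ≤ k, j ≤ k} together with a statement on which products with
`x i` and `y i` vanish; condition (3) says that x_1 y_j and x_j y_1 span the socles of P(j) and of
e_j A. Both directions are dimension counts (`IsOneQuasiHereditary.isCore`,
`IsCore.isOneQuasiHereditary`).

From A to (B, L): let C = e_1 A e_1 and choose a_i, b_i with y_i a_i = y_1 and b_i x_i = x_1. The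
products b_k a_k form a basis of C, and left multiplication by b_i identifies e_i A e_1 with the
span of those with i ≤ k. A linear form not vanishing on x_1 y_1 is nondegenerate on C. Hence,
whenever L ≅ A e_1 and B ≅ C^op compatibly, B is local and self-injective, the summands e_i L are
ideals as in [≤], and A is the full endomorphism algebra of L (`IsCore.of_isPairGenerator`). For a
generator-cogenerator L over a basic B such an identification exists because e_1 L ≅ B
(`IsCore.nonempty_range_equiv_self`).

From (B, L) to A: elements z_i of L(i) outside its radical form a basis of B. By self-injectivity
every homomorphism L(i) → L(j) is a right multiplication, and its value at z_i ranges exactly over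
L(i) ∩ L(j). In these coordinates x_i and y_i are both represented by the socle generator of B, and
the conditions of `IsCore` become statements about the basis (`IsOrderedIdealFamily.exists_isCore`).

For the bijection, A comes from the module A e_1 over End_A(A e_1), and a pair (B, L) is recovered
from A and e_1 (`IsPairGenerator.exists_equiv_pair`). -/

namespace OneQH

/-! ### Fitting's lemma and local modules. -/

section Fitting

variable {R : Type u} [Ring R] {M : Type u} [AddCommGroup M] [Module R M]

/-- Fitting's lemma: M is the direct sum of the kernel and the range of a high power of `f`, so `f`
is invertible or nilpotent. -/
theorem IsIndecomposable.isLocalRing_end [IsNoetherian R M] [IsArtinian R M]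
    (h : IsIndecomposable R M) : IsLocalRing (Module.End R M) := by
  have := h.1
  apply IsLocalRing.of_isUnit_or_isUnit_one_sub_self
  intro f
  obtain ⟨n, hn⟩ := Filter.eventually_atTop.1 (LinearMap.eventually_isCompl_ker_pow_range_pow f)
  -- The exponent is made positive so that a unit power forces `f` itself to be a unit.
  have hc := hn (n + 1) (by omega)
  rcases h.2 _ _ hc with h0 | h0
  · left
    have hr : LinearMap.range (f ^ (n + 1)) = ⊤ := by
      have := hc.sup_eq_top
      rwa [h0, bot_sup_eq] at this
    have : IsUnit (f ^ (n + 1)) := by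
      rw [Module.End.isUnit_iff]
      exact ⟨LinearMap.ker_eq_bot.1 h0, LinearMap.range_eq_top.1 hr⟩
    exact (isUnit_pow_iff (by omega)).1 this
  · right
    have : f ^ (n + 1) = 0 := LinearMap.range_eq_bot.1 h0
    exact IsNilpotent.isUnit_one_sub ⟨_, this⟩

/-- Two proper complements would both lie in the unique maximal submodule, and so would their sum.
-/
theorem IsLocalModule.isIndecomposable (h : IsLocalModule R M) [Module.Finite R M] :
    IsIndecomposable R M := by
  obtain ⟨N, hN, huniq⟩ := h
  refine ⟨?_, fun X Y hXY => ?_⟩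
  · by_contra hM
    rw [not_nontrivial_iff_subsingleton] at hM
    exact hN.1 (Subsingleton.elim _ _)
  · by_contra! hne
    have key : ∀ Z : Submodule R M, Z ≠ ⊤ → Z ≤ N := by
      intro Z hZ
      obtain h | ⟨C, hC, hZC⟩ := eq_top_or_exists_le_coatom Z
      · exact absurd h hZ
      · rwa [huniq C hC] at hZC
    have hX : X ≠ ⊤ := by
      rintro rfl
      exact hne.2 (by simpa using hXY.inf_eq_bot)
    have hY : Y ≠ ⊤ := by
      rintro rfl
      exact hne.1 (by simpa using hXY.inf_eq_bot)
    exact hN.1 (top_le_iff.1 (hXY.sup_eq_top ▸ sup_le (key X hX) (key Y hY)))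

theorem IsLocalModule.isCoatom_jacobson (h : IsLocalModule R M) :
    IsCoatom (Module.jacobson R M) := by
  obtain ⟨N, hN, huniq⟩ := h
  have : Module.jacobson R M = N :=
    le_antisymm (sInf_le hN) (le_sInf fun C hC => (huniq C hC).ge)
  rwa [this]

theorem IsLocalModule.eq_jacobson (h : IsLocalModule R M) {N : Submodule R M} (hN : IsCoatom N) :
    N = Module.jacobson R M :=
  h.unique hN h.isCoatom_jacobson

theorem IsLocalModule.le_jacobson (h : IsLocalModule R M) [Module.Finite R M] {N : Submodule R M}
    (hN : N ≠ ⊤) : N ≤ Module.jacobson R M := by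
  obtain h' | ⟨C, hC, hZC⟩ := eq_top_or_exists_le_coatom N
  · exact absurd h' hN
  · rwa [h.eq_jacobson hC] at hZC

/-- A module in which every proper submodule is contained in a fixed proper submodule is local. -/
theorem isLocalModule_of_forall_le {N : Submodule R M} (hN : N ≠ ⊤)
    (h : ∀ X : Submodule R M, X ≠ ⊤ → X ≤ N) : IsLocalModule R M := by
  refine ⟨N, ⟨hN, fun X hX => ?_⟩, fun X hX => ?_⟩
  · by_contra hX'
    exact absurd (h X hX') (not_le_of_gt hX)
  · by_contra hne
    exact hN (hX.2 _ (lt_of_le_of_ne (h X hX.1) hne))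

theorem IsLocalModule.congr {M' : Type u} [AddCommGroup M'] [Module R M'] (f : M ≃ₗ[R] M')
    (h : IsLocalModule R M) : IsLocalModule R M' := by
  obtain ⟨N, hN, huniq⟩ := h
  let o := Submodule.orderIsoMapComap f
  refine ⟨o N, (OrderIso.isCoatom_iff o N).2 hN, fun X hX => ?_⟩
  rw [← huniq (o.symm X) ((OrderIso.isCoatom_iff o.symm X).2 hX)]
  simp

end Fitting

/-! ### Primitive idempotents and the left ideals they generate. -/

section Idempotents

variable {R : Type u} [Ring R]

/-- The only idempotents of the corner ring `f R f` are `0` and `f`, and `f ≠ 0`. -/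
def IsPrimitiveIdem (f : R) : Prop :=
  f ≠ 0 ∧ ∀ g, g * g = g → f * g = g → g * f = g → g = 0 ∨ g = f

theorem coe_mul_of_mem_span {f : R} (hf : f * f = f) (z : Ideal.span {f}) : (z : R) * f = z := by
  obtain ⟨a, ha⟩ := Ideal.mem_span_singleton'.1 z.2
  rw [← ha, mul_assoc, hf]

/-- An idempotent `g` of `f R f` splits `R f` as `R g ⊕ R (f - g)`, and every splitting arises in
this way from the component of the generator `f`. Primitivity makes sense on both sides of the ring,
which is how indecomposability passes to the opposite algebra. -/
theorem isIndecomposable_span_iff {f : R} (hf : f * f = f) :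
    IsIndecomposable R (Ideal.span {f}) ↔ IsPrimitiveIdem f := by
  have hmem : ∀ a, a * f = a → a ∈ Ideal.span {f} := fun a ha =>
    Ideal.mem_span_singleton'.2 ⟨a, ha⟩
  have hff := hmem f hf
  constructor
  · rintro ⟨h1, h2⟩
    refine ⟨?_, fun g hg hfg hgf => ?_⟩
    · rintro rfl
      obtain ⟨a, b, hab⟩ := h1
      apply hab
      ext
      rw [← coe_mul_of_mem_span hf a, ← coe_mul_of_mem_span hf b, mul_zero, mul_zero]
    · let N : Submodule R (Ideal.span {f}) :=
          Submodule.comap (Ideal.span {f}).subtype (Ideal.span {g})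
      let N' : Submodule R (Ideal.span {f}) :=
          Submodule.comap (Ideal.span {f}).subtype (Ideal.span {f - g})
      have hfg' : (f - g) * (f - g) = f - g := by
        rw [sub_mul, mul_sub, mul_sub, hf, hfg, hgf, hg]; abel
      have hc : IsCompl N N' := by
        constructor
        · rw [Submodule.disjoint_def]
          intro z hz hz'
          have h3 : (z : R) * g = z := coe_mul_of_mem_span hg ⟨z, hz⟩
          have h4 : (z : R) * (f - g) = z := coe_mul_of_mem_span hfg' ⟨z, hz'⟩
          ext
          rw [← h3, ← h4, mul_assoc, sub_mul, hfg, hg, sub_self, mul_zero]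
          rfl
        · rw [codisjoint_iff, eq_top_iff]
          rintro z -
          rw [Submodule.mem_sup]
          have e1 : (z : R) * g * f = z * g := by rw [mul_assoc, hgf]
          refine ⟨⟨z * g, hmem _ e1⟩, Ideal.mem_span_singleton'.2 ⟨z, rfl⟩,
            ⟨z * (f - g), hmem _ ?_⟩, Ideal.mem_span_singleton'.2 ⟨z, rfl⟩, ?_⟩
          · rw [mul_assoc, sub_mul, hf, hgf]
          · ext
            show (z : R) * g + z * (f - g) = z
            rw [mul_sub, coe_mul_of_mem_span hf]; abel
      rcases h2 N N' hc with h | h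
      · left
        have : (⟨g, hmem g hgf⟩ : Ideal.span {f}) ∈ N := Ideal.mem_span_singleton_self g
        rw [h, Submodule.mem_bot] at this
        exact congrArg Subtype.val this
      · right
        have : (⟨f - g, hmem _ (by rw [sub_mul, hf, hgf])⟩ : Ideal.span {f}) ∈ N' :=
          Ideal.mem_span_singleton_self (f - g)
        rw [h, Submodule.mem_bot] at this
        exact (sub_eq_zero.1 (congrArg Subtype.val this)).symm
  · rintro ⟨h0, hp⟩
    refine ⟨⟨⟨⟨f, hff⟩, 0, fun h => h0 (congrArg Subtype.val h)⟩⟩, fun N N' hc => ?_⟩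
    have htop : (⟨f, hff⟩ : Ideal.span {f}) ∈ N ⊔ N' := by rw [hc.sup_eq_top]; trivial
    -- The component `n` of `f` in `N` is the required idempotent: right multiplication by `n` is
    -- the projection onto `N`.
    obtain ⟨n, hn, n', hn', hnn⟩ := Submodule.mem_sup.1 htop
    have hsum : (n : R) + n' = f := congrArg Subtype.val hnn
    have huniq : ∀ a b : Ideal.span {f}, a ∈ N → b ∈ N' → a = b → a = 0 := by
      rintro a b ha hb rfl
      exact (Submodule.disjoint_def.1 hc.disjoint) a ha hb
    have hz : ∀ z ∈ N, z = (z : R) • n := by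
      intro z hz
      have e1 : z = (z : R) • n + (z : R) • n' := by
        ext
        show (z : R) = z * n + z * n'
        rw [← mul_add, hsum, coe_mul_of_mem_span hf]
      have := huniq (z - (z : R) • n) ((z : R) • n') (N.sub_mem hz (N.smul_mem _ hn))
        (N'.smul_mem _ hn') (sub_eq_of_eq_add' e1)
      exact sub_eq_zero.1 this
    have hz' : ∀ z ∈ N', z = (z : R) • n' := by
      intro z hz
      have e1 : z = (z : R) • n + (z : R) • n' := by
        ext
        show (z : R) = z * n + z * n'
        rw [← mul_add, hsum, coe_mul_of_mem_span hf]
      have := huniq ((z : R) • n) (z - (z : R) • n') (N.smul_mem _ hn)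
        (N'.sub_mem hz (N'.smul_mem _ hn')) ((sub_eq_of_eq_add e1).symm)
      rw [this, zero_add] at e1
      exact e1
    have hfn : f * n = n := by
      have e1 : (f • n) + f • n' = n + n' := by
        ext
        show f * (n : R) + f * n' = n + n'
        rw [← mul_add, hsum, hf]
      have := huniq (f • n - n) (n' - f • n') (N.sub_mem (N.smul_mem _ hn) hn)
        (N'.sub_mem hn' (N'.smul_mem _ hn'))
        (by rw [sub_eq_sub_iff_add_eq_add, e1, add_comm])
      exact congrArg Subtype.val (sub_eq_zero.1 this)
    have hnn' : (n : R) * n = n := (congrArg Subtype.val (hz n hn)).symm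
    rcases hp n hnn' hfn (coe_mul_of_mem_span hf n) with h | h
    · left
      rw [eq_bot_iff]
      intro z hzN
      rw [hz z hzN]
      have : n = 0 := Subtype.ext h
      simp [this]
    · right
      rw [eq_bot_iff]
      intro z hzN
      rw [hz' z hzN]
      have : n' = 0 := by
        ext
        show (n' : R) = 0
        rw [h] at hsum
        simpa using hsum
      simp [this]

/-- A homomorphism `R f → R g` is right multiplication by the image of `f`, an element of `f R g`.
The resulting equations survive passage to the opposite ring and any action of the ring. -/
theorem nonempty_span_equiv_iff {f g : R} (hf : f * f = f) (hg : g * g = g) :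
    Nonempty (Ideal.span {f} ≃ₗ[R] Ideal.span {g}) ↔
      ∃ a b, f * a = a ∧ a * g = a ∧ g * b = b ∧ b * f = b ∧ a * b = f ∧ b * a = g := by
  constructor
  · rintro ⟨φ⟩
    let F : Ideal.span {f} := ⟨f, Ideal.mem_span_singleton_self f⟩
    let G : Ideal.span {g} := ⟨g, Ideal.mem_span_singleton_self g⟩
    have hF : ∀ z : Ideal.span {f}, z = (z : R) • F := fun z =>
      Subtype.ext (coe_mul_of_mem_span hf z).symm
    have hG : ∀ z : Ideal.span {g}, z = (z : R) • G := fun z =>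
      Subtype.ext (coe_mul_of_mem_span hg z).symm
    refine ⟨φ F, φ.symm G, ?_, coe_mul_of_mem_span hg _, ?_, coe_mul_of_mem_span hf _, ?_, ?_⟩
    · have : f • φ F = φ F := by rw [← map_smul, ← hF F]
      exact congrArg Subtype.val this
    · have : g • φ.symm G = φ.symm G := by rw [← map_smul, ← hG G]
      exact congrArg Subtype.val this
    · have : F = ((φ F : Ideal.span {g}) : R) • φ.symm G := by
        rw [← map_smul, ← hG, LinearEquiv.symm_apply_apply]
      exact (congrArg Subtype.val this).symm
    · have : G = ((φ.symm G : Ideal.span {f}) : R) • φ F := by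
        rw [← map_smul, ← hF, LinearEquiv.apply_symm_apply]
      exact (congrArg Subtype.val this).symm
  · rintro ⟨a, b, h1, h2, h3, h4, h5, h6⟩
    refine ⟨LinearEquiv.ofLinearMap
      (((LinearMap.toSpanSingleton R R a).comp (Ideal.span {f}).subtype).codRestrict _ fun z =>
        Ideal.mem_span_singleton'.2 ⟨z * a, by simp [mul_assoc, h2]⟩)
      (((LinearMap.toSpanSingleton R R b).comp (Ideal.span {g}).subtype).codRestrict _ fun z =>
        Ideal.mem_span_singleton'.2 ⟨z * b, by simp [mul_assoc, h4]⟩) ?_ ?_⟩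
    · ext z
      show (z : R) * b * a = z
      rw [mul_assoc, h6, coe_mul_of_mem_span hg]
    · ext z
      show (z : R) * a * b = z
      rw [mul_assoc, h5, coe_mul_of_mem_span hf]

/-- For a primitive idempotent `f` of an Artinian ring, `R f` is a local module. -/
theorem IsPrimitiveIdem.isLocalModule [IsArtinianRing R] {f : R} (hf : f * f = f)
    (h : IsPrimitiveIdem f) : IsLocalModule R (Ideal.span {f}) := by
  have hloc : IsLocalRing (Module.End R (Ideal.span {f})) :=
    ((isIndecomposable_span_iff hf).2 h).isLocalRing_end
  let F : Ideal.span {f} := ⟨f, Ideal.mem_span_singleton_self f⟩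
  have hF : ∀ z : Ideal.span {f}, z = (z : R) • F := fun z =>
    Subtype.ext (coe_mul_of_mem_span hf z).symm
  have hmax : ∃ N : Submodule R (Ideal.span {f}), IsCoatom N := by
    have : Nontrivial (Ideal.span {f}) := ((isIndecomposable_span_iff hf).2 h).1
    obtain h' | ⟨C, hC, -⟩ :=
      eq_top_or_exists_le_coatom (⊥ : Submodule R (Ideal.span {f}))
    · exact absurd h' bot_ne_top
    · exact ⟨C, hC⟩
  obtain ⟨N, hN⟩ := hmax
  refine ⟨N, hN, fun N' hN' => ?_⟩
  by_contra hne
  have hsup : N ⊔ N' = ⊤ := by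
    refine hN.2 _ (lt_of_le_of_ne le_sup_left fun h' => hne ?_)
    have hle : N' ≤ N := by rw [h']; exact le_sup_right
    by_contra hne'
    exact hN.1 (hN'.2 _ (lt_of_le_of_ne hle hne'))
  have hFm : F ∈ N ⊔ N' := by rw [hsup]; trivial
  obtain ⟨n, hn, n', hn', hnn⟩ := Submodule.mem_sup.1 hFm
  -- `T m` is right multiplication by `m`. The generator is split along two distinct maximal
  -- submodules; as the endomorphism ring is local, one component acts bijectively, so its submodule
  -- is everything.
  let T : Ideal.span {f} → Module.End R (Ideal.span {f}) := fun m =>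
    (LinearMap.toSpanSingleton R (Ideal.span {f}) m).comp (Ideal.span {f}).subtype
  have hT : ∀ m z, T m z = (z : R) • m := fun m z => rfl
  have hadd : T n + T n' = 1 := by
    apply LinearMap.ext
    intro z
    show (z : R) • n + (z : R) • n' = z
    rw [← smul_add, hnn, ← hF]
  have hun : ∀ (m : Ideal.span {f}) (X : Submodule R (Ideal.span {f})), m ∈ X → IsUnit (T m) →
      X = ⊤ := by
    intro m X hm hu
    rw [Module.End.isUnit_iff] at hu
    rw [eq_top_iff]
    rintro z -
    obtain ⟨w, rfl⟩ := hu.2 z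
    exact X.smul_mem _ hm
  rcases IsLocalRing.isUnit_or_isUnit_of_add_one hadd with h1 | h1
  · exact hN.1 (hun n N hn h1)
  · exact hN'.1 (hun n' N' hn' h1)

end Idempotents

/-! ### The exact functor M ↦ f M and its dimension. -/

section FixedPart

variable (K : Type u) [Field K] {R : Type u} [Ring R] [Algebra K R]

/-- The subspace `f M` of `M`, for an idempotent `f`. -/
def fixedPart (f : R) (M : Type u) [AddCommGroup M] [Module K M] [Module R M]
    [IsScalarTower K R M] : Submodule K M where
  carrier := {m | f • m = m}
  add_mem' {x y} (hx : f • x = x) (hy : f • y = y) := by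
    show f • (x + y) = x + y
    rw [smul_add, hx, hy]
  zero_mem' := smul_zero f
  smul_mem' c x (hx : f • x = x) := by
    show f • (c • x) = c • x
    rw [← algebraMap_smul R c x, smul_smul, ← Algebra.commutes, mul_smul, hx]

variable {M : Type u} [AddCommGroup M] [Module K M] [Module R M] [IsScalarTower K R M]
  {N : Type u} [AddCommGroup N] [Module K N] [Module R N] [IsScalarTower K R N]

theorem mem_fixedPart {f : R} {m : M} : m ∈ fixedPart K f M ↔ f • m = m := Iff.rfl

/-- The restriction of a linear map to the subspaces `f M`. -/
def fixedPartMap (f : R) (φ : M →ₗ[R] N) : fixedPart K f M →ₗ[K] fixedPart K f N where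
  toFun m := ⟨φ m, by rw [mem_fixedPart, ← map_smul, (m.2 : f • (m : M) = m)]⟩
  map_add' _ _ := Subtype.ext (map_add φ _ _)
  map_smul' c x := Subtype.ext (by
    show φ (c • (x : M)) = c • φ x
    rw [← algebraMap_smul R c (x : M), map_smul, algebraMap_smul])

theorem fixedPartMap_injective (f : R) (φ : M →ₗ[R] N) (h : Function.Injective φ) :
    Function.Injective (fixedPartMap K f φ) := fun _ _ hxy =>
  Subtype.ext (h (congrArg Subtype.val hxy))

theorem fixedPartMap_surjective {f : R} (hf : f * f = f) (φ : M →ₗ[R] N)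
    (h : Function.Surjective φ) : Function.Surjective (fixedPartMap K f φ) := by
  rintro ⟨y, hy⟩
  obtain ⟨x, rfl⟩ := h y
  refine ⟨⟨f • x, by rw [mem_fixedPart, smul_smul, hf]⟩, Subtype.ext ?_⟩
  show φ (f • x) = φ x
  rw [map_smul]
  exact hy

theorem finrank_fixedPart_congr (f : R) (φ : M ≃ₗ[R] N) :
    Module.finrank K (fixedPart K f M) = Module.finrank K (fixedPart K f N) := by
  refine LinearEquiv.finrank_eq (LinearEquiv.ofBijective (fixedPartMap K f φ.toLinearMap)
    ⟨fixedPartMap_injective K f _ φ.injective, ?_⟩)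
  rintro ⟨y, hy⟩
  refine ⟨⟨φ.symm y, ?_⟩, Subtype.ext (φ.apply_symm_apply y)⟩
  rw [mem_fixedPart, ← map_smul, (hy : f • y = y)]

instance finite_submodule [Module.Finite K M] (X : Submodule R M) : Module.Finite K X :=
  Module.Finite.of_injective (X.subtype.restrictScalars K) X.injective_subtype

theorem finrank_fixedPart_add [Module.Finite K M] {f : R} (hf : f * f = f) (X : Submodule R M) :
    Module.finrank K (fixedPart K f M) =
      Module.finrank K (fixedPart K f X) + Module.finrank K (fixedPart K f (M ⧸ X)) := by
  have h1 := LinearMap.finrank_range_add_finrank_ker (fixedPartMap K f X.mkQ)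
  rw [LinearMap.range_eq_top.2 (fixedPartMap_surjective K hf X.mkQ X.mkQ_surjective),
    finrank_top] at h1
  rw [← h1, add_comm]
  congr 1
  refine LinearEquiv.finrank_eq (LinearEquiv.ofBijective
    ((fixedPartMap K f X.subtype).codRestrict (LinearMap.ker (fixedPartMap K f X.mkQ)) ?_)
    ⟨?_, ?_⟩).symm
  · intro x
    rw [LinearMap.mem_ker]
    apply Subtype.ext
    exact (Submodule.Quotient.mk_eq_zero X).2 (x : X).2
  · intro x y hxy
    exact fixedPartMap_injective K f _ X.injective_subtype (congrArg Subtype.val hxy)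
  · rintro ⟨⟨x, hx⟩, hx'⟩
    have : x ∈ X := (Submodule.Quotient.mk_eq_zero X).1 (congrArg Subtype.val hx')
    exact ⟨⟨⟨x, this⟩, Subtype.ext hx⟩, rfl⟩

/-- Exactness of M ↦ f M makes the dimension additive on submodule and quotient; the sum telescopes
along the filtration. -/
theorem finrank_fixedPart_filtration [Module.Finite K M] {f : R} (hf : f * f = f) {r : ℕ}
    (F : Fin (r + 1) → Submodule R M) (hF : IsFiltration F) :
    Module.finrank K (fixedPart K f M) =
      ∑ t, Module.finrank K (fixedPart K f (Subquotient F t)) := by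
  have hstep : ∀ t : Fin r, Module.finrank K (fixedPart K f (F t.succ)) =
      Module.finrank K (fixedPart K f (F t.castSucc)) +
        Module.finrank K (fixedPart K f (Subquotient F t)) := by
    intro t
    rw [finrank_fixedPart_add K hf ((F t.castSucc).submoduleOf (F t.succ))]
    congr 1
    exact finrank_fixedPart_congr K f
      (Submodule.submoduleOfEquivOfLe (hF.1 (Fin.castSucc_lt_succ (i := t)).le))
  have hall : ∀ s : Fin (r + 1), Module.finrank K (fixedPart K f (F s)) =
      ∑ t : Fin r with t.castSucc < s, Module.finrank K (fixedPart K f (Subquotient F t)) := by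
    intro s
    induction s using Fin.induction with
    | zero =>
      rw [hF.2.1, Finset.sum_eq_zero]
      · rw [Module.finrank_zero_iff]
        exact ⟨fun a b => Subtype.ext (Subsingleton.elim _ _)⟩
      · intro t ht
        simp at ht
    | succ t ih =>
      rw [hstep, ih]
      have : (Finset.univ.filter fun s : Fin r => s.castSucc < t.succ) =
          insert t (Finset.univ.filter fun s : Fin r => s.castSucc < t.castSucc) := by
        ext s
        simp only [Finset.mem_filter, Finset.mem_univ, true_and, Finset.mem_insert,
          Fin.lt_def, Fin.ext_iff, Fin.val_castSucc, Fin.val_succ]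
        omega
      rw [this, Finset.sum_insert (by simp), add_comm]
  have h1 : Module.finrank K (fixedPart K f M) =
      Module.finrank K (fixedPart K f (F (Fin.last r))) := by
    rw [hF.2.2]
    exact (finrank_fixedPart_congr K f Submodule.topEquiv).symm
  rw [h1, hall]
  congr 1
  ext t
  simp [Fin.castSucc_lt_last]

end FixedPart

/-! ### Jordan–Hölder multiplicities as dimensions of vertex spaces. -/

section JordanHolder

theorem exists_filtration_simple (R : Type u) [Ring R] (M : Type u) [AddCommGroup M] [Module R M]
    [IsNoetherian R M] [IsArtinian R M] :
    ∃ (r : ℕ) (F : Fin (r + 1) → Submodule R M), IsFiltration F ∧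
      ∀ t, IsSimpleModule R (Subquotient F t) := by
  obtain ⟨s, h0, h1⟩ := exists_compositionSeries_of_isNoetherian_isArtinian R M
  refine ⟨s.length, s.toFun, ⟨s.strictMono.monotone, h0, h1⟩, fun t => ?_⟩
  exact (covBy_iff_quot_is_simple (s.strictMono.monotone (Fin.castSucc_lt_succ (i := t)).le)).1
    (s.step t)

theorem proj_eq_smul {R : Type u} [Ring R] {f : R} (hf : f * f = f) (z : Ideal.span {f}) :
    z = (z : R) • (⟨f, Ideal.mem_span_singleton_self f⟩ : Ideal.span {f}) :=
  Subtype.ext (coe_mul_of_mem_span hf z).symm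

/-- The homomorphism `R f → M` determined by an element of `M`. -/
def projLift {R : Type u} [Ring R] (f : R) {M : Type u} [AddCommGroup M] [Module R M] (m : M) :
    Ideal.span {f} →ₗ[R] M :=
  (LinearMap.toSpanSingleton R M m).comp (Ideal.span {f}).subtype

theorem projLift_apply {R : Type u} [Ring R] (f : R) {M : Type u} [AddCommGroup M] [Module R M]
    (m : M) (z : Ideal.span {f}) : projLift f m z = (z : R) • m := rfl

variable {R : Type u} [Ring R]

theorem IsVertexLabelling.isPrimitiveIdem {Λ : Type v} [Fintype Λ] {e : Λ → R}
    (he : IsVertexLabelling e) (i : Λ) : IsPrimitiveIdem (e i) :=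
  (isIndecomposable_span_iff (he.1.idem i).eq).1 (he.2.1 i)

theorem isSimpleModule_top_proj [IsArtinianRing R] {f : R} (hf : f * f = f)
    (h : IsPrimitiveIdem f) : IsSimpleModule R (Top R (Ideal.span {f})) :=
  isSimpleModule_iff_isCoatom.2 (h.isLocalModule hf).isCoatom_jacobson

/-- A simple module on which the primitive idempotent `f` does not vanish is the top of `R f`;
the isomorphism can be chosen such that it sends the class of `f` to a given element. -/
theorem exists_equiv_top_proj [IsArtinianRing R] {f : R} (hf : f * f = f)
    (h : IsPrimitiveIdem f) {S : Type u} [AddCommGroup S] [Module R S] [IsSimpleModule R S] {s : S}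
    (hs : f • s = s) (hs0 : s ≠ 0) :
    ∃ φ : Top R (Ideal.span {f}) ≃ₗ[R] S,
      φ (Submodule.Quotient.mk ⟨f, Ideal.mem_span_singleton_self f⟩) = s := by
  have hsurj : Function.Surjective (projLift f s) := by
    rw [← LinearMap.range_eq_top]
    refine (eq_bot_or_eq_top _).resolve_left fun hbot => hs0 ?_
    have : projLift f s ⟨f, Ideal.mem_span_singleton_self f⟩ = 0 := by
      rw [LinearMap.range_eq_bot.1 hbot]; rfl
    rwa [projLift_apply, hs] at this
  have hker : LinearMap.ker (projLift f s) = Module.jacobson R (Ideal.span {f}) := by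
    apply (h.isLocalModule hf).eq_jacobson
    rw [← isSimpleModule_iff_isCoatom]
    exact IsSimpleModule.congr ((projLift f s).quotKerEquivOfSurjective hsurj)
  refine ⟨(Submodule.quotEquivOfEq _ _ hker.symm).trans
    ((projLift f s).quotKerEquivOfSurjective hsurj), ?_⟩
  show projLift f s ⟨f, _⟩ = s
  rw [projLift_apply, hs]

theorem mk_top_proj_ne_zero [IsArtinianRing R] {f : R} (hf : f * f = f) (h : IsPrimitiveIdem f) :
    (Submodule.Quotient.mk ⟨f, Ideal.mem_span_singleton_self f⟩ : Top R (Ideal.span {f})) ≠ 0 := by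
  intro h0
  rw [Submodule.Quotient.mk_eq_zero] at h0
  apply (h.isLocalModule hf).isCoatom_jacobson.1
  rw [eq_top_iff]
  rintro z -
  rw [proj_eq_smul hf z]
  exact Submodule.smul_mem _ _ h0

theorem smul_mk_top_proj {f : R} (hf : f * f = f) :
    f • (Submodule.Quotient.mk ⟨f, Ideal.mem_span_singleton_self f⟩ : Top R (Ideal.span {f})) =
      Submodule.Quotient.mk ⟨f, Ideal.mem_span_singleton_self f⟩ := by
  rw [← Submodule.Quotient.mk_smul]
  congr 1
  exact Subtype.ext hf

variable (K : Type u) [Field K] [IsAlgClosed K] [Algebra K R] [Module.Finite K R]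

-- Two nonzero elements of `f S` are both images of the class of `f` in the top of `R f`, so an
-- automorphism of `S` carries one to the other; by Schur's lemma over an algebraically closed field
-- it is a scalar.
open Classical in
theorem finrank_fixedPart_simple {f : R} (hf : f * f = f) (h : IsPrimitiveIdem f)
    (S : Type u) [AddCommGroup S] [Module K S] [Module R S] [IsScalarTower K R S]
    [Module.Finite K S] [IsSimpleModule R S] :
    Module.finrank K (fixedPart K f S) =
      if Nonempty (S ≃ₗ[R] Top R (Ideal.span {f})) then 1 else 0 := by
  have := IsArtinianRing.of_finite K R
  split_ifs with hS
  · obtain ⟨φ⟩ := hS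
    let s := φ.symm (Submodule.Quotient.mk ⟨f, Ideal.mem_span_singleton_self f⟩)
    have hs : f • s = s := by rw [← map_smul, smul_mk_top_proj hf]
    have hs0 : s ≠ 0 := fun h0 => mk_top_proj_ne_zero hf h (by
      simpa [s] using h0)
    refine finrank_eq_one (⟨s, hs⟩ : fixedPart K f S) (fun h0 => hs0 (congrArg Subtype.val h0)) ?_
    rintro ⟨t, ht⟩
    by_cases ht0 : t = 0
    · exact ⟨0, Subtype.ext (by simp [ht0])⟩
    obtain ⟨α, hα⟩ := exists_equiv_top_proj hf h hs hs0
    obtain ⟨β, hβ⟩ := exists_equiv_top_proj hf h ht ht0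
    obtain ⟨c, hc⟩ := (IsSimpleModule.algebraMap_end_bijective_of_isAlgClosed (A := R) (V := S) K).2
      (α.symm.trans β).toLinearMap
    refine ⟨c, Subtype.ext ?_⟩
    have := LinearMap.congr_fun hc s
    rw [Module.algebraMap_end_apply] at this
    show c • s = t
    rw [this]
    show β (α.symm s) = t
    rw [← hβ, ← hα, LinearEquiv.symm_apply_apply]
  · rw [Module.finrank_zero_iff]
    constructor
    have key : ∀ a : fixedPart K f S, a = 0 := by
      rintro ⟨a, ha⟩
      by_contra h0
      obtain ⟨α, -⟩ := exists_equiv_top_proj hf h (s := a) ha (fun h1 => h0 (Subtype.ext h1))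
      exact hS ⟨α.symm⟩
    intro a b
    rw [key a, key b]

/-- Jordan-Hölder multiplicities are the dimensions of the vertex spaces. -/
theorem jhMultiplicity_iff {Λ : Type v} [Fintype Λ] {e : Λ → R} (he : IsVertexLabelling e)
    (M : Type u) [AddCommGroup M] [Module K M] [Module R M] [IsScalarTower K R M]
    [Module.Finite K M] (k : Λ) (m : ℕ) :
    JHMultiplicity R M (Simp e k) m ↔ Module.finrank K (fixedPart K (e k) M) = m := by
  classical
  have hk := (he.1.idem k).eq
  -- Every composition series gives the same count, so the converse may use an arbitrary one.
  have hcount : ∀ (r : ℕ) (F : Fin (r + 1) → Submodule R M), IsFiltration F →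
      (∀ t, IsSimpleModule R (Subquotient F t)) →
      countSubquotients F (Simp e k) = Module.finrank K (fixedPart K (e k) M) := by
    intro r F hF hs
    rw [finrank_fixedPart_filtration K hk F hF]
    have : ∀ t, Module.finrank K (fixedPart K (e k) (Subquotient F t)) =
        if Nonempty (Subquotient F t ≃ₗ[R] Simp e k) then 1 else 0 := fun t => by
      have := hs t
      exact finrank_fixedPart_simple K hk (he.isPrimitiveIdem k) (Subquotient F t)
    rw [Finset.sum_congr rfl fun t _ => this t, Finset.sum_boole, countSubquotients,
      Nat.card_eq_fintype_card, Fintype.card_subtype]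
    simp
  constructor
  · rintro ⟨r, F, hF, hs, rfl⟩
    exact (hcount r F hF hs).symm
  · rintro rfl
    have := IsArtinianRing.of_finite K R
    have : Module.Finite R M := Module.Finite.of_restrictScalars_finite K R M
    obtain ⟨r, F, hF, hs⟩ := exists_filtration_simple R M
    exact ⟨r, F, hF, hs, hcount r F hF hs⟩

/-- The kernel of `P(i) → Δ(i)` is generated by the vertex spaces `e_k P(i)` with `k ≰ i`. -/
theorem standardKernel_eq_span {R : Type u} [Ring R] (K : Type u) [Field K] [IsAlgClosed K]
    [Algebra K R] [Module.Finite K R] {Λ : Type v} [Fintype Λ] [PartialOrder Λ] {e : Λ → R}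
    (he : IsVertexLabelling e) (i : Λ) :
    standardKernel e i = Submodule.span R {z | ∃ k, ¬ k ≤ i ∧ e k • z = z} := by
  -- The condition on `N` says that `N` contains a fixed set, so the infimum of all such `N` is the
  -- span of this set.
  have hmem : ∀ N : Submodule R (Proj e i),
      (∀ k, ¬ k ≤ i → JHMultiplicity R (Proj e i ⧸ N) (Simp e k) 0) ↔
        {z | ∃ k, ¬ k ≤ i ∧ e k • z = z} ⊆ (N : Set (Proj e i)) := by
    intro N
    constructor
    · rintro h z ⟨k, hk, hz⟩
      have := (jhMultiplicity_iff K he _ k 0).1 (h k hk)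
      rw [Module.finrank_zero_iff] at this
      have h0 := this.elim ⟨N.mkQ z, by rw [mem_fixedPart, ← map_smul, hz]⟩ 0
      exact (Submodule.Quotient.mk_eq_zero N).1 (congrArg Subtype.val h0)
    · intro h k hk
      rw [jhMultiplicity_iff K he, Module.finrank_zero_iff]
      constructor
      have key : ∀ a : fixedPart K (e k) (Proj e i ⧸ N), a = 0 := by
        rintro ⟨a, ha⟩
        obtain ⟨z, rfl⟩ := N.mkQ_surjective a
        apply Subtype.ext
        show N.mkQ z = 0
        rw [← (ha : e k • N.mkQ z = N.mkQ z), ← map_smul]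
        exact (Submodule.Quotient.mk_eq_zero N).2
          (h ⟨k, hk, by rw [smul_smul, (he.1.idem k).eq]⟩)
      intro a b
      rw [key a, key b]
  apply le_antisymm
  · exact sInf_le ((hmem _).2 Submodule.subset_span)
  · exact le_sInf fun N hN => Submodule.span_le.2 ((hmem N).1 hN)

theorem finrank_fixedPart_standard_eq_zero {Λ : Type v} [Fintype Λ] [PartialOrder Λ] {e : Λ → R}
    (he : IsVertexLabelling e) {i k : Λ} (hk : ¬ k ≤ i) :
    Module.finrank K (fixedPart K (e k) (Standard e i)) = 0 := by
  rw [Module.finrank_zero_iff]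
  constructor
  have key : ∀ a : fixedPart K (e k) (Standard e i), a = 0 := by
    rintro ⟨a, ha⟩
    obtain ⟨z, rfl⟩ := (standardKernel e i).mkQ_surjective a
    apply Subtype.ext
    show (standardKernel e i).mkQ z = 0
    rw [← (ha : e k • (standardKernel e i).mkQ z = _), ← map_smul]
    refine (Submodule.Quotient.mk_eq_zero _).2 ?_
    rw [standardKernel_eq_span K he]
    exact Submodule.subset_span ⟨k, hk, by rw [smul_smul, (he.1.idem k).eq]⟩
  intro a b
  rw [key a, key b]

end JordanHolder

/-! ### Vertex labellings of the opposite algebra. -/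

section Op

open MulOpposite

variable {R : Type u} [Ring R] {Λ : Type v} [Fintype Λ] {e : Λ → R}

theorem IsPrimitiveIdem.op {f : R} (h : IsPrimitiveIdem f) :
    IsPrimitiveIdem (MulOpposite.op f) := by
  refine ⟨fun h0 => h.1 (op_injective h0), fun g hg h1 h2 => ?_⟩
  rcases h.2 (unop g) (congrArg unop hg) (congrArg unop h2) (congrArg unop h1) with h' | h'
  · exact Or.inl (unop_injective h')
  · exact Or.inr (unop_injective h')

theorem _root_.CompleteOrthogonalIdempotents.opLabel (he : CompleteOrthogonalIdempotents e) :
    CompleteOrthogonalIdempotents (opLabel e) := by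
  refine ⟨⟨fun i => congrArg op (he.idem i).eq, fun i j hij => congrArg op (he.ortho hij.symm)⟩, ?_⟩
  have := congrArg op he.complete
  rw [show op (∑ i, e i) = ∑ i, op (e i) from map_sum opAddEquiv e Finset.univ] at this
  exact this

theorem IsVertexLabelling.opLabel (he : IsVertexLabelling e) : IsVertexLabelling (opLabel e) := by
  have hop := he.1.opLabel
  refine ⟨hop, fun i => ?_, fun i j hij => ?_⟩
  · exact (isIndecomposable_span_iff (hop.idem i).eq).2 (he.isPrimitiveIdem i).op
  · obtain ⟨a, b, h1, h2, h3, h4, h5, h6⟩ :=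
      (nonempty_span_equiv_iff (hop.idem i).eq (hop.idem j).eq).1 hij
    refine he.2.2 i j ((nonempty_span_equiv_iff (he.1.idem i).eq (he.1.idem j).eq).2
      ⟨unop b, unop a, congrArg unop h4, congrArg unop h3, congrArg unop h2, congrArg unop h1,
        congrArg unop h5, congrArg unop h6⟩)

end Op

/-! ### The spaces f A g and factorization through vertices. -/

section Corner

variable (K : Type u) [Field K] {A : Type u} [Ring A] [Algebra K A]

/-- The subspace `f A g`, for idempotents `f` and `g`. -/
def corner (f g : A) : Submodule K A where
  carrier := {a | f * a = a ∧ a * g = a}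
  add_mem' {a b} ha hb := ⟨by rw [mul_add, ha.1, hb.1], by rw [add_mul, ha.2, hb.2]⟩
  zero_mem' := ⟨mul_zero f, zero_mul g⟩
  smul_mem' c a ha := ⟨by rw [mul_smul_comm, ha.1], by rw [smul_mul_assoc, ha.2]⟩

variable {K}

theorem mul_mem_corner {f g h k a b : A} (ha : a ∈ corner K f g) (hb : b ∈ corner K h k) :
    a * b ∈ corner K f k :=
  ⟨by rw [← mul_assoc, ha.1], by rw [mul_assoc, hb.2]⟩

theorem mul_mul_mem_corner {f g : A} (hf : f * f = f) (hg : g * g = g) (a : A) :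
    f * a * g ∈ corner K f g :=
  ⟨by rw [← mul_assoc, ← mul_assoc, hf], by rw [mul_assoc, hg]⟩

theorem finrank_fixedPart_proj {f g : A} (hg : g * g = g) :
    Module.finrank K (fixedPart K f (Ideal.span {g})) = Module.finrank K (corner K f g) := by
  refine LinearEquiv.finrank_eq
    { toFun := fun z => ⟨((z : Ideal.span {g}) : A), ?_, ?_⟩
      map_add' := fun x y => rfl
      map_smul' := fun c x => rfl
      invFun := fun a => ⟨⟨a, Ideal.mem_span_singleton'.2 ⟨a, a.2.2⟩⟩, Subtype.ext a.2.1⟩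
      left_inv := fun z => rfl
      right_inv := fun z => rfl }
  · exact congrArg Subtype.val z.2
  · exact coe_mul_of_mem_span hg _

variable {Λ : Type v} [PartialOrder Λ]

variable (K) in
/-- The part of `e_j A e_k` that factors through vertices `l > i`. -/
def above (e : Λ → A) (i j k : Λ) : Submodule K A :=
  Submodule.span K {w | ∃ l, i < l ∧ ∃ u ∈ corner K (e j) (e l), ∃ v ∈ corner K (e l) (e k),
    w = u * v}

variable (K) in
/-- The part of `e_j A e_i` that factors through vertices `k` with `i ≤ k` and `j ≤ k`. -/
def through (e : Λ → A) (j i : Λ) : Submodule K A :=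
  Submodule.span K {w | ∃ k, i ≤ k ∧ j ≤ k ∧ ∃ u ∈ corner K (e j) (e k),
    ∃ v ∈ corner K (e k) (e i), w = u * v}

variable {e : Λ → A}

theorem above_le_corner (i j k : Λ) : above K e i j k ≤ corner K (e j) (e k) := by
  refine Submodule.span_le.2 ?_
  rintro _ ⟨l, -, u, hu, v, hv, rfl⟩
  exact mul_mem_corner hu hv

theorem mul_mem_above_left {i j k s : Λ} {a c : A} (ha : a ∈ corner K (e s) (e j))
    (hc : c ∈ above K e i j k) : a * c ∈ above K e i s k := by
  induction hc using Submodule.span_induction with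
  | mem w hw =>
    obtain ⟨l, hl, u, hu, v, hv, rfl⟩ := hw
    rw [← mul_assoc]
    exact Submodule.subset_span ⟨l, hl, _, mul_mem_corner ha hu, v, hv, rfl⟩
  | zero => rw [mul_zero]; exact zero_mem _
  | add x y _ _ hx hy => rw [mul_add]; exact add_mem hx hy
  | smul t x _ hx => rw [mul_smul_comm]; exact Submodule.smul_mem _ t hx

theorem mul_mem_above_right {i j k s : Λ} {a c : A} (hc : c ∈ above K e i j k)
    (ha : a ∈ corner K (e k) (e s)) : c * a ∈ above K e i j s := by
  induction hc using Submodule.span_induction with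
  | mem w hw =>
    obtain ⟨l, hl, u, hu, v, hv, rfl⟩ := hw
    rw [mul_assoc]
    exact Submodule.subset_span ⟨l, hl, u, hu, _, mul_mem_corner hv ha, rfl⟩
  | zero => rw [zero_mul]; exact zero_mem _
  | add x y _ _ hx hy => rw [add_mul]; exact add_mem hx hy
  | smul t x _ hx => rw [smul_mul_assoc]; exact Submodule.smul_mem _ t hx

theorem through_le_above {i k : Λ} (hk : ¬ k ≤ i) : through K e k i ≤ above K e i k i := by
  refine Submodule.span_le.2 ?_
  rintro _ ⟨l, hl, hl', u, hu, v, hv, rfl⟩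
  refine Submodule.subset_span ⟨l, lt_of_le_of_ne hl ?_, u, hu, v, hv, rfl⟩
  rintro rfl
  exact hk hl'

theorem through_le_above' {i k : Λ} (hk : ¬ k ≤ i) : through K e i k ≤ above K e i i k := by
  refine Submodule.span_le.2 ?_
  rintro _ ⟨l, hl, hl', u, hu, v, hv, rfl⟩
  refine Submodule.subset_span ⟨l, lt_of_le_of_ne hl' ?_, u, hu, v, hv, rfl⟩
  rintro rfl
  exact hk hl

/-- If every `e_j A e_k` and `e_k A e_i` is spanned by a single element modulo the part that factors
through vertices above `k`, then the products of these elements span. -/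
theorem mul_mem_span_of_le [Finite Λ] {j i : Λ} {a b : Λ → A}
    (ha : ∀ k, a k ∈ corner K (e j) (e k))
    (ha' : ∀ k, ∀ c ∈ corner K (e j) (e k), ∃ t : K, c - t • a k ∈ above K e k j k)
    (hb' : ∀ k, ∀ c ∈ corner K (e k) (e i), ∃ t : K, c - t • b k ∈ above K e k k i)
    (s : Λ) : ∀ u ∈ corner K (e j) (e s), ∀ v ∈ corner K (e s) (e i),
      u * v ∈ Submodule.span K {w | ∃ k, s ≤ k ∧ w = a k * b k} := by
  -- Descending induction: `u` and `v` are multiples of `a s` and `b s` up to elements that factor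
  -- through some `l > s`, and products with those are covered by the hypothesis at `l`.
  induction s using (wellFounded_gt (α := Λ)).induction with
  | _ s ih =>
  have hmono : ∀ l, s < l → Submodule.span K {w | ∃ k, l ≤ k ∧ w = a k * b k} ≤
      Submodule.span K {w | ∃ k, s ≤ k ∧ w = a k * b k} := fun l hl =>
    Submodule.span_mono fun w ⟨k, hk, hw⟩ => ⟨k, hl.le.trans hk, hw⟩
  have h1 : ∀ c ∈ above K e s j s, ∀ v ∈ corner K (e s) (e i),
      c * v ∈ Submodule.span K {w | ∃ k, s ≤ k ∧ w = a k * b k} := by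
    intro c hc v hv
    induction hc using Submodule.span_induction with
    | mem w hw =>
      obtain ⟨l, hl, u₁, hu₁, u₂, hu₂, rfl⟩ := hw
      rw [mul_assoc]
      exact hmono l hl (ih l hl u₁ hu₁ _ (mul_mem_corner hu₂ hv))
    | zero => rw [zero_mul]; exact zero_mem _
    | add x y _ _ hx hy => rw [add_mul]; exact add_mem hx hy
    | smul t x _ hx => rw [smul_mul_assoc]; exact Submodule.smul_mem _ t hx
  have h2 : ∀ c ∈ above K e s s i, ∀ u ∈ corner K (e j) (e s),
      u * c ∈ Submodule.span K {w | ∃ k, s ≤ k ∧ w = a k * b k} := by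
    intro c hc u hu
    induction hc using Submodule.span_induction with
    | mem w hw =>
      obtain ⟨l, hl, u₁, hu₁, u₂, hu₂, rfl⟩ := hw
      rw [← mul_assoc]
      exact hmono l hl (ih l hl _ (mul_mem_corner hu hu₁) _ hu₂)
    | zero => rw [mul_zero]; exact zero_mem _
    | add x y _ _ hx hy => rw [mul_add]; exact add_mem hx hy
    | smul t x _ hx => rw [mul_smul_comm]; exact Submodule.smul_mem _ t hx
  intro u hu v hv
  obtain ⟨t, ht⟩ := ha' s u hu
  obtain ⟨t', ht'⟩ := hb' s v hv
  have : u * v = (u - t • a s) * v + t • (a s * (v - t' • b s)) + (t * t') • (a s * b s) := by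
    rw [sub_mul, mul_sub, smul_sub, smul_mul_assoc, mul_smul_comm, smul_smul]; abel
  rw [this]
  exact add_mem (add_mem (h1 _ ht v hv) (Submodule.smul_mem _ _ (h2 _ ht' _ (ha s))))
    (Submodule.smul_mem _ _ (Submodule.subset_span ⟨s, le_rfl, rfl⟩))

end Corner

/-! ### The elementwise description of 1-quasi-hereditary algebras. -/

section Core

variable (K : Type u) [Field K] {A : Type u} [Ring A] [Algebra K A]
  {Λ : Type v} [Fintype Λ] [PartialOrder Λ]

/-- A description of 1-quasi-hereditary algebras by elements, which is invariant under passing to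
the opposite algebra: `x i` generates the submodule of `P(top)` isomorphic to `Δ(i)`, and `y i`
generates the submodule of the right module `e_top A` isomorphic to the standard right module. -/
structure IsCore (one top : Λ) (e x y : Λ → A) : Prop where
  idem : CompleteOrthogonalIdempotents e
  one_le : ∀ i, one ≤ i
  le_top : ∀ i, i ≤ top
  x_mem : ∀ i, x i ∈ corner K (e i) (e top)
  y_mem : ∀ i, y i ∈ corner K (e top) (e i)
  -- This number is the sum over `k` of (P(i) : Δ(k)) [Δ(k) : S(j)].
  finrank_corner : ∀ j i, Module.finrank K (corner K (e j) (e i)) = Nat.card {k // i ≤ k ∧ j ≤ k}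
  mul_ne_zero : x one * y one ≠ 0
  -- In module terms, every nonzero submodule of P(j) contains x_1 y_j; the next field is the
  -- analogue for the right module e_j A.
  socle_left : ∀ j u, u * e j = u → u ≠ 0 → ∃ c, c * u = x one * y j
  socle_right : ∀ j u, e j * u = u → u ≠ 0 → ∃ c, u * c = x j * y one
  x_iff : ∀ i j, (∃ c ∈ corner K (e j) (e i), c * x i ≠ 0) ↔ j ≤ i
  y_iff : ∀ i j, (∃ c ∈ corner K (e i) (e j), y i * c ≠ 0) ↔ j ≤ i
  -- The annihilator of `x i` in P(i) is the kernel of P(i) → Δ(i), which consists of elements that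
  -- factor through vertices above `i`.
  x_ker : ∀ i j, ∀ c ∈ corner K (e j) (e i), c * x i = 0 → c ∈ above K e i j i
  y_ker : ∀ i j, ∀ c ∈ corner K (e i) (e j), y i * c = 0 → c ∈ above K e i i j

end Core

/-! ### Multiplicities in filtrations by standard modules. -/

section StandardFiltration

variable {K : Type u} [Field K] {A : Type u} [Ring A] [Algebra K A]
  {Λ : Type v} [PartialOrder Λ] {e : Λ → A}

/-- The incidence matrix of a finite order is unitriangular, hence invertible; the induction
descends from the maximal elements. -/
theorem eq_zero_of_sum_up_eq_zero [Fintype Λ] (c : Λ → ℤ) [DecidableLE Λ]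
    (h : ∀ j, ∑ k, (if j ≤ k then c k else 0) = 0) (k : Λ) : c k = 0 := by
  induction k using (wellFounded_gt (α := Λ)).induction with
  | _ k ih =>
  have := h k
  rw [Finset.sum_eq_single k] at this
  · simpa using this
  · intro l _ hl
    split_ifs with hkl
    · exact ih l (lt_of_le_of_ne hkl hl.symm)
    · rfl
  · simp

open Classical in
/-- The dimensions of the vertex spaces of the standard modules, as in condition (2) of the
definition of 1-quasi-hereditary algebras. -/
def HasUnitStandardDims (K : Type u) [Field K] [Algebra K A] (e : Λ → A) : Prop :=
  ∀ j k, Module.finrank K (fixedPart K (e j) (Standard e k)) = if j ≤ k then 1 else 0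

/-- The vertices that occur in Δ(k) form the set of all `j ≤ k`, which determines `k`. -/
theorem HasUnitStandardDims.eq_of_equiv (hd : HasUnitStandardDims K e) {k l : Λ}
    (h : Nonempty (Standard e k ≃ₗ[A] Standard e l)) : k = l := by
  obtain ⟨φ⟩ := h
  have key : ∀ j, j ≤ k ↔ j ≤ l := by
    intro j
    have h1 := hd j k
    rw [finrank_fixedPart_congr K (e j) φ, hd j l] at h1
    by_cases h2 : j ≤ k <;> by_cases h3 : j ≤ l <;> simp_all
  exact le_antisymm ((key k).1 le_rfl) ((key l).2 le_rfl)

open Classical in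
theorem HasUnitStandardDims.finrank_fixedPart [Fintype Λ] (hd : HasUnitStandardDims K e)
    (he : ∀ i, e i * e i = e i)
    {M : Type u} [AddCommGroup M] [Module K M] [Module A M] [IsScalarTower K A M]
    [Module.Finite K M] {r : ℕ} {F : Fin (r + 1) → Submodule A M} (hF : IsFiltration F)
    (hs : ∀ t, ∃ k, Nonempty (Subquotient F t ≃ₗ[A] Standard e k)) (j : Λ) :
    Module.finrank K (fixedPart K (e j) M) =
      ∑ k, if j ≤ k then countSubquotients F (Standard e k) else 0 := by
  choose κ hκ using hs
  have hiff : ∀ t k, Nonempty (Subquotient F t ≃ₗ[A] Standard e k) ↔ κ t = k := by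
    intro t k
    obtain ⟨φ⟩ := hκ t
    constructor
    · rintro ⟨ψ⟩
      exact hd.eq_of_equiv ⟨φ.symm.trans ψ⟩
    · rintro rfl
      exact ⟨φ⟩
  have hcount : ∀ k, countSubquotients F (Standard e k) = ∑ t, if κ t = k then 1 else 0 := by
    intro k
    rw [countSubquotients, Nat.card_eq_fintype_card, Fintype.card_subtype, Finset.sum_boole,
      Nat.cast_id]
    congr 1
    ext t
    simp [hiff]
  rw [finrank_fixedPart_filtration K (he j) F hF]
  have hdim : ∀ t, Module.finrank K (fixedPart K (e j) (Subquotient F t)) =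
      ∑ k, if κ t = k then (if j ≤ k then 1 else 0) else 0 := by
    intro t
    obtain ⟨φ⟩ := hκ t
    rw [finrank_fixedPart_congr K (e j) φ, hd, Finset.sum_ite_eq]
    simp
  rw [Finset.sum_congr rfl fun t _ => hdim t, Finset.sum_comm]
  refine Finset.sum_congr rfl fun k _ => ?_
  rw [hcount]
  split_ifs <;> simp

/-- Two standard filtrations produce the same vertex dimensions, and inverting the incidence matrix
gives equal counts. This is needed because `StandardMultiplicity` may be witnessed by a different
filtration for every `k`. -/
theorem HasUnitStandardDims.countSubquotients_eq [Fintype Λ] (hd : HasUnitStandardDims K e)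
    (he : ∀ i, e i * e i = e i)
    {M : Type u} [AddCommGroup M] [Module K M] [Module A M] [IsScalarTower K A M]
    [Module.Finite K M] {r : ℕ} {F : Fin (r + 1) → Submodule A M} (hF : IsFiltration F)
    (hs : ∀ t, ∃ k, Nonempty (Subquotient F t ≃ₗ[A] Standard e k))
    {k : Λ} {m : ℕ} (h : StandardMultiplicity e M k m) :
    countSubquotients F (Standard e k) = m := by
  classical
  obtain ⟨r', F', hF', hs', rfl⟩ := h
  have := eq_zero_of_sum_up_eq_zero (fun k => (countSubquotients F (Standard e k) : ℤ) -
    countSubquotients F' (Standard e k)) (fun j => by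
      have h1 := hd.finrank_fixedPart he hF hs j
      rw [hd.finrank_fixedPart he hF' hs' j] at h1
      have h2 : ∀ k, (if j ≤ k then (countSubquotients F (Standard e k) : ℤ) -
          countSubquotients F' (Standard e k) else 0) =
          ((if j ≤ k then countSubquotients F (Standard e k) else 0 : ℕ) : ℤ) -
          ((if j ≤ k then countSubquotients F' (Standard e k) else 0 : ℕ) : ℤ) := by
        intro k
        split_ifs <;> simp
      rw [Finset.sum_congr rfl fun k _ => h2 k, Finset.sum_sub_distrib, ← Nat.cast_sum,
        ← Nat.cast_sum, h1, sub_self]) k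
  omega

/-- If the subquotients of a standard filtration of `P(i)` are `Δ(k)` with `i ≤ k`, then every
element of `e_j A e_i` factors through vertices `k` with `i ≤ k` and `j ≤ k`. -/
theorem HasUnitStandardDims.corner_le_through [Module.Finite K A]
    (hd : HasUnitStandardDims K e)
    (he : ∀ i, e i * e i = e i) {i : Λ} {r : ℕ} {F : Fin (r + 1) → Submodule A (Proj e i)}
    (hF : IsFiltration F)
    (hs : ∀ t, ∃ k, i ≤ k ∧ Nonempty (Subquotient F t ≃ₗ[A] Standard e k)) (j : Λ) :
    corner K (e j) (e i) ≤ through K e j i := by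
  have key : ∀ s : Fin (r + 1), ∀ z ∈ F s, e j • z = z → (z : A) ∈ through K e j i := by
    intro s
    induction s using Fin.induction with
    | zero =>
      intro z hz _
      rw [hF.2.1, Submodule.mem_bot] at hz
      rw [hz]
      exact zero_mem _
    | succ t ih =>
      intro z hz hjz
      obtain ⟨k, hik, ⟨ψ⟩⟩ := hs t
      let X := (F t.castSucc).submoduleOf (F t.succ)
      have hmk : ∀ z' : F t.succ, X.mkQ z' = 0 → (z' : Proj e i) ∈ F t.castSucc := fun z' h =>
        (Submodule.Quotient.mk_eq_zero X).1 h
      let zb : Subquotient F t := X.mkQ ⟨z, hz⟩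
      have hzb : e j • zb = zb := by
        show e j • X.mkQ ⟨z, hz⟩ = X.mkQ ⟨z, hz⟩
        rw [← map_smul]
        exact congrArg X.mkQ (Subtype.ext hjz)
      by_cases hjk : j ≤ k
      -- The subquotient is generated by a lift e_k u₀ of the generator of Δ(k). Modulo the previous
      -- step, `z` equals the product of e_j c and e_k u₀, which passes through the vertex `k`.
      · obtain ⟨c, hc⟩ := (standardKernel e k).mkQ_surjective (ψ zb)
        let g : Proj e k := ⟨e k, Ideal.mem_span_singleton_self _⟩
        obtain ⟨u₀, hu₀⟩ := X.mkQ_surjective (ψ.symm ((standardKernel e k).mkQ g))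
        have hgk : e k • g = g := Subtype.ext (he k)
        have hu : X.mkQ (e k • u₀) = ψ.symm ((standardKernel e k).mkQ g) := by
          rw [map_smul, hu₀, ← map_smul, ← map_smul, hgk]
        have h1 : zb = (c : A) • X.mkQ (e k • u₀) := by
          rw [hu, ← map_smul, ← map_smul, ← proj_eq_smul (he k) c, hc,
            LinearEquiv.symm_apply_apply]
        have h2 : X.mkQ (⟨z, hz⟩ - (e j * (c : A)) • (e k • u₀)) = 0 := by
          rw [map_sub, map_smul, mul_smul, ← h1, hzb]
          exact sub_self _
        have h3 := ih _ (hmk _ h2) (by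
          show e j • (z - (e j * (c : A)) • (e k • (u₀ : Proj e i))) = _
          rw [smul_sub, hjz, smul_smul, ← mul_assoc, he]
          rfl)
        have h4 : (z : A) = (z - (e j * (c : A)) • (e k • (u₀ : Proj e i)) : Proj e i) +
            (e j * (c : A)) * (e k * ((u₀ : Proj e i) : A)) := by
          show (z : A) = ((z : A) - (e j * (c : A)) * (e k * ((u₀ : Proj e i) : A))) + _
          rw [sub_add_cancel]
        rw [h4]
        refine add_mem h3 (Submodule.subset_span ⟨k, hik, hjk, _, ⟨?_, ?_⟩, _, ⟨?_, ?_⟩, rfl⟩)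
        · rw [← mul_assoc, he]
        · rw [mul_assoc, coe_mul_of_mem_span (he k)]
        · rw [← mul_assoc, he]
        · rw [mul_assoc, coe_mul_of_mem_span (he i)]
      -- Here the vertex `j` does not occur in Δ(k), so `z` already lies in the previous step of the
      -- filtration.
      · have h0 := hd j k
        rw [if_neg hjk, ← finrank_fixedPart_congr K (e j) ψ, Module.finrank_zero_iff] at h0
        have : zb = 0 := congrArg Subtype.val (h0.elim ⟨zb, hzb⟩ 0)
        exact ih z (hmk _ this) hjz
  intro a ha
  exact key (Fin.last r) ⟨a, Ideal.mem_span_singleton'.2 ⟨a, ha.2⟩⟩ (by rw [hF.2.2]; trivial)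
    (Subtype.ext ha.1)

end StandardFiltration

end OneQH

namespace OneQH

open MulOpposite

/-! ### Generators of the standard modules inside P(top) and e_top A. -/

section Standard

variable {K : Type u} [Field K] {A : Type u} [Ring A] [Algebra K A]
  {Λ : Type v} {e : Λ → A}

/-- An element `c` with `c f = c`, as an element of `A f`. -/
def toSpan {f : A} (c : A) (h : c * f = c) : Ideal.span {f} :=
  ⟨c, Ideal.mem_span_singleton'.2 ⟨c, h⟩⟩

/-- An element `c` with `e_i c = c`, as an element of the right module `e_i A`. -/
def opToProj {i : Λ} (c : A) (h : e i * c = c) : Proj (opLabel e) i :=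
  ⟨op c, Ideal.mem_span_singleton'.2 ⟨op c, congrArg op h⟩⟩

theorem StdDual.smul_form {M : Type u} [AddCommGroup M] [Module K M] [Module Aᵐᵒᵖ M]
    [IsScalarTower K Aᵐᵒᵖ M] (a : A) (φ : StdDual K A M) (m : M) :
    (a • φ).form m = φ.form (op a • m) := rfl

/-- A linear form as an element of the dual module. -/
def StdDual.of {M : Type u} [AddCommGroup M] [Module K M] (φ : M →ₗ[K] K) : StdDual K A M := φ

/-- A homomorphism between dual modules, followed by the evaluation at an element, is the evaluation
at some element. -/
theorem StdDual.exists_eval {M N : Type u} [AddCommGroup M] [Module K M] [Module Aᵐᵒᵖ M]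
    [IsScalarTower K Aᵐᵒᵖ M] [Module.Finite K M] [AddCommGroup N] [Module K N] [Module Aᵐᵒᵖ N]
    [IsScalarTower K Aᵐᵒᵖ N] (g : StdDual K A M →ₗ[A] StdDual K A N) (n : N) :
    ∃ m : M, ∀ ξ : StdDual K A M, (g ξ).form n = ξ.form m := by
  let E : Module.Dual K (Module.Dual K M) :=
    { toFun := fun ξ => (g (StdDual.of ξ)).form n
      map_add' := fun ξ η => congrArg (fun φ : StdDual K A N => φ.form n)
        (map_add g (StdDual.of ξ) (StdDual.of η))
      map_smul' := fun c ξ => by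
        have h1 : (StdDual.of (c • ξ : Module.Dual K M) : StdDual K A M) =
            algebraMap K A c • StdDual.of ξ := by
          apply LinearMap.ext
          intro m
          show c • ξ m = ξ (op (algebraMap K A c) • m)
          rw [← MulOpposite.algebraMap_apply, algebraMap_smul, map_smul]
        have h2 := congrArg (fun φ : StdDual K A N => φ.form n) (congrArg g h1)
        simp only [map_smul] at h2
        refine h2.trans ?_
        rw [StdDual.smul_form, ← MulOpposite.algebraMap_apply, algebraMap_smul, map_smul]
        rfl }
  obtain ⟨m, hm⟩ := (Module.bijective_dual_eval K M).2 E
  exact ⟨m, fun ξ => (LinearMap.congr_fun hm ξ).symm⟩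

variable [Module.Finite K A] [Fintype Λ] [PartialOrder Λ] [IsAlgClosed K]

theorem standardKernel_eq_bot {A : Type u} [Ring A] (K : Type u) [Field K] [IsAlgClosed K]
    [Algebra K A] [Module.Finite K A] {e : Λ → A} (he : IsVertexLabelling e) {top : Λ}
    (htop : ∀ i, i ≤ top) :
    standardKernel e top = ⊥ := by
  rw [standardKernel_eq_span K he, Submodule.span_eq_bot]
  rintro z ⟨k, hk, -⟩
  exact absurd (htop k) hk

-- Since Δ(top) = P(top), the given monomorphism is right multiplication by a lift `x` of the image
-- of the generator, and injectivity says that the annihilator of `x` is exactly the kernel of P(i)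
-- → Δ(i).
variable (K) in
theorem exists_left_generator (he : IsVertexLabelling e) {top : Λ} (htop : ∀ i, i ≤ top) {i : Λ}
    (f : Standard e i →ₗ[A] Standard e top) (hf : Function.Injective f) :
    ∃ x ∈ corner K (e i) (e top), ∀ (c : A) (hc : c * e i = c),
      c * x = 0 ↔ toSpan c hc ∈ standardKernel e i := by
  have hid := fun i => (he.1.idem i).eq
  obtain ⟨w, hw⟩ := (standardKernel e top).mkQ_surjective
    (f ((standardKernel e i).mkQ (toSpan (e i) (hid i))))
  refine ⟨e i * w, ⟨by rw [← mul_assoc, hid], by rw [mul_assoc, coe_mul_of_mem_span (hid top)]⟩,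
    fun c hc => ?_⟩
  have h1 : f ((standardKernel e i).mkQ (toSpan c hc)) = (standardKernel e top).mkQ (c • w) := by
    have : toSpan c hc = c • toSpan (e i) (hid i) := Subtype.ext hc.symm
    rw [this, map_smul, map_smul, ← hw, map_smul]
  have h2 : toSpan c hc ∈ standardKernel e i ↔ (standardKernel e i).mkQ (toSpan c hc) = 0 :=
    (Submodule.Quotient.mk_eq_zero _).symm
  rw [h2, ← map_eq_zero_iff f hf, h1, ← mul_assoc, hc]
  constructor
  · intro h
    rw [show c • w = 0 from Subtype.ext h, map_zero]
  · intro h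
    have : c • w ∈ standardKernel e top := (Submodule.Quotient.mk_eq_zero _).1 h
    rw [standardKernel_eq_bot K he htop, Submodule.mem_bot] at this
    exact congrArg Subtype.val this

/-- The epimorphism of costandard modules is the transpose of a monomorphism of right standard
modules; `y` is the image of the generator under that monomorphism. -/
theorem exists_right_generator (he : IsVertexLabelling e) {top : Λ} (htop : ∀ i, i ≤ top) {i : Λ}
    (g : Costandard K e top →ₗ[A] Costandard K e i) (hg : Function.Surjective g) :
    ∃ y ∈ corner K (e top) (e i), ∀ (c : A) (hc : e i * c = c),
      y * c = 0 ↔ opToProj c hc ∈ standardKernel (opLabel e) i := by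
  have hid := fun i => (he.1.idem i).eq
  have hid' := fun i => (he.opLabel.1.idem i).eq
  -- Reflexivity of finite-dimensional spaces supplies the image of the generator under the
  -- transpose of `g`.
  obtain ⟨m, hm⟩ := StdDual.exists_eval g
    ((standardKernel (opLabel e) i).mkQ (opToProj (e i) (hid i)))
  obtain ⟨w, rfl⟩ := (standardKernel (opLabel e) top).mkQ_surjective m
  have hw : e top * unop (w : Aᵐᵒᵖ) = unop (w : Aᵐᵒᵖ) :=
    congrArg unop (coe_mul_of_mem_span (hid' top) w)
  refine ⟨unop (w : Aᵐᵒᵖ) * e i, ⟨by rw [← mul_assoc, hw], by rw [mul_assoc, hid]⟩, fun c hc => ?_⟩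
  have key : ∀ ξ, (g ξ).form ((standardKernel (opLabel e) i).mkQ
      (opToProj c hc)) =
        ξ.form ((standardKernel (opLabel e) top).mkQ (op c • w)) := by
    intro ξ
    have : opToProj c hc = op c • opToProj (e i) (hid i) :=
      Subtype.ext (congrArg op hc).symm
    rw [this, map_smul, ← StdDual.smul_form, ← map_smul, hm, StdDual.smul_form,
      ← map_smul (standardKernel (opLabel e) top).mkQ]
  have h2 : opToProj c hc ∈ standardKernel (opLabel e) i ↔
      (standardKernel (opLabel e) i).mkQ (opToProj c hc) = 0 :=
    (Submodule.Quotient.mk_eq_zero _).symm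
  rw [h2, mul_assoc, hc]
  constructor
  · intro h
    have h3 : op c • w = 0 := Subtype.ext (congrArg op h)
    refine (Module.forall_dual_apply_eq_zero_iff K _).1 fun η => ?_
    obtain ⟨ξ, rfl⟩ := hg η
    refine (key ξ).trans ?_
    rw [h3, map_zero, map_zero]
  · intro h
    have h3 : (standardKernel (opLabel e) top).mkQ (op c • w) = 0 := by
      refine (Module.forall_dual_apply_eq_zero_iff K _).1 fun ξ => ?_
      refine (key ξ).symm.trans ?_
      rw [h, map_zero]
    have h4 : op c • w ∈ standardKernel (opLabel e) top := (Submodule.Quotient.mk_eq_zero _).1 h3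
    rw [standardKernel_eq_bot K he.opLabel htop, Submodule.mem_bot] at h4
    exact congrArg (fun z : Proj (opLabel e) top => unop (z : Aᵐᵒᵖ)) h4

/-- The kernel is generated by vertex spaces at `k ≰ i`. Their elements factor through some `l` with
`i ≤ l` and `k ≤ l`, and `l = i` is impossible. -/
theorem mem_above_of_mem_standardKernel (he : IsVertexLabelling e)
    (hT : ∀ j i, corner K (e j) (e i) ≤ through K e j i) {i j : Λ} {c : A}
    (hc : c ∈ corner K (e j) (e i)) (h : toSpan c hc.2 ∈ standardKernel e i) :
    c ∈ above K e i j i := by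
  have hid := fun i => (he.1.idem i).eq
  rw [standardKernel_eq_span K he] at h
  have key : ∀ z ∈ Submodule.span A {z : Proj e i | ∃ k, ¬ k ≤ i ∧ e k • z = z}, ∀ a : A,
      e j * a * (z : A) ∈ above K e i j i := by
    intro z hz
    induction hz using Submodule.span_induction with
    | mem w hw =>
      intro a
      obtain ⟨k, hk, hw⟩ := hw
      have hw' : e k * (w : A) = w := congrArg Subtype.val hw
      have h1 : (w : A) ∈ above K e i k i :=
        through_le_above hk (hT k i ⟨hw', coe_mul_of_mem_span (hid i) w⟩)
      rw [← hw', ← mul_assoc]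
      exact mul_mem_above_left (mul_mul_mem_corner (hid j) (hid k) a) h1
    | zero =>
      intro a
      show e j * a * 0 ∈ _
      rw [mul_zero]
      exact zero_mem _
    | add x y _ _ hx hy =>
      intro a
      show e j * a * ((x : A) + y) ∈ _
      rw [mul_add]
      exact add_mem (hx a) (hy a)
    | smul t x _ hx =>
      intro a
      show e j * a * (t * (x : A)) ∈ _
      rw [← mul_assoc, mul_assoc (e j)]
      exact hx _
  have := key _ h 1
  rwa [mul_one, show ((toSpan c hc.2 : Proj e i) : A) = c from rfl, hc.1] at this

theorem mem_above_of_op_mem_standardKernel (he : IsVertexLabelling e)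
    (hT : ∀ j i, corner K (e j) (e i) ≤ through K e j i) {i j : Λ} {c : A}
    (hc : c ∈ corner K (e i) (e j))
    (h : opToProj c hc.1 ∈ standardKernel (opLabel e) i) :
    c ∈ above K e i i j := by
  have hid := fun i => (he.1.idem i).eq
  have hid' := fun i => (he.opLabel.1.idem i).eq
  rw [standardKernel_eq_span K he.opLabel] at h
  have key : ∀ z ∈ Submodule.span Aᵐᵒᵖ
      {z : Proj (opLabel e) i | ∃ k, ¬ k ≤ i ∧ opLabel e k • z = z}, ∀ a : A,
      unop (z : Aᵐᵒᵖ) * (a * e j) ∈ above K e i i j := by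
    intro z hz
    induction hz using Submodule.span_induction with
    | mem w hw =>
      intro a
      obtain ⟨k, hk, hw⟩ := hw
      have hw' : unop (w : Aᵐᵒᵖ) * e k = unop (w : Aᵐᵒᵖ) :=
        congrArg (fun z : Proj (opLabel e) i => unop (z : Aᵐᵒᵖ)) hw
      have h1 : unop (w : Aᵐᵒᵖ) ∈ above K e i i k :=
        through_le_above' hk (hT i k ⟨congrArg unop (coe_mul_of_mem_span (hid' i) w), hw'⟩)
      rw [← hw', mul_assoc, ← mul_assoc (e k)]
      exact mul_mem_above_right h1 (mul_mul_mem_corner (hid k) (hid j) a)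
    | zero =>
      intro a
      show 0 * (a * e j) ∈ _
      rw [zero_mul]
      exact zero_mem _
    | add x y _ _ hx hy =>
      intro a
      show (unop (x : Aᵐᵒᵖ) + unop (y : Aᵐᵒᵖ)) * (a * e j) ∈ _
      rw [add_mul]
      exact add_mem (hx a) (hy a)
    | smul t x _ hx =>
      intro a
      show (unop (x : Aᵐᵒᵖ) * unop t) * (a * e j) ∈ _
      rw [mul_assoc, ← mul_assoc (unop t)]
      exact hx _
  have := key _ h 1
  rwa [one_mul, show unop ((opToProj c hc.1 : Proj (opLabel e) i) : Aᵐᵒᵖ) = c from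
    rfl, hc.2] at this

end Standard

/-! ### One-dimensional quotients of the spaces e_j A e_i. -/

section Generators

variable {K : Type u} [Field K] {A : Type u} [Ring A] [Algebra K A]
  {Λ : Type v} [PartialOrder Λ] {e : Λ → A}

theorem exists_smul_eq_of_finrank_eq_one {V : Type u} [AddCommGroup V] [Module K V]
    {X : Submodule K V} (h : Module.finrank K X = 1) {x z : V} (hx : x ∈ X) (hx0 : x ≠ 0)
    (hz : z ∈ X) : ∃ t : K, t • x = z := by
  obtain ⟨t, ht⟩ := (finrank_eq_one_iff_of_nonzero' (⟨x, hx⟩ : X)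
    (fun h0 => hx0 (congrArg Subtype.val h0))).1 h ⟨z, hz⟩
  exact ⟨t, congrArg Subtype.val ht⟩

/-- Modulo the elements that factor through vertices above `i`, the space `e_j A e_i` is spanned by
one element. -/
theorem exists_left_basis {top i j : Λ} {x : A}
    (hdim : Module.finrank K (corner K (e j) (e top)) = 1)
    (hx : x ∈ corner K (e i) (e top))
    (hker : ∀ c ∈ corner K (e j) (e i), c * x = 0 → c ∈ above K e i j i) :
    ∃ b ∈ corner K (e j) (e i), ∀ c ∈ corner K (e j) (e i),
      ∃ t : K, c - t • b ∈ above K e i j i := by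
  by_cases h : ∃ b ∈ corner K (e j) (e i), b * x ≠ 0
  · obtain ⟨b, hb, hb0⟩ := h
    refine ⟨b, hb, fun c hc => ?_⟩
    obtain ⟨t, ht⟩ := exists_smul_eq_of_finrank_eq_one hdim (mul_mem_corner hb hx) hb0
      (mul_mem_corner hc hx)
    refine ⟨t, hker _ (sub_mem hc (Submodule.smul_mem _ _ hb)) ?_⟩
    rw [sub_mul, smul_mul_assoc, ht, sub_self]
  · push Not at h
    refine ⟨0, zero_mem _, fun c hc => ⟨0, ?_⟩⟩
    rw [smul_zero, sub_zero]
    exact hker c hc (h c hc)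

/-- Mirror image of `exists_left_basis`. When `y` annihilates the whole space, `b` is 0; the
additional clause allows one to conclude `y * b ≠ 0` once `b` is known to be nonzero. -/
theorem exists_right_basis {top i j : Λ} {y : A}
    (hdim : Module.finrank K (corner K (e top) (e j)) = 1) (hy : y ∈ corner K (e top) (e i))
    (hker : ∀ c ∈ corner K (e i) (e j), y * c = 0 → c ∈ above K e i i j) :
    ∃ b ∈ corner K (e i) (e j), (b ≠ 0 → y * b ≠ 0) ∧
      ∀ c ∈ corner K (e i) (e j), ∃ t : K, c - t • b ∈ above K e i i j := by
  by_cases h : ∃ b ∈ corner K (e i) (e j), y * b ≠ 0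
  · obtain ⟨b, hb, hb0⟩ := h
    refine ⟨b, hb, fun _ => hb0, fun c hc => ?_⟩
    obtain ⟨t, ht⟩ := exists_smul_eq_of_finrank_eq_one hdim (mul_mem_corner hy hb) hb0
      (mul_mem_corner hy hc)
    refine ⟨t, hker _ (sub_mem hc (Submodule.smul_mem _ _ hb)) ?_⟩
    rw [mul_sub, mul_smul_comm, ht, sub_self]
  · push Not at h
    refine ⟨0, zero_mem _, fun h0 => absurd rfl h0, fun c hc => ⟨0, ?_⟩⟩
    rw [smul_zero, sub_zero]
    exact hker c hc (h c hc)

end Generators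

/-! ### Duality between submodules of M and of its dual. -/

section Dual

variable {K : Type u} [Field K] {A : Type u}

instance StdDual.instModuleBase {M : Type u} [AddCommGroup M] [Module K M] :
    Module K (StdDual K A M) :=
  (LinearMap.module : Module K (M →ₗ[K] K))

instance StdDual.instIsScalarTower [Ring A] [Algebra K A] {M : Type u} [AddCommGroup M]
    [Module K M] [Module Aᵐᵒᵖ M]
    [IsScalarTower K Aᵐᵒᵖ M] : IsScalarTower K A (StdDual K A M) where
  smul_assoc c a φ := LinearMap.ext fun m => by
    show φ.form (op (c • a) • m) = c • φ.form (op a • m)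
    rw [op_smul, smul_assoc, map_smul]

instance StdDual.instFinite {M : Type u} [AddCommGroup M] [Module K M] [Module.Finite K M] :
    Module.Finite K (StdDual K A M) :=
  (inferInstance : Module.Finite K (M →ₗ[K] K))

variable {M : Type u} [AddCommGroup M] [Module K M]

theorem StdDual.form_sub (φ ψ : StdDual K A M) (m : M) :
    (φ - ψ).form m = φ.form m - ψ.form m := rfl

theorem StdDual.form_smul (c : K) (φ : StdDual K A M) (m : M) :
    (c • φ).form m = c • φ.form m := rfl

theorem StdDual.exists_form_ne_zero {n : M} (hn : n ≠ 0) : ∃ φ : StdDual K A M, φ.form n ≠ 0 := by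
  by_contra! h
  exact hn ((Module.forall_dual_apply_eq_zero_iff K n).1 fun φ => h φ)

variable [Ring A] [Algebra K A] [Module Aᵐᵒᵖ M] [IsScalarTower K Aᵐᵒᵖ M]

/-- The forms that vanish on the submodule generated by `n`. -/
def StdDual.perp (n : M) : Submodule A (StdDual K A M) where
  carrier := {φ | ∀ a : A, φ.form (op a • n) = 0}
  add_mem' {φ ψ} hφ hψ a := by
    show φ.form (op a • n) + ψ.form (op a • n) = 0
    rw [hφ a, hψ a, add_zero]
  zero_mem' _ := rfl
  smul_mem' b φ hφ a := by
    rw [StdDual.smul_form, smul_smul, ← op_mul]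
    exact hφ (a * b)

theorem StdDual.perp_ne_top {n : M} (hn : n ≠ 0) : StdDual.perp (K := K) (A := A) n ≠ ⊤ := by
  intro h
  obtain ⟨φ, hφ⟩ := StdDual.exists_form_ne_zero (K := K) (A := A) hn
  have : φ ∈ StdDual.perp (K := K) (A := A) n := by rw [h]; trivial
  apply hφ
  have := this 1
  rwa [op_one, one_smul] at this

/-- If `n` generates a one-dimensional submodule, then the forms that vanish on it are a maximal
submodule. -/
theorem StdDual.isCoatom_perp {n : M} (hn : n ≠ 0) (h1 : ∀ a : A, ∃ t : K, op a • n = t • n) :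
    IsCoatom (StdDual.perp (K := K) (A := A) n) := by
  refine ⟨StdDual.perp_ne_top hn, fun X hX => ?_⟩
  obtain ⟨ξ, hξX, hξ⟩ := SetLike.exists_of_lt hX
  have hξ0 : ξ.form n ≠ 0 := by
    intro h0
    apply hξ
    intro a
    obtain ⟨t, ht⟩ := h1 a
    rw [ht, map_smul, h0, smul_zero]
  rw [eq_top_iff]
  rintro η -
  have h2 : η - (η.form n / ξ.form n) • ξ ∈ StdDual.perp (K := K) (A := A) n := by
    intro a
    obtain ⟨t, ht⟩ := h1 a
    rw [ht, map_smul, StdDual.form_sub, StdDual.form_smul,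
      smul_eq_mul (η.form n / ξ.form n), div_mul_cancel₀ _ hξ0, sub_self, smul_zero]
  have h3 := X.add_mem (hX.le h2) (X.smul_mem (algebraMap K A (η.form n / ξ.form n)) hξX)
  rwa [algebraMap_smul, sub_add_cancel] at h3

/-- A simple top of the dual means a simple socle of `M`. The forms vanishing on `n` are a maximal
submodule, hence the radical, so they include all forms vanishing on the submodule generated by `u`;
therefore `n` lies in that submodule. -/
theorem StdDual.exists_smul_eq [Module.Finite K M] [Module.Finite K A] {n u : M} (hn : n ≠ 0)
    (h1 : ∀ a : A, ∃ t : K, op a • n = t • n)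
    (hJ : IsCoatom (Module.jacobson A (StdDual K A M))) (hu : u ≠ 0) : ∃ a : A, op a • u = n := by
  have hfin : Module.Finite A (StdDual K A M) := Module.Finite.of_restrictScalars_finite K A _
  have hle : StdDual.perp (K := K) (A := A) u ≤ StdDual.perp n := by
    obtain h' | ⟨C, hC, huC⟩ := eq_top_or_exists_le_coatom (StdDual.perp (K := K) (A := A) u)
    · exact absurd h' (StdDual.perp_ne_top hu)
    · have h2 : Module.jacobson A (StdDual K A M) = C := by
        have hle : Module.jacobson A (StdDual K A M) ≤ C := sInf_le hC
        by_contra hne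
        exact hC.1 (hJ.2 _ (lt_of_le_of_ne hle hne))
      rw [← h2] at huC
      exact huC.trans (sInf_le (StdDual.isCoatom_perp hn h1))
  by_contra hno
  let U : Submodule K M :=
    { carrier := Set.range fun a : A => op a • u
      add_mem' := by
        rintro _ _ ⟨a, rfl⟩ ⟨b, rfl⟩
        exact ⟨a + b, by simp only [op_add, add_smul]⟩
      zero_mem' := ⟨0, by simp⟩
      smul_mem' := by
        rintro c _ ⟨a, rfl⟩
        exact ⟨c • a, by simp only [op_smul, smul_assoc]⟩ }
  have hnU : n ∉ U := hno
  obtain ⟨φ, hφn, hφU⟩ := Submodule.exists_dual_map_eq_bot_of_notMem hnU inferInstance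
  have h3 : (StdDual.of φ : StdDual K A M) ∈ StdDual.perp (K := K) (A := A) u := by
    intro a
    have : φ (op a • u) ∈ Submodule.map φ U := ⟨_, ⟨a, rfl⟩, rfl⟩
    rwa [hφU, Submodule.mem_bot] at this
  have h4 := hle h3 1
  rw [op_one, one_smul] at h4
  exact hφn h4

end Dual

/-! ### Simple socles. -/

section Socle

variable {A : Type u} [Ring A]

/-- Every nonzero submodule contains a simple one, and the only simple submodule is the socle. -/
theorem socle_le_of_isSimpleModule {M : Type u} [AddCommGroup M] [Module A M] [IsArtinian A M]
    (h : IsSimpleModule A (socle A M)) {N : Submodule A M} (hN : N ≠ ⊥) : socle A M ≤ N := by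
  obtain h' | ⟨X, hX, hXN⟩ := eq_bot_or_exists_atom_le N
  · exact absurd h' hN
  · have h1 : X ≤ socle A M := le_sSup (isSimpleModule_iff_isAtom.2 hX)
    rcases (isSimpleModule_iff_isAtom.1 h).le_iff.1 h1 with h2 | h2
    · exact absurd h2 hX.1
    · rwa [← h2]

end Socle

/-! ### From 1-quasi-hereditary algebras to the elementwise description. -/

section CoreOfOneQH

variable {K : Type u} [Field K] [IsAlgClosed K] {A : Type u} [Ring A] [Algebra K A]
  [Module.Finite K A] {Λ : Type v} [Fintype Λ] [PartialOrder Λ] {one : Λ} {e : Λ → A}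

theorem IsOneQuasiHereditary.hasUnitStandardDims (h : IsOneQuasiHereditary K one e) :
    HasUnitStandardDims K e := by
  obtain ⟨⟨he, -⟩, -, top, -, h2, -, -⟩ := h
  intro j k
  split_ifs with hjk
  · exact (jhMultiplicity_iff K he _ j 1).1 (h2 k j hjk).1
  · exact finrank_fixedPart_standard_eq_zero K he hjk

-- By `HasUnitStandardDims.countSubquotients_eq`, a single filtration realizes all the prescribed
-- multiplicities, including the vanishing ones.
open Classical in
theorem IsOneQuasiHereditary.exists_filtration (h : IsOneQuasiHereditary K one e) (i : Λ) :
    ∃ (r : ℕ) (F : Fin (r + 1) → Submodule A (Proj e i)), IsFiltration F ∧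
      (∀ t, ∃ k, i ≤ k ∧ Nonempty (Subquotient F t ≃ₗ[A] Standard e k)) ∧
      ∀ k, countSubquotients F (Standard e k) = if i ≤ k then 1 else 0 := by
  have hd := h.hasUnitStandardDims
  have hid := fun i => (h.1.1.1.idem i).eq
  obtain ⟨⟨he, hq⟩, -, top, -, h2, -, -⟩ := h
  obtain ⟨r, F, hF, hs, -⟩ := (hq i).2.2
  have hc : ∀ k, countSubquotients F (Standard e k) = if i ≤ k then 1 else 0 := by
    intro k
    split_ifs with hik
    · exact hd.countSubquotients_eq hid hF hs (h2 k i hik).2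
    · exact hd.countSubquotients_eq hid hF hs ((hq i).2.1 k hik)
  refine ⟨r, F, hF, fun t => ?_, hc⟩
  obtain ⟨k, hk⟩ := hs t
  refine ⟨k, ?_, hk⟩
  by_contra hik
  have := hc k
  rw [if_neg hik, countSubquotients, Nat.card_eq_zero] at this
  rcases this with h' | h'
  · exact h'.elim ⟨t, hk⟩
  · exact h'.not_finite inferInstance

theorem IsOneQuasiHereditary.finrank_corner (h : IsOneQuasiHereditary K one e) (j i : Λ) :
    Module.finrank K (corner K (e j) (e i)) = Nat.card {k // i ≤ k ∧ j ≤ k} := by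
  classical
  obtain ⟨r, F, hF, hs, hc⟩ := h.exists_filtration i
  rw [← finrank_fixedPart_proj (h.1.1.1.idem i).eq,
    h.hasUnitStandardDims.finrank_fixedPart (fun i => (h.1.1.1.idem i).eq) hF
      (fun t => (hs t).imp fun k hk => hk.2) j, Nat.card_eq_fintype_card, Fintype.card_subtype,
    Finset.card_eq_sum_ones, Finset.sum_filter]
  refine Finset.sum_congr rfl fun k _ => ?_
  rw [hc]
  by_cases h1 : j ≤ k <;> by_cases h2 : i ≤ k <;> simp [h1, h2]

theorem IsOneQuasiHereditary.corner_le_through (h : IsOneQuasiHereditary K one e) (j i : Λ) :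
    corner K (e j) (e i) ≤ through K e j i := by
  classical
  obtain ⟨r, F, hF, hs, hc⟩ := h.exists_filtration i
  exact h.hasUnitStandardDims.corner_le_through (fun i => (h.1.1.1.idem i).eq) hF hs j

/-- A 1-quasi-hereditary algebra has the elementwise description `IsCore`. -/
theorem IsOneQuasiHereditary.isCore (h : IsOneQuasiHereditary K one e) :
    ∃ top x y, IsCore K one top e x y := by
  classical
  have hd := h.hasUnitStandardDims
  have hdim := h.finrank_corner
  have hT := h.corner_le_through
  have hart : IsArtinianRing A := IsArtinianRing.of_finite K A
  obtain ⟨⟨he, hq⟩, hone, top, htop, h2, h3, h4⟩ := h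
  have hid := fun i => (he.1.idem i).eq
  have hcard : ∀ p : Λ → Prop, (∀ k, p k ↔ k = top) → Nat.card {k // p k} = 1 := by
    intro p hp
    rw [Nat.card_eq_one_iff_unique]
    exact ⟨⟨fun a b => Subtype.ext (((hp a).1 a.2).trans ((hp b).1 b.2).symm)⟩,
      ⟨⟨top, (hp top).2 rfl⟩⟩⟩
  have htop' : ∀ k, top ≤ k ↔ k = top := fun k =>
    ⟨fun h => le_antisymm (htop k) h, fun h => h ▸ le_rfl⟩
  have hd1 : ∀ j, Module.finrank K (corner K (e j) (e top)) = 1 := fun j => by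
    rw [hdim]
    exact hcard _ fun k => ⟨fun h => (htop' k).1 h.1, fun h => ⟨(htop' k).2 h, h ▸ htop j⟩⟩
  have hd2 : ∀ j, Module.finrank K (corner K (e top) (e j)) = 1 := fun j => by
    rw [hdim]
    exact hcard _ fun k => ⟨fun h => (htop' k).1 h.2, fun h => ⟨h ▸ htop j, (htop' k).2 h⟩⟩
  have hx : ∀ i, ∃ x ∈ corner K (e i) (e top), ∀ (c : A) (hc : c * e i = c),
      c * x = 0 ↔ toSpan c hc ∈ standardKernel e i := fun i => by
    obtain ⟨f, hf⟩ := (h4 i).1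
    exact exists_left_generator K he htop f hf
  have hy : ∀ i, ∃ y ∈ corner K (e top) (e i), ∀ (c : A) (hc : e i * c = c),
      y * c = 0 ↔ opToProj c hc ∈ standardKernel (opLabel e) i := fun i => by
    obtain ⟨g, hg⟩ := (h4 i).2
    exact exists_right_generator he htop g hg
  choose x hx hxk using hx
  choose y hy hyk using hy
  have x_ker : ∀ i j, ∀ c ∈ corner K (e j) (e i), c * x i = 0 → c ∈ above K e i j i :=
    fun i j c hc h0 => mem_above_of_mem_standardKernel he hT hc ((hxk i c hc.2).1 h0)
  have y_ker : ∀ i j, ∀ c ∈ corner K (e i) (e j), y i * c = 0 → c ∈ above K e i i j :=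
    fun i j c hc h0 => mem_above_of_op_mem_standardKernel he hT hc ((hyk i c hc.1).1 h0)
  have x_iff : ∀ i j, (∃ c ∈ corner K (e j) (e i), c * x i ≠ 0) ↔ j ≤ i := by
    intro i j
    have h1 := hd j i
    constructor
    · rintro ⟨c, hc, h0⟩
      by_contra hji
      apply h0
      rw [hxk i c hc.2, standardKernel_eq_span K he]
      exact Submodule.subset_span ⟨j, hji, Subtype.ext hc.1⟩
    · intro hji
      rw [if_pos hji] at h1
      have : Nontrivial (fixedPart K (e j) (Standard e i)) :=
        Module.nontrivial_of_finrank_pos (R := K) (by omega)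
      obtain ⟨⟨z, hz⟩, hz0⟩ := exists_ne (0 : fixedPart K (e j) (Standard e i))
      obtain ⟨w, rfl⟩ := (standardKernel e i).mkQ_surjective z
      refine ⟨e j * w, ⟨by rw [← mul_assoc, hid], by rw [mul_assoc, coe_mul_of_mem_span (hid i)]⟩,
        fun h0 => hz0 ?_⟩
      rw [hxk i _ (by rw [mul_assoc, coe_mul_of_mem_span (hid i)])] at h0
      apply Subtype.ext
      show (standardKernel e i).mkQ w = 0
      rw [← (hz : e j • (standardKernel e i).mkQ w = _), ← map_smul]
      exact (Submodule.Quotient.mk_eq_zero _).2 h0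
  have y_zero : ∀ i j, ¬ j ≤ i → ∀ c ∈ corner K (e i) (e j), y i * c = 0 := by
    intro i j hji c hc
    rw [hyk i c hc.1, standardKernel_eq_span K he.opLabel]
    exact Submodule.subset_span ⟨j, hji, Subtype.ext (congrArg op hc.2)⟩
  have y_iff : ∀ i j, (∃ c ∈ corner K (e i) (e j), y i * c ≠ 0) ↔ j ≤ i := by
    intro i j
    constructor
    · rintro ⟨c, hc, h0⟩
      by_contra hji
      exact h0 (y_zero i j hji c hc)
    · intro hji
      -- The composition factors of the right standard modules are not prescribed; they come from a
      -- count. The products a_k b_k with `j ≤ k` span e_1 A e_j, whose dimension is their number,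
      -- so none of them vanishes. In particular `b i ≠ 0`.
      have ha := fun k => exists_left_basis (hd1 one) (hx k) (x_ker k one)
      have hb := fun k => exists_right_basis (hd2 j) (hy k) (y_ker k j)
      choose a ha ha' using ha
      choose b hb hb0 hb' using hb
      have hspan : corner K (e one) (e j) ≤
          Submodule.span K (Set.range fun k : {k // j ≤ k} => a k * b k) := by
        refine (hT one j).trans (Submodule.span_le.2 ?_)
        rintro _ ⟨k, hk, -, u, hu, v, hv, rfl⟩
        have := mul_mem_span_of_le ha ha' hb' k u hu v hv
        refine Submodule.span_mono ?_ this
        rintro _ ⟨l, hl, rfl⟩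
        exact ⟨⟨l, hk.trans hl⟩, rfl⟩
      have hle : Module.finrank K (corner K (e one) (e j)) = Fintype.card {k // j ≤ k} := by
        rw [hdim, ← Nat.card_eq_fintype_card]
        exact Nat.card_congr (Equiv.subtypeEquivRight fun k => ⟨fun h => h.1, fun h => ⟨h, hone k⟩⟩)
      have hli : LinearIndependent K (fun k : {k // j ≤ k} => a k * b k) := by
        rw [linearIndependent_iff_card_le_finrank_span, ← hle]
        exact Submodule.finrank_mono hspan
      have hne := hli.ne_zero ⟨i, hji⟩
      have hbi : b i ≠ 0 := fun h0 => hne (by simp [h0])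
      exact ⟨b i, hb i, hb0 i hbi⟩
  have hsoc : ∀ j u, u * e j = u → u ≠ 0 → ∀ s ∈ socle A (Proj e j), ∃ c, c * u = (s : A) := by
    intro j u hu hu0 s hs
    obtain ⟨φ⟩ := (h3 j).1
    have hsimp := isSimpleModule_top_proj (hid one) (he.isPrimitiveIdem one)
    have h5 : IsSimpleModule A (socle A (Proj e j)) := IsSimpleModule.congr φ
    have h6 : Submodule.span A {toSpan u hu} ≠ ⊥ := by
      rw [Ne, Submodule.span_singleton_eq_bot]
      exact fun h0 => hu0 (congrArg Subtype.val h0)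
    obtain ⟨c, hc⟩ := Submodule.mem_span_singleton.1 (socle_le_of_isSimpleModule h5 h6 hs)
    exact ⟨c, congrArg Subtype.val hc⟩
  have hsoc1 : ∀ j, ∃ s ∈ socle A (Proj e j), (s : A) ≠ 0 ∧ e one * (s : A) = s := by
    intro j
    obtain ⟨φ⟩ := (h3 j).1
    let s := φ.symm (Submodule.Quotient.mk ⟨e one, Ideal.mem_span_singleton_self (e one)⟩)
    refine ⟨s, s.2, fun h0 => ?_, ?_⟩
    · apply mk_top_proj_ne_zero (hid one) (he.isPrimitiveIdem one)
      have : s = 0 := Subtype.ext (Subtype.ext h0)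
      simpa [s] using this
    · have : e one • s = s := by
        rw [← map_smul, smul_mk_top_proj (hid one)]
      exact congrArg (fun z : socle A (Proj e j) => ((z : Proj e j) : A)) this
  have y_ne : ∀ i, y i ≠ 0 := fun i h0 => by
    obtain ⟨c, -, hc⟩ := (y_iff i i).2 le_rfl
    exact hc (by rw [h0, zero_mul])
  have x_ne : ∀ i, x i ≠ 0 := fun i h0 => by
    obtain ⟨c, -, hc⟩ := (x_iff i i).2 le_rfl
    exact hc (by rw [h0, mul_zero])
  -- Only the vertex `one` occurs in Δ(one), and e_1 A e_top is one-dimensional, so x_1 spans a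
  -- submodule of P(top).
  have x_one : ∀ c, ∃ t : K, c * x one = t • x one := by
    intro c
    have h5 : ∀ l, ∃ t : K, e l * c * x one = t • x one := by
      intro l
      by_cases hl : l = one
      · subst hl
        obtain ⟨t, ht⟩ := exists_smul_eq_of_finrank_eq_one (hd1 l) (hx l) (x_ne l)
          (show e l * c * x l ∈ corner K (e l) (e top) from
            ⟨by rw [← mul_assoc, ← mul_assoc, hid], by rw [mul_assoc, (hx l).2]⟩)
        exact ⟨t, ht.symm⟩
      · refine ⟨0, ?_⟩
        rw [zero_smul]
        by_contra h0
        refine hl (le_antisymm ((x_iff one l).1 ⟨e l * c * e one,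
          mul_mul_mem_corner (hid l) (hid one) c, ?_⟩) (hone l))
        rwa [mul_assoc, (hx one).1]
    choose t ht using h5
    refine ⟨∑ l, t l, ?_⟩
    rw [Finset.sum_smul, ← Finset.sum_congr rfl fun l _ => ht l]
    rw [← Finset.sum_mul, ← Finset.sum_mul, he.1.complete, one_mul]
  have y_one : ∀ c, ∃ t : K, y one * c = t • y one := by
    intro c
    have h5 : ∀ l, ∃ t : K, y one * (c * e l) = t • y one := by
      intro l
      by_cases hl : l = one
      · subst hl
        obtain ⟨t, ht⟩ := exists_smul_eq_of_finrank_eq_one (hd2 l) (hy l) (y_ne l)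
          (show y l * (c * e l) ∈ corner K (e top) (e l) from
            ⟨by rw [← mul_assoc, (hy l).1], by rw [mul_assoc, mul_assoc, hid]⟩)
        exact ⟨t, ht.symm⟩
      · refine ⟨0, ?_⟩
        rw [zero_smul]
        by_contra h0
        refine hl (le_antisymm ((y_iff one l).1 ⟨e one * c * e l,
          mul_mul_mem_corner (hid one) (hid l) c, ?_⟩) (hone l))
        rwa [mul_assoc, ← mul_assoc (y one), (hy one).2]
    choose t ht using h5
    refine ⟨∑ l, t l, ?_⟩
    rw [Finset.sum_smul, ← Finset.sum_congr rfl fun l _ => ht l]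
    rw [← Finset.mul_sum, ← Finset.mul_sum, he.1.complete, mul_one]
  -- A socle element of P(1) at the vertex `one` is a left multiple of y_1, with a factor in e_1 A
  -- e_top = K x_1; hence it is a scalar multiple of x_1 y_1.
  have hxy : x one * y one ≠ 0 := by
    obtain ⟨s, hs, hs0, hs1⟩ := hsoc1 one
    obtain ⟨c, hc⟩ := hsoc one (y one) (hy one).2 (y_ne one) s hs
    have hc' : e one * c * e top ∈ corner K (e one) (e top) :=
      mul_mul_mem_corner (hid one) (hid top) c
    obtain ⟨t, ht⟩ := exists_smul_eq_of_finrank_eq_one (hd1 one) (hx one) (x_ne one) hc'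
    intro h0
    apply hs0
    have : e one * c * e top * y one = s := by
      rw [mul_assoc, (hy one).1, mul_assoc, hc, hs1]
    rw [← this, ← ht, smul_mul_assoc, h0, smul_zero]
  have hxy' : ∀ j, x one * y j ≠ 0 := by
    intro j h0
    obtain ⟨c, hc, hc0⟩ := (y_iff j one).2 (hone j)
    obtain ⟨t, ht⟩ := exists_smul_eq_of_finrank_eq_one (hd2 one) (mul_mem_corner (hy j) hc) hc0
      (hy one)
    apply hxy
    rw [← ht, mul_smul_comm, ← mul_assoc, h0, zero_mul, smul_zero]
  have hyx' : ∀ j, x j * y one ≠ 0 := by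
    intro j h0
    obtain ⟨c, hc, hc0⟩ := (x_iff j one).2 (hone j)
    obtain ⟨t, ht⟩ := exists_smul_eq_of_finrank_eq_one (hd1 one) (mul_mem_corner hc (hx j)) hc0
      (hx one)
    apply hxy
    rw [← ht, smul_mul_assoc, mul_assoc, h0, mul_zero, smul_zero]
  refine ⟨top, x, y, he.1, hone, htop, hx, hy, hdim, hxy, ?_, ?_, x_iff, y_iff, x_ker, y_ker⟩
  · intro j u hu hu0
    obtain ⟨s, hs, hs0, hs1⟩ := hsoc1 j
    obtain ⟨c, hc⟩ := hsoc j (x one * y j) (by rw [mul_assoc, (hy j).2]) (hxy' j) s hs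
    obtain ⟨d, hd⟩ := hsoc j u hu hu0 s hs
    obtain ⟨t, ht⟩ := x_one c
    rw [← mul_assoc, ht, smul_mul_assoc] at hc
    have ht0 : t ≠ 0 := by
      rintro rfl
      exact hs0 (by rw [← hc, zero_smul])
    refine ⟨t⁻¹ • d, ?_⟩
    rw [smul_mul_assoc, hd, ← hc, smul_smul, inv_mul_cancel₀ ht0, one_smul]
  · intro j u hu hu0
    obtain ⟨φ⟩ := (h3 j).2
    have hsimp := isSimpleModule_top_proj (hid one) (he.isPrimitiveIdem one)
    have h5 : IsSimpleModule A (Top A (Inj K e j)) := IsSimpleModule.congr φ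
    have hxj : e j * (x j * y one) = x j * y one := by rw [← mul_assoc, (hx j).1]
    obtain ⟨a, ha⟩ := StdDual.exists_smul_eq (n := opToProj (x j * y one) hxj) (u := opToProj u hu)
      (fun h0 => hyx' j (congrArg (fun z : Proj (opLabel e) j => unop (z : Aᵐᵒᵖ)) h0))
      (fun a => by
        obtain ⟨t, ht⟩ := y_one a
        refine ⟨t, Subtype.ext (congrArg op ?_)⟩
        show x j * y one * a = t • (x j * y one)
        rw [mul_assoc, ht, mul_smul_comm])
      (isSimpleModule_iff_isCoatom.1 h5)
      (fun h0 => hu0 (congrArg (fun z : Proj (opLabel e) j => unop (z : Aᵐᵒᵖ)) h0))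
    exact ⟨a, congrArg (fun z : Proj (opLabel e) j => unop (z : Aᵐᵒᵖ)) ha⟩

end CoreOfOneQH

/-! ### The elementwise description over the opposite algebra. -/

section OpCore

variable {K : Type u} [Field K] {A : Type u} [Ring A] [Algebra K A]

theorem op_mem_corner {f g a : A} : op a ∈ corner K (op f) (op g) ↔ a ∈ corner K g f :=
  ⟨fun h => ⟨congrArg unop h.2, congrArg unop h.1⟩, fun h => ⟨congrArg op h.2, congrArg op h.1⟩⟩

theorem finrank_corner_op (f g : A) :
    Module.finrank K (corner K (op f) (op g)) = Module.finrank K (corner K g f) := by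
  refine LinearEquiv.finrank_eq
    { toFun := fun z => ⟨unop (z : Aᵐᵒᵖ), op_mem_corner.1 z.2⟩
      map_add' := fun x y => rfl
      map_smul' := fun c x => rfl
      invFun := fun a => ⟨op (a : A), op_mem_corner.2 a.2⟩
      left_inv := fun z => rfl
      right_inv := fun z => rfl }

variable {Λ : Type v} [PartialOrder Λ] {e : Λ → A}

theorem op_mem_above {i j k : Λ} {c : A} (hc : c ∈ above K e i j k) :
    op c ∈ above K (opLabel e) i k j := by
  induction hc using Submodule.span_induction with
  | mem w hw =>
    obtain ⟨l, hl, u, hu, v, hv, rfl⟩ := hw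
    exact Submodule.subset_span ⟨l, hl, op v, op_mem_corner.2 hv, op u, op_mem_corner.2 hu, rfl⟩
  | zero => exact zero_mem _
  | add x y _ _ hx hy => exact add_mem hx hy
  | smul t x _ hx => exact Submodule.smul_mem _ t hx

theorem IsCore.op [Fintype Λ] {one top : Λ} {x y : Λ → A} (h : IsCore K one top e x y) :
    IsCore K one top (opLabel e) (fun i => op (y i)) (fun i => op (x i)) where
  idem := h.idem.opLabel
  one_le := h.one_le
  le_top := h.le_top
  x_mem i := op_mem_corner.2 (h.y_mem i)
  y_mem i := op_mem_corner.2 (h.x_mem i)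
  finrank_corner j i := by
    rw [opLabel, opLabel, finrank_corner_op, h.finrank_corner]
    exact Nat.card_congr (Equiv.subtypeEquivRight fun k => and_comm)
  mul_ne_zero h0 := h.mul_ne_zero (op_injective h0)
  socle_left j u hu hu0 := by
    obtain ⟨c, hc⟩ := h.socle_right j (unop u) (congrArg unop hu)
      (fun h0 => hu0 (unop_injective h0))
    exact ⟨MulOpposite.op c, congrArg MulOpposite.op hc⟩
  socle_right j u hu hu0 := by
    obtain ⟨c, hc⟩ := h.socle_left j (unop u) (congrArg unop hu)
      (fun h0 => hu0 (unop_injective h0))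
    exact ⟨MulOpposite.op c, congrArg MulOpposite.op hc⟩
  x_iff i j := by
    rw [← h.y_iff i j]
    constructor
    · rintro ⟨c, hc, h0⟩
      exact ⟨unop c, op_mem_corner.1 hc, fun h1 => h0 (congrArg MulOpposite.op h1)⟩
    · rintro ⟨c, hc, h0⟩
      exact ⟨MulOpposite.op c, op_mem_corner.2 hc, fun h1 => h0 (op_injective h1)⟩
  y_iff i j := by
    rw [← h.x_iff i j]
    constructor
    · rintro ⟨c, hc, h0⟩
      exact ⟨unop c, op_mem_corner.1 hc, fun h1 => h0 (congrArg MulOpposite.op h1)⟩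
    · rintro ⟨c, hc, h0⟩
      exact ⟨MulOpposite.op c, op_mem_corner.2 hc, fun h1 => h0 (op_injective h1)⟩
  x_ker i j c hc h0 := op_mem_above (h.y_ker i j (unop c) (op_mem_corner.1 hc) (op_injective h0))
  y_ker i j c hc h0 := op_mem_above (h.x_ker i j (unop c) (op_mem_corner.1 hc) (op_injective h0))

end OpCore

/-! ### From the elementwise description to 1-quasi-hereditary algebras. -/

section OfCore

variable {K : Type u} [Field K] {A : Type u} [Ring A] [Algebra K A]
  {Λ : Type v}

theorem eq_zero_of_mul_eq_zero [Fintype Λ] {e : Λ → A} (he : CompleteOrthogonalIdempotents e)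
    {M : Type u}
    [AddCommGroup M] [Module A M] {m : M} (h : ∀ j, e j • m = 0) : m = 0 := by
  rw [← one_smul A m, ← he.complete, Finset.sum_smul]
  exact Finset.sum_eq_zero fun j _ => h j

theorem mem_of_smul_mem [Fintype Λ] {e : Λ → A} (he : CompleteOrthogonalIdempotents e) {M : Type u}
    [AddCommGroup M] [Module A M] {N : Submodule A M} {m : M} (h : ∀ j, e j • m ∈ N) : m ∈ N := by
  rw [← one_smul A m, ← he.complete, Finset.sum_smul]
  exact sum_mem fun j _ => h j

variable [PartialOrder Λ] {one top : Λ} {e x y : Λ → A}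

theorem nat_card_eq_one_of_le_top (htop : ∀ i, i ≤ top) (j : Λ) :
    Nat.card {k // top ≤ k ∧ j ≤ k} = 1 := by
  rw [Nat.card_eq_one_iff_unique]
  exact ⟨⟨fun a b => Subtype.ext (((htop _).antisymm a.2.1).trans ((htop _).antisymm b.2.1).symm)⟩,
    ⟨⟨top, le_rfl, htop j⟩⟩⟩

/-- The elements that factor through vertices above `i` lie in every submodule that contains the
vertex spaces above `i`. -/
theorem mem_of_mem_above {i j k : Λ} {N : Submodule A (Proj e k)}
    (hN : ∀ l, i < l → ∀ v : Proj e k, e l • v = v → v ∈ N) {c : A} (hc : c ∈ above K e i j k)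
    (hck : c * e k = c) : toSpan c hck ∈ N := by
  have key : ∀ c ∈ above K e i j k, ∃ z ∈ N, (z : A) = c := by
    intro c hc
    induction hc using Submodule.span_induction with
    | mem w hw =>
      obtain ⟨l, hl, u, hu, v, hv, rfl⟩ := hw
      exact ⟨u • toSpan v hv.2, N.smul_mem u (hN l hl (toSpan v hv.2) (Subtype.ext hv.1)), rfl⟩
    | zero => exact ⟨0, zero_mem _, rfl⟩
    | add x y _ _ hx hy =>
      obtain ⟨a, ha, rfl⟩ := hx
      obtain ⟨b, hb, rfl⟩ := hy
      exact ⟨a + b, add_mem ha hb, rfl⟩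
    | smul t x _ hx =>
      obtain ⟨a, ha, rfl⟩ := hx
      refine ⟨algebraMap K A t • a, N.smul_mem _ ha, ?_⟩
      show algebraMap K A t * a = t • (a : A)
      rw [Algebra.smul_def]
  obtain ⟨z, hz, h⟩ := key c hc
  have : toSpan c hck = z := Subtype.ext h.symm
  rwa [this]

/-- A linear extension of the opposite order lists larger elements first, as is required for
building a standard filtration from the bottom. -/
theorem exists_antitone_enumeration (T : Type v) [Fintype T] [PartialOrder T] :
    ∃ τ : Fin (Fintype.card T) ≃ T, ∀ a b, a < b → τ.symm b < τ.symm a := by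
  let E := LinearExtension Tᵒᵈ
  have : Fintype E := (inferInstance : Fintype T)
  have hcard : Fintype.card E = Fintype.card T := Fintype.card_congr (Equiv.refl T)
  let τ := monoEquivOfFin E hcard
  refine ⟨τ.toEquiv.trans (Equiv.refl T), fun a b hab => ?_⟩
  have h1 : (toLinearExtension (OrderDual.toDual b) : E) ≤ toLinearExtension (OrderDual.toDual a) :=
    toLinearExtension.monotone hab.le
  exact lt_of_le_of_ne (τ.symm.monotone h1) fun h2 => hab.ne (τ.symm.injective h2).symm

variable [Fintype Λ]

theorem IsCore.finrank_corner_top (h : IsCore K one top e x y) (j : Λ) :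
    Module.finrank K (corner K (e j) (e top)) = 1 := by
  rw [h.finrank_corner]
  exact nat_card_eq_one_of_le_top h.le_top j

theorem IsCore.finrank_top_corner (h : IsCore K one top e x y) (j : Λ) :
    Module.finrank K (corner K (e top) (e j)) = 1 := by
  rw [h.finrank_corner, ← nat_card_eq_one_of_le_top h.le_top j]
  exact Nat.card_congr (Equiv.subtypeEquivRight fun k => and_comm)

theorem IsCore.mul_self (h : IsCore K one top e x y) (i : Λ) : e i * e i = e i :=
  (h.idem.idem i).eq

variable [Module.Finite K A]

/-- The nonzero element x_1 y_j lies in every nonzero submodule of P(j), so it generates the only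
simple submodule; being fixed by e_1, it identifies this submodule with S(1). -/
theorem IsCore.socle_equiv (h : IsCore K one top e x y) (he : IsVertexLabelling e) (j : Λ) :
    Nonempty (socle A (Proj e j) ≃ₗ[A] Simp e one) := by
  have hart : IsArtinianRing A := IsArtinianRing.of_finite K A
  have hne : x one * y j ≠ 0 := by
    obtain ⟨c, hc, hc0⟩ := (h.y_iff j one).2 (h.one_le j)
    obtain ⟨t, ht⟩ := exists_smul_eq_of_finrank_eq_one (h.finrank_top_corner one)
      (mul_mem_corner (h.y_mem j) hc) hc0 (h.y_mem one)
    intro h0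
    apply h.mul_ne_zero
    rw [← ht, mul_smul_comm, ← mul_assoc, h0, zero_mul, smul_zero]
  let n : Proj e j := toSpan (x one * y j) (by rw [mul_assoc, (h.y_mem j).2])
  have hn : n ≠ 0 := fun h0 => hne (congrArg Subtype.val h0)
  have hle : ∀ X : Submodule A (Proj e j), X ≠ ⊥ → Submodule.span A {n} ≤ X := by
    intro X hX
    obtain ⟨u, hu, hu0⟩ := Submodule.exists_mem_ne_zero_of_ne_bot hX
    obtain ⟨c, hc⟩ := h.socle_left j u (coe_mul_of_mem_span (h.mul_self j) u)
      (fun h0 => hu0 (Subtype.ext h0))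
    rw [Submodule.span_singleton_le_iff_mem]
    have : n = c • u := Subtype.ext hc.symm
    rw [this]
    exact X.smul_mem c hu
  have hatom : IsAtom (Submodule.span A {n}) := by
    refine ⟨by rwa [Ne, Submodule.span_singleton_eq_bot], fun X hX => ?_⟩
    by_contra h0
    exact absurd (hle X h0) (not_le_of_gt hX)
  have hsoc : socle A (Proj e j) = Submodule.span A {n} := by
    apply le_antisymm
    · refine sSup_le fun T hT => ?_
      have hT' : IsAtom T := isSimpleModule_iff_isAtom.1 hT
      rcases hT'.le_iff.1 (hle T hT'.1) with h1 | h1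
      · exact absurd h1 hatom.1
      · exact h1.ge
    · exact le_sSup (isSimpleModule_iff_isAtom.2 hatom)
  rw [hsoc]
  have hsimp : IsSimpleModule A (Submodule.span A {n}) := isSimpleModule_iff_isAtom.2 hatom
  obtain ⟨φ, -⟩ := exists_equiv_top_proj (h.mul_self one) (he.isPrimitiveIdem one)
    (s := (⟨n, Submodule.mem_span_singleton_self n⟩ : Submodule.span A {n}))
    (Subtype.ext (Subtype.ext (by
      show e one * (x one * y j) = x one * y j
      rw [← mul_assoc, (h.x_mem one).1])))
    (fun h0 => hn (congrArg Subtype.val h0))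
  exact ⟨φ.symm⟩

/-- Dually, the forms that vanish on the submodule generated by x_j y_1 are the largest proper
submodule of I(j). -/
theorem IsCore.top_inj_equiv (h : IsCore K one top e x y) (he : IsVertexLabelling e) (j : Λ) :
    Nonempty (Top A (Inj K e j) ≃ₗ[A] Simp e one) := by
  have hart : IsArtinianRing A := IsArtinianRing.of_finite K A
  have hne : x j * y one ≠ 0 := by
    obtain ⟨c, hc, hc0⟩ := (h.x_iff j one).2 (h.one_le j)
    obtain ⟨t, ht⟩ := exists_smul_eq_of_finrank_eq_one (h.finrank_corner_top one)
      (mul_mem_corner hc (h.x_mem j)) hc0 (h.x_mem one)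
    intro h0
    apply h.mul_ne_zero
    rw [← ht, smul_mul_assoc, mul_assoc, h0, mul_zero, smul_zero]
  let n : Proj (opLabel e) j := opToProj (x j * y one) (by rw [← mul_assoc, (h.x_mem j).1])
  have hn : n ≠ 0 := fun h0 => hne (congrArg (fun z : Proj (opLabel e) j => unop (z : Aᵐᵒᵖ)) h0)
  have hle : ∀ X : Submodule A (Inj K e j), X ≠ ⊤ → X ≤ StdDual.perp n := by
    intro X hX
    -- By the double annihilator theorem a proper subspace of the dual has a nonzero common zero
    -- `z`, and `n` is a multiple of `z` by `socle_right`.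
    obtain ⟨z, hz, hXz⟩ : ∃ z : Proj (opLabel e) j, z ≠ 0 ∧ ∀ ξ ∈ X, ξ.form z = 0 := by
      by_contra! hno
      let X' : Submodule K (Module.Dual K (Proj (opLabel e) j)) := X.restrictScalars K
      have h0 : X'.dualCoannihilator = ⊥ := by
        rw [eq_bot_iff]
        intro z hz
        by_contra hz0
        obtain ⟨ξ, hξ, h1⟩ := hno z hz0
        exact h1 ((Submodule.mem_dualCoannihilator _).1 hz ξ hξ)
      have h1 : X'.dualCoannihilator.dualAnnihilator = X' :=
        Subspace.dualCoannihilator_dualAnnihilator_eq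
      rw [h0, Submodule.dualAnnihilator_bot] at h1
      apply hX
      rw [eq_top_iff]
      rintro ξ -
      have : ξ.form ∈ X' := by rw [← h1]; trivial
      exact this
    have hz1 : e j * unop (z : Aᵐᵒᵖ) = unop (z : Aᵐᵒᵖ) :=
      congrArg unop (coe_mul_of_mem_span (h.op.mul_self j) z)
    obtain ⟨c, hc⟩ := h.socle_right j _ hz1 (fun h0 => hz (Subtype.ext (unop_injective h0)))
    have hzn : MulOpposite.op c • z = n := Subtype.ext (congrArg MulOpposite.op hc)
    intro ξ hξ a
    rw [← hzn, ← StdDual.smul_form, ← StdDual.smul_form]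
    exact hXz _ (X.smul_mem _ (X.smul_mem _ hξ))
  have hco : IsCoatom (StdDual.perp (K := K) (A := A) n) := by
    refine ⟨StdDual.perp_ne_top hn, fun X hX => ?_⟩
    by_contra h0
    exact absurd (hle X h0) (not_le_of_gt hX)
  have hjac : Module.jacobson A (Inj K e j) = StdDual.perp n :=
    ((isLocalModule_of_forall_le hco.1 hle).eq_jacobson hco).symm
  obtain ⟨ξ, hξ⟩ := StdDual.exists_form_ne_zero (K := K) (A := A) hn
  have hsimp : IsSimpleModule A (Top A (Inj K e j)) :=
    isSimpleModule_iff_isCoatom.2 (hjac ▸ hco)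
  let q := (Module.jacobson A (Inj K e j)).mkQ
  obtain ⟨φ, -⟩ := exists_equiv_top_proj (h.mul_self one) (he.isPrimitiveIdem one)
    (S := Top A (Inj K e j)) (s := q (e one • ξ)) (by
      rw [← map_smul, smul_smul, h.mul_self]) (fun h0 => by
      have h1 : e one • ξ ∈ Module.jacobson A (Inj K e j) := (Submodule.Quotient.mk_eq_zero _).1 h0
      rw [hjac] at h1
      have h2 := h1 1
      rw [op_one, one_smul, StdDual.smul_form] at h2
      apply hξ
      have h3 : MulOpposite.op (e one) • n = n := Subtype.ext (congrArg MulOpposite.op (by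
        show x j * y one * e one = x j * y one
        rw [mul_assoc, (h.y_mem one).2]))
      rwa [h3] at h2)
  exact ⟨φ.symm⟩

variable [IsAlgClosed K]

/-- By `x_iff`, right multiplication by `x i` kills the vertex spaces at `k ≰ i`; by `x_ker`, it
kills nothing beyond what they generate. -/
theorem IsCore.standardKernel_eq (h : IsCore K one top e x y) (he : IsVertexLabelling e) (i : Λ) :
    standardKernel e i = LinearMap.ker (projLift (e i) (x i)) := by
  have hid := h.mul_self
  apply le_antisymm
  · rw [standardKernel_eq_span K he, Submodule.span_le]
    rintro z ⟨k, hk, hz⟩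
    by_contra h0
    exact hk ((h.x_iff i k).1 ⟨z, ⟨congrArg Subtype.val hz, coe_mul_of_mem_span (hid i) z⟩, h0⟩)
  · intro z hz
    refine mem_of_smul_mem he.1 fun j => ?_
    have hz' : (z : A) * x i = 0 := hz
    have hjz : e j * (z : A) ∈ corner K (e j) (e i) :=
      ⟨by rw [← mul_assoc, hid], by rw [mul_assoc, coe_mul_of_mem_span (hid i)]⟩
    have h1 := h.x_ker i j _ hjz (by rw [mul_assoc, hz', mul_zero])
    refine mem_of_mem_above (fun l hl v hv => ?_) h1 hjz.2
    rw [standardKernel_eq_span K he]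
    exact Submodule.subset_span ⟨l, not_le_of_gt hl, hv⟩

theorem IsCore.exists_standard_injective (h : IsCore K one top e x y) (he : IsVertexLabelling e)
    (i : Λ) : ∃ f : Standard e i →ₗ[A] Proj e top, Function.Injective f := by
  have hker : LinearMap.ker (projLift (e i) (toSpan (x i) (h.x_mem i).2)) = standardKernel e i := by
    rw [h.standardKernel_eq he]
    ext z
    exact ⟨fun h0 => congrArg Subtype.val h0, fun h0 => Subtype.ext h0⟩
  refine ⟨(standardKernel e i).liftQ _ hker.ge, ?_⟩
  rw [← LinearMap.ker_eq_bot, Submodule.ker_liftQ, hker, Submodule.mkQ_map_self]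

theorem IsCore.exists_standard_to_standard (h : IsCore K one top e x y)
    (he : IsVertexLabelling e) (i : Λ) :
    ∃ f : Standard e i →ₗ[A] Standard e top, Function.Injective f := by
  obtain ⟨f, hf⟩ := h.exists_standard_injective he i
  refine ⟨(standardKernel e top).mkQ.comp f, ?_⟩
  rw [LinearMap.coe_comp]
  refine Function.Injective.comp ?_ hf
  rw [← LinearMap.ker_eq_bot, Submodule.ker_mkQ, standardKernel_eq_bot K he h.le_top]

/-- The transpose of the embedding of standard modules over the opposite algebra. -/
theorem IsCore.exists_costandard_surjective (h : IsCore K one top e x y)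
    (he : IsVertexLabelling e) (i : Λ) :
    ∃ g : Costandard K e top →ₗ[A] Costandard K e i, Function.Surjective g := by
  obtain ⟨f, hf⟩ := h.op.exists_standard_to_standard he.opLabel i
  refine ⟨
    { toFun := fun ξ => StdDual.of (ξ.form.comp (f.restrictScalars K))
      map_add' := fun ξ η => rfl
      map_smul' := fun a ξ => LinearMap.ext fun m => ?_ }, fun η => ?_⟩
  · show ξ.form (MulOpposite.op a • f m) = ξ.form (f (MulOpposite.op a • m))
    rw [map_smul f]
  · obtain ⟨ξ, hξ⟩ := LinearMap.dualMap_surjective_of_injective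
      (f := f.restrictScalars K) hf η.form
    exact ⟨StdDual.of ξ, hξ⟩

/-- Δ(i) embeds into P(top), all of whose vertex spaces are one-dimensional; `x_iff` tells which of
them are met. -/
theorem IsCore.hasUnitStandardDims (h : IsCore K one top e x y) (he : IsVertexLabelling e) :
    HasUnitStandardDims K e := by
  intro j i
  split_ifs with hji
  · obtain ⟨f, hf⟩ := h.exists_standard_injective he i
    have hle : Module.finrank K (fixedPart K (e j) (Standard e i)) ≤ 1 := by
      rw [← h.finrank_corner_top j, ← finrank_fixedPart_proj (h.mul_self top)]
      exact LinearMap.finrank_le_finrank_of_injective (fixedPartMap_injective K (e j) f hf)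
    refine le_antisymm hle ?_
    obtain ⟨c, hc, hc0⟩ := (h.x_iff i j).2 hji
    have hne : (standardKernel e i).mkQ (toSpan c hc.2) ≠ 0 := by
      intro h0
      have h1 : toSpan c hc.2 ∈ standardKernel e i := (Submodule.Quotient.mk_eq_zero _).1 h0
      rw [h.standardKernel_eq he] at h1
      exact hc0 h1
    have : Nontrivial (fixedPart K (e j) (Standard e i)) :=
      ⟨⟨⟨_, by
        rw [mem_fixedPart, ← map_smul]
        exact congrArg _ (Subtype.ext hc.1)⟩, 0, fun h0 => hne (congrArg Subtype.val h0)⟩⟩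
    exact Module.finrank_pos
  · exact finrank_fixedPart_standard_eq_zero K he hji

/-- In `P(i)`, the vertex spaces `e_k P(i)` with `k` in upper sets of `{k | i ≤ k}` generate a
filtration with subquotients `Δ(k)`. -/
theorem IsCore.exists_filtration (h : IsCore K one top e x y) (he : IsVertexLabelling e) (i : Λ) :
    ∃ (r : ℕ) (F : Fin (r + 1) → Submodule A (Proj e i)) (τ : Fin r ≃ {k // i ≤ k}),
      IsFiltration F ∧ ∀ t, Nonempty (Subquotient F t ≃ₗ[A] Standard e (τ t)) := by
  classical
  have hid := h.mul_self
  have hd := h.hasUnitStandardDims he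
  obtain ⟨τ, hτ⟩ := exists_antitone_enumeration {k // i ≤ k}
  let G : Fin (Fintype.card {k // i ≤ k} + 1) → Set (Proj e i) := fun t =>
    {z | ∃ s : Fin (Fintype.card {k // i ≤ k}), s.castSucc < t ∧ e (τ s) • z = z}
  let F := fun t => Submodule.span A (G t)
  have hF : IsFiltration F := by
    refine ⟨fun s t hst => Submodule.span_mono fun z ⟨a, ha, hz⟩ => ⟨a, ha.trans_le hst, hz⟩,
      ?_, ?_⟩
    · show Submodule.span A (G 0) = ⊥
      rw [Submodule.span_eq_bot]
      rintro z ⟨s, hs, -⟩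
      exact absurd hs (by simp)
    · show Submodule.span A (G (Fin.last _)) = ⊤
      rw [eq_top_iff]
      rintro z -
      rw [proj_eq_smul (hid i) z]
      refine Submodule.smul_mem _ _ (Submodule.subset_span
        ⟨τ.symm ⟨i, le_rfl⟩, Fin.castSucc_lt_last _, ?_⟩)
      rw [Equiv.apply_symm_apply]
      exact Subtype.ext (hid i)
  have hlow : ∀ t : Fin (Fintype.card {k // i ≤ k}), ∀ l, (τ t : Λ) < l → ∀ v : Proj e i,
      e l • v = v → v ∈ F t.castSucc := by
    intro t l hl v hv
    refine Submodule.subset_span ⟨τ.symm ⟨l, (τ t).2.trans hl.le⟩, ?_, ?_⟩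
    · rw [Fin.castSucc_lt_castSucc_iff]
      have := hτ (τ t) ⟨l, (τ t).2.trans hl.le⟩ hl
      rwa [Equiv.symm_apply_apply] at this
    · rw [Equiv.apply_symm_apply]
      exact hv
  have hmap : ∀ t, ∃ ψ : Standard e (τ t) →ₗ[A] Subquotient F t, Function.Surjective ψ := by
    intro t
    -- Modulo vertices above `τ t`, which are already in the previous step, `a` spans the vertex
    -- space at `τ t`; so it generates the subquotient.
    obtain ⟨a, ha, -, ha'⟩ := exists_right_basis (h.finrank_top_corner i) (h.y_mem (τ t))
      (h.y_ker (τ t) i)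
    have haF : toSpan a ha.2 ∈ F t.succ :=
      Submodule.subset_span ⟨t, Fin.castSucc_lt_succ, Subtype.ext ha.1⟩
    let X := (F t.castSucc).submoduleOf (F t.succ)
    let ψ₀ : Proj e (τ t) →ₗ[A] Subquotient F t :=
      projLift (e (τ t)) (X.mkQ ⟨toSpan a ha.2, haF⟩)
    have hψ₀ : ∀ (z : Proj e (τ t)) (w : F t.succ),
        (w : Proj e i) - (z : A) • toSpan a ha.2 ∈ F t.castSucc → X.mkQ w = ψ₀ z := by
      intro z w hw
      rw [← sub_eq_zero]
      show X.mkQ w - (z : A) • X.mkQ ⟨toSpan a ha.2, haF⟩ = 0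
      rw [← map_smul, ← map_sub]
      exact (Submodule.Quotient.mk_eq_zero X).2 hw
    have hker : standardKernel e (τ t : Λ) ≤ LinearMap.ker ψ₀ := by
      rw [standardKernel_eq_span K he, Submodule.span_le]
      rintro z ⟨l, hl, hz⟩
      have hz1 : (z : A) ∈ corner K (e l) (e (τ t)) :=
        ⟨congrArg Subtype.val hz, coe_mul_of_mem_span (hid _) z⟩
      have hz2 : (z : A) * x (τ t) = 0 := by
        by_contra h0
        exact hl ((h.x_iff _ l).1 ⟨z, hz1, h0⟩)
      have hz3 := mul_mem_above_right (h.x_ker _ _ _ hz1 hz2) ha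
      have hz4 : (z : A) • toSpan a ha.2 ∈ F t.castSucc :=
        mem_of_mem_above (hlow t) hz3 (by rw [mul_assoc, ha.2])
      have := hψ₀ z 0 (by
        rw [ZeroMemClass.coe_zero, zero_sub]
        exact neg_mem hz4)
      rw [map_zero] at this
      exact this.symm
    refine ⟨(standardKernel e (τ t : Λ)).liftQ ψ₀ hker, ?_⟩
    have hrange : ∀ w ∈ F t.succ, ∃ z : Proj e (τ t),
        w - (z : A) • toSpan a ha.2 ∈ F t.castSucc := by
      intro w hw
      induction hw using Submodule.span_induction with
      | mem w hw =>
        obtain ⟨s, hs, hw⟩ := hw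
        rcases lt_or_eq_of_le (Fin.castSucc_lt_succ_iff.1 hs) with hs' | rfl
        · refine ⟨0, ?_⟩
          rw [ZeroMemClass.coe_zero, zero_smul, sub_zero]
          exact Submodule.subset_span ⟨s, by rwa [Fin.castSucc_lt_castSucc_iff], hw⟩
        · have hwc : (w : A) ∈ corner K (e (τ s)) (e i) :=
            ⟨congrArg Subtype.val hw, coe_mul_of_mem_span (hid i) w⟩
          obtain ⟨c, hc⟩ := ha' w hwc
          refine ⟨toSpan (c • e (τ s)) (by rw [smul_mul_assoc, hid]), ?_⟩
          have h1 : w - (c • e (τ s)) • toSpan a ha.2 =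
              toSpan ((w : A) - c • a) (by
                rw [sub_mul, smul_mul_assoc, ha.2, coe_mul_of_mem_span (hid i)]) := by
            apply Subtype.ext
            show (w : A) - (c • e (τ s)) * a = (w : A) - c • a
            rw [smul_mul_assoc, ha.1]
          exact h1 ▸ mem_of_mem_above (hlow s) hc _
      | zero => exact ⟨0, by simp⟩
      | add w w' _ _ hw hw' =>
        obtain ⟨z, hz⟩ := hw
        obtain ⟨z', hz'⟩ := hw'
        refine ⟨z + z', ?_⟩
        have h1 : w + w' - ((z + z' : Proj e (τ t)) : A) • toSpan a ha.2 =
            (w - (z : A) • toSpan a ha.2) + (w' - (z' : A) • toSpan a ha.2) := by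
          rw [Submodule.coe_add, add_smul]; abel
        rw [h1]
        exact add_mem hz hz'
      | smul c w _ hw =>
        obtain ⟨z, hz⟩ := hw
        refine ⟨c • z, ?_⟩
        have h1 : c • w - ((c • z : Proj e (τ t)) : A) • toSpan a ha.2 =
            c • (w - (z : A) • toSpan a ha.2) := by
          rw [smul_sub, smul_smul]; rfl
        rw [h1]
        exact Submodule.smul_mem _ c hz
    intro q
    obtain ⟨w, rfl⟩ := X.mkQ_surjective q
    obtain ⟨z, hz⟩ := hrange w w.2
    exact ⟨(standardKernel e (τ t : Λ)).mkQ z, (hψ₀ z w hz).symm⟩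
  choose ψ hψ using hmap
  refine ⟨_, F, τ, hF, fun t => ?_⟩
  have hle : ∀ j t, Module.finrank K (fixedPart K (e j) (Subquotient F t)) ≤
      Module.finrank K (fixedPart K (e j) (Standard e (τ t))) := fun j t =>
    LinearMap.finrank_le_finrank_of_surjective (fixedPartMap_surjective K (hid j) (ψ t) (hψ t))
  -- Both sums equal dim e_j A e_i. As each term on the left is at most the one on the right, the
  -- surjections from the standard modules are bijective on every vertex space.
  have hsum : ∀ j, ∑ t, Module.finrank K (fixedPart K (e j) (Subquotient F t)) =
      ∑ t, Module.finrank K (fixedPart K (e j) (Standard e (τ t))) := by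
    intro j
    rw [← finrank_fixedPart_filtration K (hid j) F hF, finrank_fixedPart_proj (hid i),
      h.finrank_corner, Finset.sum_congr rfl fun t _ => hd j (τ t),
      τ.sum_comp fun k : {k // i ≤ k} => if j ≤ (k : Λ) then 1 else 0, Finset.sum_boole,
      Nat.cast_id, ← Fintype.card_subtype, ← Nat.card_eq_fintype_card]
    exact Nat.card_congr
      { toFun := fun k => ⟨⟨k, k.2.1⟩, k.2.2⟩
        invFun := fun k => ⟨k.1, k.1.2, k.2⟩
        left_inv := fun k => rfl
        right_inv := fun k => rfl }
  have heq : ∀ j, Module.finrank K (fixedPart K (e j) (Standard e (τ t))) =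
      Module.finrank K (fixedPart K (e j) (Subquotient F t)) := fun j =>
    ((Finset.sum_eq_sum_iff_of_le fun t _ => hle j t).1 (hsum j) t (Finset.mem_univ t)).symm
  have hinj : Function.Injective (ψ t) := by
    rw [← LinearMap.ker_eq_bot, eq_bot_iff]
    intro z hz
    rw [Submodule.mem_bot]
    refine eq_zero_of_mul_eq_zero he.1 fun j => ?_
    have h1 := (LinearMap.injective_iff_surjective_of_finrank_eq_finrank (heq j)).2
      (fixedPartMap_surjective K (hid j) (ψ t) (hψ t))
    have h2 := @h1 ⟨e j • z, by rw [mem_fixedPart, smul_smul, hid]⟩ 0 (Subtype.ext (by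
      show ψ t (e j • z) = ψ t 0
      rw [map_smul, LinearMap.mem_ker.1 hz, smul_zero, map_zero]))
    exact congrArg Subtype.val h2
  exact ⟨(LinearEquiv.ofBijective (ψ t) ⟨hinj, hψ t⟩).symm⟩

open Classical in
theorem IsCore.standardMultiplicity (h : IsCore K one top e x y) (he : IsVertexLabelling e)
    (i k : Λ) : StandardMultiplicity e (Proj e i) k (if i ≤ k then 1 else 0) := by
  have hd := h.hasUnitStandardDims he
  obtain ⟨r, F, τ, hF, hs⟩ := h.exists_filtration he i
  refine ⟨r, F, hF, fun t => ⟨_, hs t⟩, ?_⟩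
  have hiff : ∀ t, Nonempty (Subquotient F t ≃ₗ[A] Standard e k) ↔ (τ t : Λ) = k := by
    intro t
    obtain ⟨φ⟩ := hs t
    constructor
    · rintro ⟨ψ⟩
      exact hd.eq_of_equiv ⟨φ.symm.trans ψ⟩
    · intro h
      rw [← h]
      exact ⟨φ⟩
  rw [countSubquotients, Nat.card_congr (Equiv.subtypeEquivRight hiff)]
  split_ifs with hik
  · rw [Nat.card_eq_one_iff_unique]
    exact ⟨⟨fun a b => Subtype.ext (τ.injective (Subtype.ext (a.2.trans b.2.symm)))⟩,
      ⟨⟨τ.symm ⟨k, hik⟩, by rw [Equiv.apply_symm_apply]⟩⟩⟩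
  · have : IsEmpty {t // (τ t : Λ) = k} := ⟨fun t => hik (t.2 ▸ (τ t).2)⟩
    exact Nat.card_of_isEmpty

/-- The elementwise description characterizes 1-quasi-hereditary algebras. -/
theorem IsCore.isOneQuasiHereditary (h : IsCore K one top e x y) (he : IsVertexLabelling e) :
    IsOneQuasiHereditary K one e := by
  classical
  have hd := h.hasUnitStandardDims he
  have hjh : ∀ i j, j ≤ i → JHMultiplicity A (Standard e i) (Simp e j) 1 := fun i j hji => by
    rw [jhMultiplicity_iff K he, hd, if_pos hji]
  have hsm : ∀ i k, i ≤ k → StandardMultiplicity e (Proj e i) k 1 := fun i k hik => by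
    have := h.standardMultiplicity he i k
    rwa [if_pos hik] at this
  refine ⟨⟨he, fun i => ⟨hjh i i le_rfl, fun k hk => ?_, hsm i i le_rfl⟩⟩, h.one_le, top, h.le_top,
    fun i j hji => ⟨hjh i j hji, hsm j i hji⟩,
    fun j => ⟨h.socle_equiv he j, h.top_inj_equiv he j⟩,
    fun i => ⟨h.exists_standard_to_standard he i, h.exists_costandard_surjective he i⟩⟩
  have := h.standardMultiplicity he i k
  rwa [if_neg hk] at this

end OfCore

end OneQH

namespace OneQH

/-! ### The algebra C = e_1 A e_1 and the spaces e_i A e_1. -/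

section Frame

variable (K : Type u) [Field K] {A : Type u} [Ring A] [Algebra K A]
  {Λ : Type v} [PartialOrder Λ]

/-- Elements of an algebra `A` with idempotents `e i` that describe the left modules `e_i A e_1`
over the opposite of `C = e_1 A e_1`: the space `e_i A e_1` is generated by `a i` and isomorphic to the
ideal of `C` with basis `b k * a k`, for `i ≤ k`. -/
structure LocalFrame (one : Λ) (e : Λ → A) where
  a : Λ → A
  b : Λ → A
  basis : Module.Basis Λ K (corner K (e one) (e one))
  form : A →ₗ[K] K
  a_mem : ∀ i, a i ∈ corner K (e i) (e one)
  b_mem : ∀ i, b i ∈ corner K (e one) (e i)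
  form_ne_zero : ∀ c ∈ corner K (e one) (e one), c ≠ 0 →
    ∃ d ∈ corner K (e one) (e one), form (c * d) ≠ 0
  a_generates : ∀ i, ∀ w ∈ corner K (e i) (e one), ∃ c ∈ corner K (e one) (e one), w = a i * c
  mul_a_eq_zero : ∀ i u, u * e i = u → u * a i = 0 → u = 0
  b_mul_eq_zero : ∀ i u, e i * u = u → b i * u = 0 → u = 0
  exists_eq_zero : ∀ u : A, u ≠ 0 → ∃ d, u * (d * e one) ≠ 0
  mem_span_iff : ∀ i (w : corner K (e one) (e one)),
    w ∈ Submodule.span K (basis '' Set.Ici i) ↔ ∃ v ∈ corner K (e i) (e one), (w : A) = b i * v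
  mul_mem : ∀ i, ∀ u ∈ corner K (e one) (e i), ∀ v ∈ corner K (e i) (e one),
    ∃ v' ∈ corner K (e i) (e one), u * v = b i * v'
  exists_surjective : ∀ i j, i ≤ j → ∃ u ∈ corner K (e j) (e i), ∀ w ∈ corner K (e j) (e one),
    ∃ v ∈ corner K (e i) (e one), w = u * v
  exists_mul_a_eq : ∀ i j, ∀ w ∈ corner K (e j) (e one),
    (∃ v ∈ corner K (e i) (e one), b j * w = b i * v) → ∃ u ∈ corner K (e j) (e i), w = u * a i

variable {K} [Fintype Λ] {one top : Λ} {e x y : Λ → A}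

theorem IsCore.exists_a (h : IsCore K one top e x y) (i : Λ) :
    ∃ a ∈ corner K (e i) (e one), y i * a = y one := by
  obtain ⟨c, hc, hc0⟩ := (h.y_iff i one).2 (h.one_le i)
  obtain ⟨t, ht⟩ := exists_smul_eq_of_finrank_eq_one (h.finrank_top_corner one)
    (mul_mem_corner (h.y_mem i) hc) hc0 (h.y_mem one)
  exact ⟨t • c, Submodule.smul_mem _ t hc, by rw [mul_smul_comm, ht]⟩

theorem IsCore.exists_b (h : IsCore K one top e x y) (i : Λ) :
    ∃ b ∈ corner K (e one) (e i), b * x i = x one := by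
  obtain ⟨c, hc, hc0⟩ := (h.x_iff i one).2 (h.one_le i)
  obtain ⟨t, ht⟩ := exists_smul_eq_of_finrank_eq_one (h.finrank_corner_top one)
    (mul_mem_corner hc (h.x_mem i)) hc0 (h.x_mem one)
  exact ⟨t • c, Submodule.smul_mem _ t hc, by rw [smul_mul_assoc, ht]⟩

theorem IsCore.mul_y_one_ne_zero (h : IsCore K one top e x y) (j : Λ) : x j * y one ≠ 0 := by
  obtain ⟨c, -, hc⟩ := h.exists_b j
  intro h0
  apply h.mul_ne_zero
  rw [← hc, mul_assoc, h0, mul_zero]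

/-- If `u` were nonzero, x_1 y_i would be a left multiple of `u`; multiplying on the right by `a`
gives a nonzero multiple of x_1 y_1, contradicting `u * a = 0`. -/
theorem IsCore.eq_zero_of_mul_a (h : IsCore K one top e x y) {i : Λ} {a u : A}
    (hya : y i * a ≠ 0) (ha : a ∈ corner K (e i) (e one)) (hu : u * e i = u) (hua : u * a = 0) :
    u = 0 := by
  by_contra hu0
  obtain ⟨c, hc⟩ := h.socle_left i u hu hu0
  obtain ⟨t, ht⟩ := exists_smul_eq_of_finrank_eq_one (h.finrank_top_corner one)
    (mul_mem_corner (h.y_mem i) ha) hya (h.y_mem one)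
  apply h.mul_ne_zero
  rw [← ht, mul_smul_comm, ← mul_assoc, ← hc, mul_assoc, hua, mul_zero, smul_zero]

theorem IsCore.eq_zero_of_b_mul (h : IsCore K one top e x y) {i : Λ} {b u : A}
    (hb : b * x i = x one) (hu : e i * u = u) (hbu : b * u = 0) : u = 0 := by
  by_contra hu0
  obtain ⟨c, hc⟩ := h.socle_right i u hu hu0
  apply h.mul_ne_zero
  rw [← hb, mul_assoc, ← hc, ← mul_assoc, hbu, zero_mul]

theorem IsCore.finrank_corner_comm (h : IsCore K one top e x y) (i j : Λ) :
    Module.finrank K (corner K (e i) (e j)) = Module.finrank K (corner K (e j) (e i)) := by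
  rw [h.finrank_corner, h.finrank_corner]
  exact Nat.card_congr (Equiv.subtypeEquivRight fun k => and_comm)

/-- Every nonzero right ideal of C contains x_1 y_1, so a form not vanishing there is nondegenerate.
-/
theorem IsCore.exists_form_ne_zero (h : IsCore K one top e x y) {f : A →ₗ[K] K}
    (hf : f (x one * y one) ≠ 0) {c : A} (hc : c ∈ corner K (e one) (e one)) (hc0 : c ≠ 0) :
    ∃ d ∈ corner K (e one) (e one), f (c * d) ≠ 0 := by
  obtain ⟨d, hd⟩ := h.socle_right one c hc.1 hc0
  refine ⟨e one * d * e one, mul_mul_mem_corner (h.mul_self one) (h.mul_self one) d, ?_⟩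
  rwa [← mul_assoc, ← mul_assoc, hc.2, hd, mul_assoc, (h.y_mem one).2]

/-- An element `a` of `e_i A e_1` with `y i * a ≠ 0` generates `e_i A e_1` over `e_1 A e_1`. -/
theorem IsCore.exists_eq_mul (h : IsCore K one top e x y) [Module.Finite K A] {i : Λ} {a : A}
    (hya : y i * a ≠ 0) (ha : a ∈ corner K (e i) (e one)) {w : A}
    (hw : w ∈ corner K (e i) (e one)) : ∃ c ∈ corner K (e one) (e one), w = a * c := by
  obtain ⟨f, hf⟩ : ∃ f : A →ₗ[K] K, f (x one * y one) ≠ 0 := by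
    by_contra! h0
    exact h.mul_ne_zero ((Module.forall_dual_apply_eq_zero_iff K _).1 h0)
  let W : Submodule K A := (corner K (e one) (e one)).map (LinearMap.mulLeft K a)
  have hle : W ≤ corner K (e i) (e one) := by
    rintro _ ⟨c, hc, rfl⟩
    exact mul_mem_corner ha hc
  -- The pairing (v, w) ↦ f(v w) of e_1 A e_i with W = a C is nondegenerate in `v`. Hence dim W ≥
  -- dim e_1 A e_i = dim e_i A e_1, and W is everything.
  let P : corner K (e one) (e i) →ₗ[K] Module.Dual K W :=
    LinearMap.mk₂ K (fun v w => f ((v : A) * w))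
      (fun v v' w => by rw [Submodule.coe_add, add_mul, map_add])
      (fun t v w => by rw [Submodule.coe_smul, smul_mul_assoc, map_smul])
      (fun v w w' => by rw [Submodule.coe_add, mul_add, map_add])
      (fun t v w => by rw [Submodule.coe_smul, mul_smul_comm, map_smul])
  have hP : Function.Injective P := by
    rw [← LinearMap.ker_eq_bot, eq_bot_iff]
    intro v hv
    rw [Submodule.mem_bot]
    by_contra hv0
    have hva : (v : A) * a ≠ 0 := fun h0 => hv0 (Subtype.ext (h.eq_zero_of_mul_a hya ha v.2.2 h0))
    obtain ⟨d, hd, hd0⟩ := h.exists_form_ne_zero hf (mul_mem_corner v.2 ha) hva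
    apply hd0
    have := LinearMap.congr_fun (LinearMap.mem_ker.1 hv) ⟨a * d, d, hd, rfl⟩
    rw [mul_assoc]
    exact this
  have h1 := LinearMap.finrank_le_finrank_of_injective hP
  rw [Subspace.dual_finrank_eq, h.finrank_corner_comm] at h1
  have h2 : W = corner K (e i) (e one) := Submodule.eq_of_le_of_finrank_le hle h1
  rw [← h2] at hw
  obtain ⟨c, hc, rfl⟩ := hw
  exact ⟨c, hc, rfl⟩

/-- With y_i a_i = y_1 and b_i x_i = x_1, the products b_k a_k span C and their number is dim C. The
remaining properties compare subspaces spanned by parts of this basis with images of the spaces e_j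
A e_i of the same dimension. -/
theorem IsCore.nonempty_localFrame (h : IsCore K one top e x y) [Module.Finite K A] :
    Nonempty (LocalFrame K one e) := by
  classical
  choose a ha hya using h.exists_a
  choose b hb hbx using h.exists_b
  have y_ne : y one ≠ 0 := fun h0 => h.mul_ne_zero (by rw [h0, mul_zero])
  have x_ne : x one ≠ 0 := fun h0 => h.mul_ne_zero (by rw [h0, zero_mul])
  have hya0 : ∀ i, y i * a i ≠ 0 := fun i => by rw [hya]; exact y_ne
  have ha' : ∀ k, ∀ c ∈ corner K (e k) (e one), ∃ t : K, c - t • a k ∈ above K e k k one := by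
    intro k c hc
    obtain ⟨t, ht⟩ := exists_smul_eq_of_finrank_eq_one (h.finrank_top_corner one)
      (h.y_mem one) y_ne (mul_mem_corner (h.y_mem k) hc)
    refine ⟨t, h.y_ker k one _ (sub_mem hc (Submodule.smul_mem _ _ (ha k))) ?_⟩
    rw [mul_sub, mul_smul_comm, hya, ht, sub_self]
  have hb' : ∀ k, ∀ c ∈ corner K (e one) (e k), ∃ t : K, c - t • b k ∈ above K e k one k := by
    intro k c hc
    obtain ⟨t, ht⟩ := exists_smul_eq_of_finrank_eq_one (h.finrank_corner_top one)
      (h.x_mem one) x_ne (mul_mem_corner hc (h.x_mem k))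
    refine ⟨t, h.x_ker k one _ (sub_mem hc (Submodule.smul_mem _ _ (hb k))) ?_⟩
    rw [sub_mul, smul_mul_assoc, hbx, ht, sub_self]
  let w : Λ → corner K (e one) (e one) := fun k => ⟨b k * a k, mul_mem_corner (hb k) (ha k)⟩
  have hspan : ∀ i, ∀ u ∈ corner K (e one) (e i), ∀ v ∈ corner K (e i) (e one),
      ∀ z : corner K (e one) (e one), (z : A) = u * v → z ∈ Submodule.span K (w '' Set.Ici i) := by
    intro i u hu v hv z hz
    have h1 := mul_mem_span_of_le hb hb' ha' i u hu v hv
    have h2 : {w | ∃ k, i ≤ k ∧ w = b k * a k} =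
        (corner K (e one) (e one)).subtype '' (w '' Set.Ici i) := by
      ext c
      simp only [Set.mem_image, exists_exists_and_eq_and]
      exact ⟨fun ⟨k, hk, hc⟩ => ⟨k, hk, hc.symm⟩, fun ⟨k, hk, hc⟩ => ⟨k, hk, hc.symm⟩⟩
    rw [h2, ← Submodule.map_span, ← hz] at h1
    obtain ⟨z', hz', h3⟩ := h1
    have : z = z' := Subtype.ext h3.symm
    rwa [this]
  have hcard : Module.finrank K (corner K (e one) (e one)) = Fintype.card Λ := by
    rw [h.finrank_corner, ← Nat.card_eq_fintype_card]
    exact Nat.card_congr ⟨fun k => k.1, fun k => ⟨k, h.one_le k, h.one_le k⟩, fun _ => rfl,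
      fun _ => rfl⟩
  have htop : ⊤ ≤ Submodule.span K (Set.range w) := by
    rintro z -
    refine Submodule.span_mono (Set.image_subset_range w (Set.Ici one))
      (hspan one (e one) ⟨h.mul_self one, h.mul_self one⟩ z z.2 z z.2.1.symm)
  let γ : Module.Basis Λ K (corner K (e one) (e one)) :=
    basisOfTopLeSpanOfCardEqFinrank w htop hcard.symm
  have hγ : (γ : Λ → corner K (e one) (e one)) = w :=
    coe_basisOfTopLeSpanOfCardEqFinrank w htop hcard.symm
  have hfin : ∀ s : Set Λ, Module.finrank K (Submodule.span K (w '' s)) = Nat.card s := by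
    intro s
    have hli : LinearIndependent K fun k : s => w k := by
      rw [← hγ]
      exact γ.linearIndependent.comp _ Subtype.val_injective
    have := finrank_span_eq_card hli
    rwa [← Nat.card_eq_fintype_card, Set.range_comp' w, Subtype.range_coe] at this
  have hmem : ∀ i (z : corner K (e one) (e one)),
      z ∈ Submodule.span K (w '' Set.Ici i) ↔ ∃ v ∈ corner K (e i) (e one), (z : A) = b i * v := by
    intro i
    let D : corner K (e i) (e one) →ₗ[K] corner K (e one) (e one) :=
      { toFun := fun v => ⟨b i * v, mul_mem_corner (hb i) v.2⟩
        map_add' := fun v v' => Subtype.ext (mul_add _ _ _)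
        map_smul' := fun t v => Subtype.ext (mul_smul_comm _ _ _) }
    have hD : Function.Injective D := by
      rw [← LinearMap.ker_eq_bot, eq_bot_iff]
      intro v hv
      exact Subtype.ext (h.eq_zero_of_b_mul (hbx i) v.2.1 (congrArg Subtype.val hv))
    have hle : LinearMap.range D ≤ Submodule.span K (w '' Set.Ici i) := by
      rintro _ ⟨v, rfl⟩
      exact hspan i (b i) (hb i) v v.2 _ rfl
    have heq : LinearMap.range D = Submodule.span K (w '' Set.Ici i) := by
      refine Submodule.eq_of_le_of_finrank_le hle ?_
      rw [LinearMap.finrank_range_of_inj hD, hfin, h.finrank_corner]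
      exact (Nat.card_congr (Equiv.subtypeEquivRight fun k => ⟨fun hk => ⟨h.one_le k, hk⟩,
        fun hk => hk.2⟩)).le
    intro z
    rw [← heq]
    constructor
    · rintro ⟨v, rfl⟩
      exact ⟨v, v.2, rfl⟩
    · rintro ⟨v, hv, hz⟩
      exact ⟨⟨v, hv⟩, Subtype.ext hz.symm⟩
  obtain ⟨f, hf⟩ : ∃ f : A →ₗ[K] K, f (x one * y one) ≠ 0 := by
    by_contra! h0
    exact h.mul_ne_zero ((Module.forall_dual_apply_eq_zero_iff K _).1 h0)
  refine ⟨
    { a := a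
      b := b
      basis := γ
      form := f
      a_mem := ha
      b_mem := hb
      form_ne_zero := fun c hc hc0 => h.exists_form_ne_zero hf hc hc0
      a_generates := fun i v hv => h.exists_eq_mul (hya0 i) (ha i) hv
      mul_a_eq_zero := fun i u hu hu0 => h.eq_zero_of_mul_a (hya0 i) (ha i) hu hu0
      b_mul_eq_zero := fun i u hu hu0 => h.eq_zero_of_b_mul (hbx i) hu hu0
      exists_eq_zero := ?_
      mem_span_iff := by rw [hγ]; exact hmem
      mul_mem := fun i u hu v hv => (hmem i ⟨u * v, mul_mem_corner hu hv⟩).1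
        (hspan i u hu v hv _ rfl)
      exists_surjective := ?_
      exists_mul_a_eq := ?_ }⟩
  · intro u hu
    obtain ⟨j, hj⟩ : ∃ j, e j * u ≠ 0 := by
      by_contra! h0
      exact hu (eq_zero_of_mul_eq_zero h.idem h0)
    obtain ⟨d, hd⟩ := h.socle_right j (e j * u) (by rw [← mul_assoc, h.mul_self]) hj
    refine ⟨d, fun h0 => h.mul_y_one_ne_zero j ?_⟩
    have h1 : e j * u * d * e one = x j * y one := by
      rw [hd, mul_assoc, (h.y_mem one).2]
    rw [← h1, mul_assoc, mul_assoc, h0, mul_zero]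
  -- A `u` with y_j u a nonzero multiple of y_i satisfies y_j u a_i ≠ 0, so u a_i generates e_j A
  -- e_1 over C.
  · intro i j hij
    obtain ⟨u, hu, hu0⟩ := (h.y_iff j i).2 hij
    obtain ⟨t, ht⟩ := exists_smul_eq_of_finrank_eq_one (h.finrank_top_corner i)
      (mul_mem_corner (h.y_mem j) hu) hu0 (h.y_mem i)
    refine ⟨u, hu, fun v hv => ?_⟩
    have hne : y j * (u * a i) ≠ 0 := by
      intro h0
      apply hya0 i
      rw [← ht, smul_mul_assoc, mul_assoc, h0, smul_zero]
    obtain ⟨c, hc, rfl⟩ := h.exists_eq_mul hne (mul_mem_corner hu (ha i)) hv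
    exact ⟨a i * c, mul_mem_corner (ha i) hc, mul_assoc _ _ _⟩
  · intro i j
    let D : corner K (e j) (e one) →ₗ[K] corner K (e one) (e one) :=
      { toFun := fun v => ⟨b j * v, mul_mem_corner (hb j) v.2⟩
        map_add' := fun v v' => Subtype.ext (mul_add _ _ _)
        map_smul' := fun t v => Subtype.ext (mul_smul_comm _ _ _) }
    have hD : Function.Injective D := by
      rw [← LinearMap.ker_eq_bot, eq_bot_iff]
      intro v hv
      exact Subtype.ext (h.eq_zero_of_b_mul (hbx j) v.2.1 (congrArg Subtype.val hv))
    let E : corner K (e j) (e i) →ₗ[K] corner K (e j) (e one) :=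
      { toFun := fun v => ⟨v * a i, mul_mem_corner v.2 (ha i)⟩
        map_add' := fun v v' => Subtype.ext (add_mul _ _ _)
        map_smul' := fun t v => Subtype.ext (smul_mul_assoc _ _ _) }
    have hE : Function.Injective E := by
      rw [← LinearMap.ker_eq_bot, eq_bot_iff]
      intro v hv
      exact Subtype.ext (h.eq_zero_of_mul_a (hya0 i) (ha i) v.2.2 (congrArg Subtype.val hv))
    have hle : LinearMap.range E ≤ (Submodule.span K (w '' Set.Ici i)).comap D := by
      rintro _ ⟨v, rfl⟩
      exact hspan i (b j * v) (mul_mem_corner (hb j) v.2) (a i) (ha i) _ (mul_assoc _ _ _).symm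
    have hinf : ((Submodule.span K (w '' Set.Ici i)).comap D).map D ≤
        Submodule.span K (w '' (Set.Ici i ∩ Set.Ici j)) := by
      rintro _ ⟨v, hv, rfl⟩
      have h1 : D v ∈ Submodule.span K (w '' Set.Ici i) := hv
      have h2 : D v ∈ Submodule.span K (w '' Set.Ici j) := (hmem j _).2 ⟨v, v.2, rfl⟩
      rw [← hγ, Module.Basis.mem_span_image] at h1 h2 ⊢
      exact Set.subset_inter h1 h2
    -- Inside C, the right side is contained in the span of the basis elements with `i ≤ k` and `j ≤
    -- k`; their number is dim e_j A e_i, the dimension of the left side.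
    have heq : LinearMap.range E = (Submodule.span K (w '' Set.Ici i)).comap D := by
      refine Submodule.eq_of_le_of_finrank_le hle ?_
      rw [LinearMap.finrank_range_of_inj hE, h.finrank_corner,
        (Submodule.equivMapOfInjective D hD _).finrank_eq]
      refine (Submodule.finrank_mono hinf).trans ?_
      rw [hfin]
      exact le_rfl
    intro v hv hv'
    have h1 : (⟨v, hv⟩ : corner K (e j) (e one)) ∈ LinearMap.range E := by
      rw [heq]
      exact (hmem i _).2 hv'
    obtain ⟨u, hu⟩ := h1
    exact ⟨u, u.2, (congrArg Subtype.val hu).symm⟩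

end Frame

/-! ### Local rings and self-injectivity. -/

section LocalModules

variable {B : Type u} [Ring B]

theorem IsLocalModule.of_surjective {M M' : Type u} [AddCommGroup M] [Module B M]
    [AddCommGroup M'] [Module B M'] [Module.Finite B M] [Nontrivial M'] (h : IsLocalModule B M)
    (f : M →ₗ[B] M') (hf : Function.Surjective f) : IsLocalModule B M' := by
  refine isLocalModule_of_forall_le (N := (Module.jacobson B M).map f) ?_ fun X hX => ?_
  · intro htop
    have hker : LinearMap.ker f ≤ Module.jacobson B M := by
      refine h.le_jacobson fun h0 => ?_
      obtain ⟨z, hz⟩ := exists_ne (0 : M')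
      obtain ⟨w, rfl⟩ := hf z
      have : w ∈ LinearMap.ker f := by rw [h0]; trivial
      exact hz this
    apply h.isCoatom_jacobson.1
    have := congrArg (Submodule.comap f) htop
    rwa [Submodule.comap_map_eq, Submodule.comap_top, sup_eq_left.2 hker] at this
  · have h1 : X.comap f ≤ Module.jacobson B M := by
      refine h.le_jacobson fun h0 => hX ?_
      rw [eq_top_iff]
      rintro z -
      obtain ⟨w, rfl⟩ := hf z
      have : w ∈ X.comap f := by rw [h0]; trivial
      exact this
    rw [← Submodule.map_comap_eq_of_surjective hf X]
    exact Submodule.map_mono h1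

theorem IsPrimitiveIdem.isLocalRing [IsArtinianRing B] (h : IsPrimitiveIdem (1 : B)) :
    IsLocalRing B := by
  have : Nontrivial B := ⟨⟨1, 0, h.1⟩⟩
  have hloc := ((isIndecomposable_span_iff (mul_one (1 : B))).2 h).isLocalRing_end
  let T : B → Module.End B (Ideal.span {(1 : B)}) := fun b =>
    (LinearMap.toSpanSingleton B (Ideal.span {(1 : B)}) (toSpan b (mul_one b))).comp
      (Ideal.span {(1 : B)}).subtype
  have hT : ∀ b, IsUnit (T b) → IsUnit b := by
    intro b hb
    rw [Module.End.isUnit_iff] at hb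
    obtain ⟨z, hz⟩ := hb.2 (toSpan 1 (mul_one 1))
    have hz' : (z : B) * b = 1 := congrArg Subtype.val hz
    exact IsUnit.of_mul_eq_one_right _ hz'
  apply IsLocalRing.of_isUnit_or_isUnit_one_sub_self
  intro b
  have hadd : T b + T (1 - b) = 1 := by
    apply LinearMap.ext
    intro z
    apply Subtype.ext
    show (z : B) * b + z * (1 - b) = z
    rw [← mul_add, add_sub_cancel, mul_one]
  exact (IsLocalRing.isUnit_or_isUnit_of_add_one hadd).imp (hT _) (hT _)

theorem isPrimitiveIdem_one [IsLocalRing B] : IsPrimitiveIdem (1 : B) := by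
  refine ⟨one_ne_zero, fun g hg _ _ => ?_⟩
  rcases IsLocalRing.isUnit_or_isUnit_of_add_one (add_sub_cancel g 1) with h | h
  · right
    exact h.mul_left_cancel (by rw [hg, mul_one])
  · left
    refine h.mul_left_cancel ?_
    rw [sub_mul, hg, one_mul, sub_self, mul_zero]

theorem isLocalModule_self [IsArtinianRing B] [IsLocalRing B] : IsLocalModule B B := by
  have h := isPrimitiveIdem_one.isLocalModule (mul_one (1 : B))
  have : Ideal.span {(1 : B)} = ⊤ := Ideal.span_singleton_one
  exact h.congr ((LinearEquiv.ofEq _ _ this).trans Submodule.topEquiv)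

/-- An algebra with a nondegenerate linear form is self-injective. -/
theorem baer_of_form {K : Type u} [Field K] [Algebra K B] [Module.Finite K B] (μ : B →ₗ[K] K)
    (hμ : ∀ c : B, c ≠ 0 → ∃ b, μ (b * c) ≠ 0) : Module.Baer B B := by
  intro I g
  let P : B →ₗ[K] Module.Dual K B := LinearMap.mk₂ K (fun c b => μ (b * c))
    (fun c c' b => by rw [mul_add, map_add])
    (fun t c b => by rw [mul_smul_comm, map_smul])
    (fun c b b' => by rw [add_mul, map_add])
    (fun t c b => by rw [smul_mul_assoc, map_smul])
  have hP : Function.Injective P := by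
    rw [← LinearMap.ker_eq_bot, eq_bot_iff]
    intro c hc
    rw [Submodule.mem_bot]
    by_contra h0
    obtain ⟨b, hb⟩ := hμ c h0
    exact hb (LinearMap.congr_fun (LinearMap.mem_ker.1 hc) b)
  have hP' : Function.Surjective P :=
    (LinearMap.injective_iff_surjective_of_finrank_eq_finrank Subspace.dual_finrank_eq.symm).1 hP
  -- The linear form μ ∘ g extends to B and, by nondegeneracy, equals μ(· c) there. Testing with all
  -- left multiples shows that `g` is right multiplication by `c`.
  obtain ⟨ν, hν⟩ := LinearMap.exists_extend (p := I.restrictScalars K)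
    (μ.comp (g.restrictScalars K))
  obtain ⟨c, hc⟩ := hP' ν
  refine ⟨LinearMap.toSpanSingleton B B c, fun x hx => ?_⟩
  show x * c = g ⟨x, hx⟩
  rw [← sub_eq_zero]
  by_contra h0
  obtain ⟨b, hb⟩ := hμ _ h0
  apply hb
  have h1 : μ (b * x * c) = ν (b * x) := LinearMap.congr_fun hc (b * x)
  have h2 : ν (b * x) = μ (g ⟨b * x, I.mul_mem_left b hx⟩) :=
    LinearMap.congr_fun hν ⟨b * x, I.mul_mem_left b hx⟩
  have h3 : g ⟨b * x, I.mul_mem_left b hx⟩ = b * g ⟨x, hx⟩ := map_smul g b ⟨x, hx⟩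
  rw [mul_sub, map_sub, ← h3, ← h2, ← h1, mul_assoc, sub_self]

/-- Over a self-injective ring, homomorphisms from an ideal to the ring are right
multiplications. -/
theorem exists_eq_mul_right (hB : Module.Injective B B) {I : Ideal B} (f : I →ₗ[B] B) :
    ∃ c : B, ∀ z : I, f z = z * c := by
  obtain ⟨g, hg⟩ := Module.Baer.of_injective hB I f
  refine ⟨g 1, fun z => ?_⟩
  rw [← smul_eq_mul, ← map_smul, smul_eq_mul, mul_one]
  exact (hg z z.2).symm

end LocalModules

/-! ### Modules L with A f ≅ L and B ≅ f L. -/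

section Pair

variable {K : Type u} [Field K] {A : Type u} [Ring A] [Algebra K A]
  {B : Type u} [Ring B] [Algebra K B] {L : Type u} [AddCommGroup L] [Module K L] [Module B L]
  [IsScalarTower K B L]

/-- The module `L` is generated by `x₀` over `A` and `f L` is generated by `x₀` over `B`, with
`A f ≅ L` and `B ≅ f L`. -/
structure IsPairGenerator (ρ : A →ₐ[K] Module.End B L) (f : A) (x₀ : L) : Prop where
  idem : f * f = f
  fix : ρ f x₀ = x₀
  exists_left : ∀ l, ∃ a, ρ a x₀ = l
  left_inj : ∀ a, ρ a x₀ = 0 → a * f = 0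
  exists_right : ∀ l, ρ f l = l → ∃ b : B, b • x₀ = l
  right_inj : ∀ b : B, b • x₀ = 0 → b = 0

variable {ρ : A →ₐ[K] Module.End B L} {f : A} {x₀ : L}

theorem IsPairGenerator.eq_zero (g : IsPairGenerator ρ f x₀) {a : A} (haf : a * f = a)
    (h : ρ a x₀ = 0) : a = 0 := by
  rw [← haf, g.left_inj a h]

theorem IsPairGenerator.exists_left' (g : IsPairGenerator ρ f x₀) (l : L) :
    ∃ a, a * f = a ∧ ρ a x₀ = l := by
  obtain ⟨a, rfl⟩ := g.exists_left l
  refine ⟨a * f, by rw [mul_assoc, g.idem], ?_⟩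
  rw [map_mul, Module.End.mul_apply, g.fix]

/-- Both spaces are identified with f L through their action on `x₀`. As the two actions commute,
the identification reverses products, so B ≅ (f A f)^op. -/
theorem IsPairGenerator.exists_equiv (g : IsPairGenerator ρ f x₀) :
    ∃ θ : corner K f f ≃ₗ[K] B, ∀ c, θ c • x₀ = ρ c x₀ := by
  have h1 : ∀ c : corner K f f, ∃ b : B, b • x₀ = ρ c x₀ := fun c =>
    g.exists_right _ (by rw [← Module.End.mul_apply, ← map_mul, c.2.1])
  choose t ht using h1
  have huniq : ∀ b b' : B, b • x₀ = b' • x₀ → b = b' := fun b b' h =>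
    sub_eq_zero.1 (g.right_inj _ (by rw [sub_smul, h, sub_self]))
  let T : corner K f f →ₗ[K] B :=
    { toFun := t
      map_add' := fun c c' => huniq _ _ (by
        rw [add_smul, ht, ht, ht, Submodule.coe_add, map_add, LinearMap.add_apply])
      map_smul' := fun s c => huniq _ _ (by
        rw [ht, RingHom.id_apply, smul_assoc, ht, Submodule.coe_smul, map_smul,
          LinearMap.smul_apply]) }
  refine ⟨LinearEquiv.ofBijective T ⟨?_, fun b => ?_⟩, ht⟩
  · rw [← LinearMap.ker_eq_bot, eq_bot_iff]
    intro c hc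
    have h0 : t c = 0 := hc
    refine Subtype.ext (g.eq_zero c.2.2 ?_)
    rw [← ht, h0, zero_smul]
  · obtain ⟨a, ha, hab⟩ := g.exists_left' (b • x₀)
    have hfa : f * a = a := by
      rw [← sub_eq_zero]
      refine g.eq_zero (by rw [sub_mul, mul_assoc, ha]) ?_
      rw [map_sub, map_mul, LinearMap.sub_apply, Module.End.mul_apply, hab, map_smul, g.fix,
        sub_self]
    refine ⟨⟨a, hfa, ha⟩, huniq _ _ ?_⟩
    exact (ht _).trans hab

theorem mem_range_iff_of_idem {q : A} (hi : q * q = q) {l : L} :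
    l ∈ LinearMap.range (ρ q) ↔ ρ q l = l := by
  constructor
  · rintro ⟨l, rfl⟩
    rw [← Module.End.mul_apply, ← map_mul, hi]
  · intro h
    exact ⟨l, h⟩

theorem IsPairGenerator.exists_span_equiv (g : IsPairGenerator ρ f x₀) :
    ∃ τ : B ≃ₗ[B] LinearMap.range (ρ f), ∀ b, (τ b : L) = b • x₀ := by
  let τ : B →ₗ[B] LinearMap.range (ρ f) :=
    LinearMap.toSpanSingleton B _ ⟨x₀, (mem_range_iff_of_idem g.idem).2 g.fix⟩
  refine ⟨LinearEquiv.ofBijective τ ⟨?_, ?_⟩, fun _ => rfl⟩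
  · rw [← LinearMap.ker_eq_bot, eq_bot_iff]
    intro b hb
    exact g.right_inj b (congrArg Subtype.val hb)
  · rintro ⟨l, hl⟩
    obtain ⟨b, hb⟩ := g.exists_right l ((mem_range_iff_of_idem g.idem).1 hl)
    exact ⟨b, Subtype.ext hb⟩

variable {Λ : Type v} [PartialOrder Λ] {one : Λ} {e : Λ → A}

/-- The ideal of `B` that corresponds to `e_i L`. -/
def LocalFrame.ideal (F : LocalFrame K one e) (g : IsPairGenerator ρ (e one) x₀) (i : Λ) :
    Ideal B where
  carrier := {b | ∃ v ∈ corner K (e i) (e one), b • x₀ = ρ (F.b i * v) x₀}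
  add_mem' := by
    rintro b b' ⟨v, hv, h⟩ ⟨v', hv', h'⟩
    exact ⟨v + v', add_mem hv hv', by
      rw [add_smul, h, h', mul_add, map_add, LinearMap.add_apply]⟩
  zero_mem' := ⟨0, zero_mem _, by rw [zero_smul, mul_zero, map_zero, LinearMap.zero_apply]⟩
  smul_mem' := by
    rintro b b' ⟨v, hv, h⟩
    obtain ⟨θ, hθ⟩ := g.exists_equiv
    refine ⟨v * θ.symm b, mul_mem_corner hv (θ.symm b).2, ?_⟩
    have h1 : ρ (θ.symm b : A) x₀ = b • x₀ := by rw [← hθ, LinearEquiv.apply_symm_apply]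
    rw [smul_eq_mul, mul_smul, h, ← map_smul, ← h1, ← Module.End.mul_apply, ← map_mul, mul_assoc]

theorem LocalFrame.mem_ideal (F : LocalFrame K one e) (g : IsPairGenerator ρ (e one) x₀) {i : Λ}
    {b : B} : b ∈ F.ideal g i ↔ ∃ v ∈ corner K (e i) (e one), b • x₀ = ρ (F.b i * v) x₀ := Iff.rfl

theorem LocalFrame.mem_ideal_iff (F : LocalFrame K one e) (g : IsPairGenerator ρ (e one) x₀)
    {θ : corner K (e one) (e one) ≃ₗ[K] B} (hθ : ∀ c, θ c • x₀ = ρ c x₀) {i : Λ} {b : B} :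
    b ∈ F.ideal g i ↔ b ∈ Submodule.span K (F.basis.map θ '' Set.Ici i) := by
  have h1 : (F.basis.map θ '' Set.Ici i) = θ.toLinearMap '' (F.basis '' Set.Ici i) := by
    rw [Set.image_image]
    rfl
  have h2 : b ∈ Submodule.span K (F.basis.map θ '' Set.Ici i) ↔
      θ.symm b ∈ Submodule.span K (F.basis '' Set.Ici i) := by
    rw [h1, Submodule.span_image]
    exact Submodule.mem_map_equiv (e := θ) _
  have h3 : ρ (θ.symm b : A) x₀ = b • x₀ := by rw [← hθ, LinearEquiv.apply_symm_apply]
  rw [h2, F.mem_span_iff, F.mem_ideal]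
  refine exists_congr fun v => and_congr_right fun hv => ?_
  rw [← h3]
  constructor
  · intro h
    rw [← sub_eq_zero]
    refine g.eq_zero ?_ (by rw [map_sub, LinearMap.sub_apply, h, sub_self])
    rw [sub_mul, (θ.symm b).2.2, mul_assoc, hv.2]
  · intro h
    rw [h]

theorem IsPairGenerator.exists_right_mul (g : IsPairGenerator ρ f x₀) (b : B) :
    ∃ c ∈ corner K f f, ρ c x₀ = b • x₀ := by
  obtain ⟨θ, hθ⟩ := g.exists_equiv
  exact ⟨θ.symm b, (θ.symm b).2, by rw [← hθ, LinearEquiv.apply_symm_apply]⟩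

/-- Right multiplication in B is left multiplication in C, and `mul_mem` puts c b_i v back into b_i
e_i A e_1. -/
theorem LocalFrame.isTwoSided (F : LocalFrame K one e) (g : IsPairGenerator ρ (e one) x₀) (i : Λ) :
    (F.ideal g i).IsTwoSided := by
  refine ⟨fun {b} b' hb => ?_⟩
  obtain ⟨v, hv, h⟩ := hb
  obtain ⟨c, hc, hcb⟩ := g.exists_right_mul b'
  obtain ⟨v', hv', h'⟩ := F.mul_mem i (c * F.b i) (mul_mem_corner hc (F.b_mem i)) v hv
  refine ⟨v', hv', ?_⟩
  rw [mul_smul, ← hcb, ← map_smul, h, ← Module.End.mul_apply, ← map_mul, ← h', mul_assoc]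

theorem IsPairGenerator.exists_corner (g : IsPairGenerator ρ f x₀) {q : A} {l : L}
    (hl : ρ q l = l) : ∃ v, q * v = v ∧ v * f = v ∧ ρ v x₀ = l := by
  obtain ⟨a, ha, rfl⟩ := g.exists_left' l
  refine ⟨a, ?_, ha, rfl⟩
  rw [← sub_eq_zero]
  refine g.eq_zero (by rw [sub_mul, mul_assoc, ha]) ?_
  rw [map_sub, map_mul, LinearMap.sub_apply, Module.End.mul_apply, hl, sub_self]

/-- The action of b_i embeds e_i L into e_1 L ≅ B with the ideal as its image. -/
theorem LocalFrame.exists_equiv (F : LocalFrame K one e) (g : IsPairGenerator ρ (e one) x₀)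
    {i : Λ} (hi : e i * e i = e i) : ∃ ψ : LinearMap.range (ρ (e i)) ≃ₗ[B] F.ideal g i,
      ∀ l, (ψ l : B) • x₀ = ρ (F.b i) l := by
  let D : LinearMap.range (ρ (e i)) →ₗ[B] L := (ρ (F.b i)).comp (Submodule.subtype _)
  have hD : Function.Injective D := by
    rw [← LinearMap.ker_eq_bot, eq_bot_iff]
    rintro ⟨l, hl⟩ h0
    rw [mem_range_iff_of_idem hi] at hl
    obtain ⟨v, hv, hv', rfl⟩ := g.exists_corner hl
    have h1 : ρ (F.b i) (ρ v x₀) = 0 := h0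
    rw [← Module.End.mul_apply, ← map_mul] at h1
    have h2 := F.b_mul_eq_zero i v hv (g.eq_zero (by rw [mul_assoc, hv']) h1)
    rw [Submodule.mem_bot]
    exact Subtype.ext (by simp [h2])
  let E : F.ideal g i →ₗ[B] L := (LinearMap.toSpanSingleton B L x₀).comp (Submodule.subtype _)
  have hE : Function.Injective E := by
    rw [← LinearMap.ker_eq_bot, eq_bot_iff]
    intro b hb
    exact Subtype.ext (g.right_inj _ hb)
  have hDE : LinearMap.range D = LinearMap.range E := by
    ext l
    constructor
    · rintro ⟨⟨l, hl⟩, rfl⟩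
      rw [mem_range_iff_of_idem hi] at hl
      obtain ⟨v, hv, hv', rfl⟩ := g.exists_corner hl
      have h1 : ρ (F.b i) (ρ v x₀) = ρ (F.b i * v) x₀ := by rw [map_mul, Module.End.mul_apply]
      obtain ⟨b, hb⟩ := g.exists_right (ρ (F.b i * v) x₀) (by
        rw [← Module.End.mul_apply, ← map_mul, ← mul_assoc, (F.b_mem i).1])
      exact ⟨⟨b, v, ⟨hv, hv'⟩, hb⟩, hb.trans h1.symm⟩
    · rintro ⟨⟨b, v, hv, hb⟩, rfl⟩
      refine ⟨⟨ρ v x₀, (mem_range_iff_of_idem hi).2 ?_⟩, ?_⟩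
      · rw [← Module.End.mul_apply, ← map_mul, hv.1]
      · show ρ (F.b i) (ρ v x₀) = b • x₀
        rw [hb, map_mul, Module.End.mul_apply]
  refine ⟨(LinearEquiv.ofInjective D hD).trans ((LinearEquiv.ofEq _ _ hDE).trans
    (LinearEquiv.ofInjective E hE).symm), fun l => ?_⟩
  exact congrArg Subtype.val ((LinearEquiv.ofInjective E hE).apply_symm_apply
    ((LinearEquiv.ofEq _ _ hDE) (LinearEquiv.ofInjective D hD l)))

/-- An idempotent of B corresponds to an idempotent of `f A f`, so 1 is primitive in B. -/
theorem IsPairGenerator.isLocalRing (g : IsPairGenerator ρ f x₀) [Module.Finite K B]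
    (hp : IsPrimitiveIdem f) : IsLocalRing B := by
  have : IsArtinianRing B := IsArtinianRing.of_finite K B
  apply IsPrimitiveIdem.isLocalRing
  have hx : x₀ ≠ 0 := by
    intro h0
    apply hp.1
    exact g.eq_zero g.idem (by rw [h0, map_zero])
  refine ⟨fun h0 => hx (by rw [← one_smul B x₀, h0, zero_smul]), fun b hb _ _ => ?_⟩
  obtain ⟨c, hc, hcb⟩ := g.exists_right_mul b
  have hcc : c * c = c := by
    rw [← sub_eq_zero]
    refine g.eq_zero (by rw [sub_mul, mul_assoc, hc.2]) ?_
    rw [map_sub, map_mul, LinearMap.sub_apply, Module.End.mul_apply, hcb, map_smul, hcb,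
      ← mul_smul, hb, sub_self]
  rcases hp.2 c hcc hc.1 hc.2 with h | h
  · left
    exact g.right_inj b (by rw [← hcb, h, map_zero, LinearMap.zero_apply])
  · right
    rw [← sub_eq_zero]
    exact g.right_inj _ (by rw [sub_smul, ← hcb, h, g.fix, one_smul, sub_self])

/-- The form on C is transported to B. Products are reversed, so nondegeneracy under right
multiplication in C becomes the left-sided condition of `baer_of_form`. -/
theorem LocalFrame.injective (F : LocalFrame K one e) (g : IsPairGenerator ρ (e one) x₀)
    [Module.Finite K B] : Module.Injective B B := by
  obtain ⟨θ, hθ⟩ := g.exists_equiv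
  have hsymm : ∀ b, ρ (θ.symm b : A) x₀ = b • x₀ := fun b => by
    rw [← hθ, LinearEquiv.apply_symm_apply]
  refine (baer_of_form (K := K) (F.form.comp ((Submodule.subtype _).comp θ.symm.toLinearMap))
    fun b hb => ?_).injective
  obtain ⟨d, hd, hd0⟩ := F.form_ne_zero (θ.symm b) (θ.symm b).2 (fun h0 => hb (by
    rw [← θ.apply_symm_apply b, show θ.symm b = 0 from Subtype.ext h0, map_zero]))
  refine ⟨θ ⟨d, hd⟩, ?_⟩
  have h1 : ((θ.symm (θ ⟨d, hd⟩ * b) : corner K (e one) (e one)) : A) = θ.symm b * d := by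
    rw [← sub_eq_zero]
    refine g.eq_zero (by rw [sub_mul, mul_assoc, hd.2, (θ.symm _).2.2]) ?_
    rw [map_sub, LinearMap.sub_apply, hsymm, mul_smul, map_mul, Module.End.mul_apply, ← hsymm b,
      ← map_smul, hθ, sub_self]
  show F.form ((θ.symm (θ ⟨d, hd⟩ * b) : corner K (e one) (e one)) : A) ≠ 0
  rwa [h1]

theorem LocalFrame.finrank_eq [Fintype Λ] (F : LocalFrame K one e)
    (g : IsPairGenerator ρ (e one) x₀) :
    Module.finrank K B = Fintype.card Λ := by
  obtain ⟨θ, -⟩ := g.exists_equiv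
  exact Module.finrank_eq_card_basis (F.basis.map θ)

/-- The module e_i L is a nonzero cyclic module over the local ring B, generated by a_i x₀. -/
theorem LocalFrame.isLocalModule_range (F : LocalFrame K one e)
    (g : IsPairGenerator ρ (e one) x₀) [Module.Finite K B] [IsLocalRing B] {i : Λ}
    (hi : e i * e i = e i) (hi0 : e i ≠ 0) : IsLocalModule B (LinearMap.range (ρ (e i))) := by
  have : IsArtinianRing B := IsArtinianRing.of_finite K B
  have hai : ρ (F.a i) x₀ ∈ LinearMap.range (ρ (e i)) := by
    rw [mem_range_iff_of_idem hi, ← Module.End.mul_apply, ← map_mul, (F.a_mem i).1]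
  have ha0 : ρ (F.a i) x₀ ≠ 0 := by
    intro h0
    apply hi0
    refine F.mul_a_eq_zero i _ hi ?_
    rw [(F.a_mem i).1, g.eq_zero (F.a_mem i).2 h0]
  have hnt : Nontrivial (LinearMap.range (ρ (e i))) :=
    ⟨⟨⟨_, hai⟩, 0, fun h0 => ha0 (congrArg Subtype.val h0)⟩⟩
  refine isLocalModule_self.of_surjective (LinearMap.toSpanSingleton B _ ⟨_, hai⟩) ?_
  rintro ⟨l, hl⟩
  rw [mem_range_iff_of_idem hi] at hl
  obtain ⟨v, hv, hv', rfl⟩ := g.exists_corner hl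
  obtain ⟨c, hc, rfl⟩ := F.a_generates i v ⟨hv, hv'⟩
  obtain ⟨b, hb⟩ := g.exists_right (ρ c x₀) (by rw [← Module.End.mul_apply, ← map_mul, hc.1])
  refine ⟨b, Subtype.ext ?_⟩
  show b • ρ (F.a i) x₀ = ρ (F.a i * c) x₀
  rw [map_mul, Module.End.mul_apply, ← hb, map_smul]

theorem LocalFrame.ideal_mono (F : LocalFrame K one e) (g : IsPairGenerator ρ (e one) x₀) {i j : Λ}
    (hij : i ≤ j) : F.ideal g j ≤ F.ideal g i := by
  obtain ⟨θ, hθ⟩ := g.exists_equiv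
  intro b hb
  rw [F.mem_ideal_iff g hθ] at hb ⊢
  exact Submodule.span_mono (Set.image_mono (Set.Ici_subset_Ici.2 hij)) hb

theorem LocalFrame.le_of_ideal_le (F : LocalFrame K one e) (g : IsPairGenerator ρ (e one) x₀)
    {i j : Λ} (h : F.ideal g j ≤ F.ideal g i) : i ≤ j := by
  obtain ⟨θ, hθ⟩ := g.exists_equiv
  have h1 : F.basis.map θ j ∈ F.ideal g j := by
    rw [F.mem_ideal_iff g hθ]
    exact Submodule.subset_span ⟨j, le_rfl, rfl⟩
  have h2 := h h1
  rw [F.mem_ideal_iff g hθ, Module.Basis.self_mem_span_image] at h2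
  exact h2

/-- By self-injectivity an epimorphism is a right multiplication; as the ideals are two-sided, its
image stays in the source ideal, and comparing basis elements gives `i ≤ j`. -/
theorem LocalFrame.surj_iff (F : LocalFrame K one e) (g : IsPairGenerator ρ (e one) x₀)
    [Module.Finite K B] (hid : ∀ i, e i * e i = e i) (i j : Λ) :
    (∃ f : F.ideal g i →ₗ[B] F.ideal g j, Function.Surjective f) ↔ i ≤ j := by
  constructor
  · rintro ⟨φ, hφ⟩
    obtain ⟨c, hc⟩ := exists_eq_mul_right (F.injective g) ((F.ideal g j).subtype.comp φ)
    refine F.le_of_ideal_le g fun b hb => ?_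
    obtain ⟨z, hz⟩ := hφ ⟨b, hb⟩
    have h1 : b = z * c := by
      rw [← hc z]
      show b = ((φ z : F.ideal g j) : B)
      rw [hz]
    rw [h1]
    have := F.isTwoSided g i
    exact Ideal.mul_mem_right c _ z.2
  · intro hij
    obtain ⟨u, hu, hs⟩ := F.exists_surjective i j hij
    obtain ⟨ψi, -⟩ := F.exists_equiv g (hid i)
    obtain ⟨ψj, -⟩ := F.exists_equiv g (hid j)
    let D : LinearMap.range (ρ (e i)) →ₗ[B] LinearMap.range (ρ (e j)) :=
      ((ρ u).comp (Submodule.subtype _)).codRestrict _ fun l => by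
        rw [mem_range_iff_of_idem (hid j), LinearMap.comp_apply, ← Module.End.mul_apply, ← map_mul,
          hu.1]
    have hD : Function.Surjective D := by
      rintro ⟨l, hl⟩
      have hl' := hl
      rw [mem_range_iff_of_idem (hid j)] at hl'
      obtain ⟨w, hw, hw', rfl⟩ := g.exists_corner hl'
      obtain ⟨v, hv, rfl⟩ := hs w ⟨hw, hw'⟩
      refine ⟨⟨ρ v x₀, ?_⟩, Subtype.ext ?_⟩
      · rw [mem_range_iff_of_idem (hid i), ← Module.End.mul_apply, ← map_mul, hv.1]
      · show ρ u (ρ v x₀) = ρ (u * v) x₀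
        rw [map_mul, Module.End.mul_apply]
    exact ⟨ψj.toLinearMap.comp (D.comp ψi.symm.toLinearMap),
      ψj.surjective.comp (hD.comp ψi.symm.surjective)⟩

theorem LocalFrame.iSup_ideal_eq (F : LocalFrame K one e) (g : IsPairGenerator ρ (e one) x₀)
    {θ : corner K (e one) (e one) ≃ₗ[K] B} (hθ : ∀ c, θ c • x₀ = ρ c x₀) (i : Λ) {b : B} :
    b ∈ (⨆ j, ⨆ _ : i < j, F.ideal g j) ↔
      b ∈ Submodule.span K (F.basis.map θ '' Set.Ioi i) := by
  constructor
  · intro hb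
    rw [iSup_subtype'] at hb
    induction hb using Submodule.iSup_induction' with
    | mem j b hb =>
      rw [F.mem_ideal_iff g hθ] at hb
      exact Submodule.span_mono (Set.image_mono fun k hk => lt_of_lt_of_le j.2 hk) hb
    | zero => exact zero_mem _
    | add b b' _ _ h h' => exact add_mem h h'
  · intro hb
    have hle : Submodule.span K (F.basis.map θ '' Set.Ioi i) ≤
        (⨆ j, ⨆ _ : i < j, F.ideal g j).restrictScalars K := by
      rw [Submodule.span_le]
      rintro _ ⟨j, hj, rfl⟩
      refine (le_iSup_of_le j (le_iSup_of_le hj le_rfl) :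
        F.ideal g j ≤ ⨆ j, ⨆ _ : i < j, F.ideal g j) ?_
      rw [F.mem_ideal_iff g hθ]
      exact Submodule.subset_span ⟨j, le_rfl, rfl⟩
    exact hle hb

theorem LocalFrame.isOrderedIdealFamily (F : LocalFrame K one e)
    (g : IsPairGenerator ρ (e one) x₀) [Module.Finite K B] [IsLocalRing B]
    (hid : ∀ i, e i * e i = e i) (hne : ∀ i, e i ≠ 0) (hone : ∀ i, one ≤ i) :
    IsOrderedIdealFamily one (F.ideal g) := by
  have hloc : ∀ i, IsLocalModule B (F.ideal g i) := fun i => by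
    obtain ⟨ψ, -⟩ := F.exists_equiv g (hid i)
    exact (F.isLocalModule_range g (hid i) (hne i)).congr ψ
  obtain ⟨θ, hθ⟩ := g.exists_equiv
  refine ⟨F.isTwoSided g, hloc, ?_, F.surj_iff g hid, fun i => ?_⟩
  · rw [eq_top_iff]
    rintro b -
    rw [F.mem_ideal_iff g hθ, show Set.Ici one = Set.univ from Set.eq_univ_of_forall hone,
      Set.image_univ, Module.Basis.span_eq]
    trivial
  · have hsup : (⨆ j, ⨆ _ : i < j, F.ideal g j) ≤ F.ideal g i :=
      iSup_le fun j => iSup_le fun hj => F.ideal_mono g hj.le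
    let N : Submodule B (F.ideal g i) :=
      Submodule.comap (F.ideal g i).subtype (⨆ j, ⨆ _ : i < j, F.ideal g j)
    have hβ : F.basis.map θ i ∈ F.ideal g i := by
      rw [F.mem_ideal_iff g hθ]
      exact Submodule.subset_span ⟨i, le_rfl, rfl⟩
    have hβ' : F.basis.map θ i ∉ (⨆ j, ⨆ _ : i < j, F.ideal g j) := by
      rw [F.iSup_ideal_eq g hθ, Module.Basis.self_mem_span_image]
      exact lt_irrefl i
    have hdec : ∀ b ∈ F.ideal g i, ∃ t : K, b - t • F.basis.map θ i ∈
        (⨆ j, ⨆ _ : i < j, F.ideal g j) := by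
      intro b hb
      rw [F.mem_ideal_iff g hθ, show Set.Ici i = insert i (Set.Ioi i) from
        (Set.Ioi_insert).symm, Set.image_insert_eq, Submodule.mem_span_insert] at hb
      obtain ⟨t, r, hr, rfl⟩ := hb
      refine ⟨t, ?_⟩
      rw [add_sub_cancel_left, F.iSup_ideal_eq g hθ]
      exact hr
    -- The ideal at `i` is the sum of the ideals above it plus the line of its own basis vector. So
    -- that sum is maximal, and by locality it is the radical.
    have hN : IsCoatom N := by
      refine ⟨fun h0 => hβ' ?_, fun X hX => ?_⟩
      · have : (⟨_, hβ⟩ : F.ideal g i) ∈ N := by rw [h0]; trivial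
        exact this
      · obtain ⟨⟨b, hb⟩, hbX, hbN⟩ := SetLike.exists_of_lt hX
        obtain ⟨t, ht⟩ := hdec b hb
        have ht0 : t ≠ 0 := by
          rintro rfl
          rw [zero_smul, sub_zero] at ht
          exact hbN ht
        have hβX : (⟨_, hβ⟩ : F.ideal g i) ∈ X := by
          have h1 : (⟨b, hb⟩ - t • ⟨_, hβ⟩ : F.ideal g i) ∈ X := hX.le ht
          have h2 := X.sub_mem hbX h1
          rw [sub_sub_cancel] at h2
          have h3 := X.smul_mem (algebraMap K B t⁻¹) h2
          rwa [algebraMap_smul, smul_smul, inv_mul_cancel₀ ht0, one_smul] at h3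
        rw [eq_top_iff]
        rintro ⟨c, hc⟩ -
        obtain ⟨s, hs⟩ := hdec c hc
        have h1 : (⟨c, hc⟩ - s • ⟨_, hβ⟩ : F.ideal g i) ∈ X := hX.le hs
        have h2 := X.smul_mem (algebraMap K B s) hβX
        rw [algebraMap_smul] at h2
        have h3 := X.add_mem h1 h2
        rwa [sub_add_cancel] at h3
    rw [← (hloc i).eq_jacobson hN, Submodule.map_comap_eq, Submodule.range_subtype]
    exact inf_eq_right.2 hsup

/-- A double centralizer property: a B-homomorphism e_i L → e_j L is determined by its value at the
generator a_i x₀, and each such value is realized by an element of e_j A e_i. -/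
theorem LocalFrame.bijective [Fintype Λ] (F : LocalFrame K one e) (g : IsPairGenerator ρ (e one) x₀)
    [Module.Finite K B] (he : CompleteOrthogonalIdempotents e) : Function.Bijective ρ := by
  have hid := fun i => (he.idem i).eq
  constructor
  · rw [injective_iff_map_eq_zero]
    intro a ha
    by_contra ha0
    obtain ⟨d, hd⟩ := F.exists_eq_zero a ha0
    apply hd
    refine g.eq_zero (by rw [mul_assoc, mul_assoc, g.idem]) ?_
    rw [map_mul, ha, zero_mul, LinearMap.zero_apply]
  · intro φ
    have key : ∀ i j, ∃ u, ρ u = ρ (e j) * φ * ρ (e i) := by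
      intro i j
      obtain ⟨v, hv, hv', hvx⟩ := g.exists_corner (q := e j) (l := ρ (e j) (φ (ρ (F.a i) x₀)))
        (by rw [← Module.End.mul_apply, ← map_mul, hid])
      have hai : ρ (F.a i) x₀ ∈ LinearMap.range (ρ (e i)) := by
        rw [mem_range_iff_of_idem (hid i), ← Module.End.mul_apply, ← map_mul, (F.a_mem i).1]
      -- Viewed as a map from the ideal at `i` to B, the homomorphism is a right multiplication, so
      -- its values remain in this two-sided ideal. `exists_mul_a_eq` then writes `v` as a multiple
      -- of a_i.
      obtain ⟨w, hw, hvw⟩ : ∃ w ∈ corner K (e i) (e one), F.b j * v = F.b i * w := by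
        obtain ⟨ψ, -⟩ := F.exists_equiv g (hid i)
        obtain ⟨τ, hτ⟩ := g.exists_span_equiv
        let T : F.ideal g i →ₗ[B] LinearMap.range (ρ (e one)) :=
          ((ρ (F.b j) * φ).comp ((Submodule.subtype _).comp ψ.symm.toLinearMap)).codRestrict _
            fun z => by
              rw [mem_range_iff_of_idem (hid one), LinearMap.comp_apply, Module.End.mul_apply,
                ← Module.End.mul_apply, ← map_mul, (F.b_mem j).1]
        obtain ⟨c, hc⟩ := exists_eq_mul_right (F.injective g) (τ.symm.toLinearMap.comp T)
        have := F.isTwoSided g i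
        obtain ⟨w, hw, hw'⟩ := (F.mem_ideal g).1 (Ideal.mul_mem_right c _ (ψ ⟨_, hai⟩).2)
        refine ⟨w, hw, ?_⟩
        rw [← sub_eq_zero]
        refine g.eq_zero (by rw [sub_mul, mul_assoc, mul_assoc, hv', hw.2]) ?_
        rw [map_sub, LinearMap.sub_apply, ← hw', ← hc, ← hτ, LinearMap.comp_apply,
          LinearEquiv.coe_coe, LinearEquiv.apply_symm_apply, sub_eq_zero, map_mul,
          Module.End.mul_apply, hvx, ← Module.End.mul_apply, ← map_mul, (F.b_mem j).2]
        show _ = ρ (F.b j) (φ ((ψ.symm (ψ ⟨_, hai⟩) : LinearMap.range (ρ (e i))) : L))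
        rw [LinearEquiv.symm_apply_apply]
      obtain ⟨u, hu, rfl⟩ := F.exists_mul_a_eq i j v ⟨hv, hv'⟩ ⟨w, hw, hvw⟩
      refine ⟨u, LinearMap.ext fun l => ?_⟩
      obtain ⟨r, hr, hr', hrl⟩ := g.exists_corner (q := e i) (l := ρ (e i) l)
        (by rw [← Module.End.mul_apply, ← map_mul, hid])
      obtain ⟨c, hc, rfl⟩ := F.a_generates i r ⟨hr, hr'⟩
      obtain ⟨b, hb⟩ := g.exists_right (ρ c x₀) (by rw [← Module.End.mul_apply, ← map_mul, hc.1])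
      have h1 : ρ (e i) l = b • ρ (F.a i) x₀ := by
        rw [← hrl, map_mul, Module.End.mul_apply, ← hb, map_smul]
      rw [Module.End.mul_apply, Module.End.mul_apply, h1, map_smul, map_smul, ← hvx, map_mul,
        Module.End.mul_apply, ← map_smul, ← h1, ← Module.End.mul_apply, ← map_mul, hu.2]
    choose u hu using key
    refine ⟨∑ i, ∑ j, u i j, ?_⟩
    have h1 : ∑ i, ρ (e i) = 1 := by rw [← map_sum, he.complete, map_one]
    simp_rw [map_sum, hu, ← Finset.sum_mul, h1, ← Finset.mul_sum, h1, one_mul, mul_one]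

/-- An algebra with the structure of a 1-quasi-hereditary algebra, acting on a module that is
generated as in `IsPairGenerator`, is the endomorphism algebra of a module with an ordered family
of ideals. -/
theorem IsCore.of_isPairGenerator [IsAlgClosed K] [Fintype Λ] [Module.Finite K A]
    [Module.Finite K B] {top : Λ} {x y : Λ → A} (h : IsCore K one top e x y)
    (he : IsVertexLabelling e) (g : IsPairGenerator ρ (e one) x₀) :
    (IsLocalSelfInjectiveOfCard K Λ B ∧ ∃ I : Λ → Ideal B, IsOrderedIdealFamily one I ∧
      ∀ i, Nonempty (LinearMap.range (ρ (e i)) ≃ₗ[B] I i)) ∧ Function.Bijective ρ := by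
  obtain ⟨F⟩ := h.nonempty_localFrame
  have hid := fun i => (he.1.idem i).eq
  have : IsLocalRing B := g.isLocalRing (he.isPrimitiveIdem one)
  exact ⟨⟨⟨this, F.injective g, F.finrank_eq g⟩, F.ideal g,
    F.isOrderedIdealFamily g hid (fun i => (he.isPrimitiveIdem i).1) h.one_le,
    fun i => ⟨(F.exists_equiv g (hid i)).choose⟩⟩, F.bijective g he.1⟩

end Pair

/-! ### A basis of B adapted to the ideals. -/

section OrderedBasis

variable {K : Type u} [Field K] {B : Type u} [Ring B] [Algebra K B] {Λ : Type v} [PartialOrder Λ]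

theorem exists_sub_not_isUnit [IsAlgClosed K] [Module.Finite K B] [Nontrivial B] (b : B) :
    ∃ t : K, ¬ IsUnit (b - algebraMap K B t) := by
  obtain ⟨t, ht⟩ := spectrum.nonempty_of_isAlgClosed_of_finiteDimensional K b
  exact ⟨t, by rwa [IsUnit.sub_iff]⟩

theorem exists_hom_of_injective {X : Type u} [AddCommGroup X] [Module B X]
    (hX : Module.Injective B X) (v : B) (w : X) (hvw : ∀ b, b * v = 0 → b • w = 0) :
    ∃ g : B →ₗ[B] X, g v = w := by
  have hv : ∀ y ∈ Ideal.span {v}, ∃ b, b * v = y := fun y hy =>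
    Submodule.mem_span_singleton.1 hy
  choose! s hs using hv
  have hs' : ∀ b b', b * v = b' * v → b • w = b' • w := fun b b' hb => by
    rw [← sub_eq_zero, ← sub_smul]
    exact hvw _ (by rw [sub_mul, hb, sub_self])
  let f : Ideal.span {v} →ₗ[B] X :=
    { toFun := fun y => s y • w
      map_add' := fun y y' => by
        rw [← add_smul]
        exact hs' _ _ (by rw [add_mul, hs _ y.2, hs _ y'.2, hs _ (y + y').2]; rfl)
      map_smul' := fun b y => by
        rw [RingHom.id_apply, ← mul_smul]
        exact hs' _ _ (by rw [mul_assoc, hs _ y.2, hs _ (b • y).2]; rfl) }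
  have hvv : v ∈ Ideal.span {v} := Ideal.subset_span rfl
  obtain ⟨g, hg⟩ := Module.Baer.of_injective hX _ f
  refine ⟨g, ?_⟩
  rw [hg v hvv]
  exact (hs' (s v) 1 (by rw [hs v hvv, one_mul])).trans (one_smul B w)

/-- Nakayama's lemma for one element: `d * n` is not a unit, so `1 - d * n` is one, and it kills
`z`. -/
theorem eq_zero_of_mul_mul_eq [IsLocalRing B] [IsDedekindFiniteMonoid B] {M : Type u}
    [AddCommGroup M] [Module B M] {n d : B} (hn : ¬ IsUnit n) {z : M} (h : d • n • z = z) :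
    z = 0 := by
  rcases IsLocalRing.isUnit_or_isUnit_of_add_one (add_sub_cancel (d * n) 1) with h1 | h1
  · obtain ⟨w, hw⟩ := h1.exists_left_inv
    exact (hn (IsUnit.of_mul_eq_one_right (w * d) (by rw [mul_assoc, hw]))).elim
  · refine h1.smul_eq_zero.1 ?_
    rw [sub_smul, mul_smul, h, one_smul, sub_self]

/-- A basis of `B` such that `z i` generates the ideal `I i` from both sides, and such that
`z top` spans the socle. -/
structure IsOrderedBasis (top : Λ) (I : Λ → Ideal B) (z : Module.Basis Λ K B) : Prop where
  le_top : ∀ i, i ≤ top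
  mem_iff : ∀ i w, w ∈ I i ↔ w ∈ Submodule.span K (z '' Set.Ici i)
  generates : ∀ i, ∀ w ∈ I i, ∃ b, b * z i = w
  right_generates : ∀ i, ∀ w ∈ I i, ∃ d, z i * d = w
  mem_of_mul_eq_zero : ∀ i w, (∀ b, b * z i = 0 → b * w = 0) → w ∈ I i
  mul_mem : ∀ i, ∀ w ∈ I i, ∀ d, w * d ∈ I i
  nonunit_mul : ∀ i b, ¬ IsUnit b → b * z i ∈ Submodule.span K (z '' Set.Ioi i)
  exists_mul_left : ∀ w, w ≠ 0 → ∃ b, b * w = z top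
  exists_mul_right : ∀ w, w ≠ 0 → ∃ d, w * d = z top

theorem IsOrderedBasis.mul_eq_zero {top : Λ} {I : Λ → Ideal B} {z : Module.Basis Λ K B}
    (h : IsOrderedBasis top I z) (i : Λ) (w : B) (hw : w ∈ I i) (b : B) (hb : b * z i = 0) :
    b * w = 0 := by
  obtain ⟨d, rfl⟩ := h.right_generates i w hw
  rw [← mul_assoc, hb, zero_mul]

variable {one : Λ} {I : Λ → Ideal B}

theorem IsOrderedIdealFamily.le_of_lt (h : IsOrderedIdealFamily one I) {i j : Λ} (hij : i < j) :
    I j ≤ I i :=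
  calc I j ≤ ⨆ j, ⨆ _ : i < j, I j := le_iSup_of_le j (le_iSup_of_le hij le_rfl)
    _ = _ := (h.rad_eq i).symm
    _ ≤ I i := Submodule.map_subtype_le _ _

theorem IsOrderedIdealFamily.exists_generator [Module.Finite K B] (h : IsOrderedIdealFamily one I)
    (i : Λ) : ∃ z ∈ I i, z ∉ (⨆ j, ⨆ _ : i < j, I j) := by
  obtain ⟨z, hz⟩ : ∃ z : I i, z ∉ Module.jacobson B (I i) := by
    by_contra! hc
    exact (h.isLocal i).isCoatom_jacobson.1 (Submodule.eq_top_iff'.2 hc)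
  refine ⟨z, z.2, ?_⟩
  rw [← h.rad_eq i]
  rintro ⟨w, hw, hwz⟩
  rw [Subtype.ext hwz] at hw
  exact hz hw

theorem IsOrderedIdealFamily.exists_mul_eq [Module.Finite K B] (h : IsOrderedIdealFamily one I)
    {i : Λ} {z : B} (hz : z ∈ I i) (hz' : z ∉ (⨆ j, ⨆ _ : i < j, I j)) {w : B} (hw : w ∈ I i) :
    ∃ b, b * z = w := by
  have : IsArtinianRing B := IsArtinianRing.of_finite K B
  have htop : Submodule.span B {(⟨z, hz⟩ : I i)} = ⊤ := by
    by_contra hne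
    apply hz'
    rw [← h.rad_eq i]
    exact ⟨⟨z, hz⟩, (h.isLocal i).le_jacobson hne (Submodule.mem_span_singleton_self _), rfl⟩
  have hmem : (⟨w, hw⟩ : I i) ∈ Submodule.span B {(⟨z, hz⟩ : I i)} := by
    rw [htop]
    trivial
  obtain ⟨b, hb⟩ := Submodule.mem_span_singleton.1 hmem
  exact ⟨b, congrArg Subtype.val hb⟩

theorem IsOrderedIdealFamily.nonunit_mul_mem [Module.Finite K B] [IsLocalRing B]
    (h : IsOrderedIdealFamily one I) {i : Λ} {z : B} (hz : z ∈ I i)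
    (hz' : z ∉ (⨆ j, ⨆ _ : i < j, I j)) {b : B} (hb : ¬ IsUnit b) :
    b * z ∈ (⨆ j, ⨆ _ : i < j, I j) := by
  have : IsArtinianRing B := IsArtinianRing.of_finite K B
  by_contra hc
  obtain ⟨d, hd⟩ := h.exists_mul_eq (K := K) ((I i).mul_mem_left b hz) hc hz
  rw [eq_zero_of_mul_mul_eq hb hd] at hz'
  exact hz' (zero_mem _)

theorem IsOrderedIdealFamily.exists_sub_mem [IsAlgClosed K] [Module.Finite K B] [IsLocalRing B]
    (h : IsOrderedIdealFamily one I) {i : Λ} {z : B} (hz : z ∈ I i)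
    (hz' : z ∉ (⨆ j, ⨆ _ : i < j, I j)) {w : B} (hw : w ∈ I i) :
    ∃ t : K, w - t • z ∈ (⨆ j, ⨆ _ : i < j, I j) := by
  obtain ⟨b, rfl⟩ := h.exists_mul_eq (K := K) hz hz' hw
  obtain ⟨t, ht⟩ := exists_sub_not_isUnit (K := K) b
  refine ⟨t, ?_⟩
  rw [Algebra.smul_def, ← sub_mul]
  exact h.nonunit_mul_mem (K := K) hz hz' ht

/-- Descending induction, since each ideal is the line of its generator plus the ideals above. The
generators are arbitrary because a second choice of them is used for `exists_isOrderedBasis`. -/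
theorem IsOrderedIdealFamily.mem_of_forall [IsAlgClosed K] [Module.Finite K B] [IsLocalRing B]
    [Fintype Λ] (h : IsOrderedIdealFamily one I) {z : Λ → B} (hz : ∀ i, z i ∈ I i)
    (hz' : ∀ i, z i ∉ (⨆ j, ⨆ _ : i < j, I j)) (P : Submodule K B) (i : Λ)
    (hP : ∀ k, i ≤ k → z k ∈ P) {w : B} (hw : w ∈ I i) : w ∈ P := by
  induction i using (wellFounded_gt (α := Λ)).induction generalizing w with
  | _ i ih =>
  obtain ⟨t, ht⟩ := h.exists_sub_mem (K := K) (hz i) (hz' i) hw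
  rw [← sub_add_cancel w (t • z i)]
  refine add_mem ?_ (P.smul_mem t (hP i le_rfl))
  rw [iSup_subtype'] at ht
  have key : ∀ r ∈ (⨆ j : {j // i < j}, I j), r ∈ P := by
    intro r hr
    induction hr using Submodule.iSup_induction' with
    | mem j b hb => exact ih j j.2 (fun k hk => hP k (j.2.le.trans hk)) hb
    | zero => exact zero_mem _
    | add b b' _ _ h1 h2 => exact add_mem h1 h2
  exact key _ ht

/-- Generators z_i of the ideals span B, and their number is dim B. Properties of right multiples
come from self-injectivity: `w` is a right multiple of `v` once the left annihilator of `v` kills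
`w`. -/
theorem IsOrderedIdealFamily.exists_isOrderedBasis [IsAlgClosed K] [Module.Finite K B] [Fintype Λ]
    (h : IsOrderedIdealFamily one I) (hB : IsLocalSelfInjectiveOfCard K Λ B) :
    (∀ i, one ≤ i) ∧ ∃ (top : Λ) (z : Module.Basis Λ K B), IsOrderedBasis top I z := by
  classical
  obtain ⟨hloc, hinj, hcard⟩ := hB
  have : IsArtinianRing B := IsArtinianRing.of_finite K B
  choose z hz hz' using h.exists_generator (K := K)
  have hzne : ∀ i, z i ≠ 0 := fun i h0 => hz' i (by rw [h0]; exact zero_mem _)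
  have hgen : ∀ i, ∀ w ∈ I i, ∃ b, b * z i = w := fun i w hw =>
    h.exists_mul_eq (K := K) (hz i) (hz' i) hw
  have hmono : ∀ {i j}, i ≤ j → I j ≤ I i := fun {i j} hij => by
    rcases hij.eq_or_lt with rfl | hlt
    · exact le_rfl
    · exact h.le_of_lt hlt
  have hone : ∀ i, one ≤ i := by
    intro i
    refine (h.surj_iff one i).1 ⟨(LinearMap.toSpanSingleton B (I i) ⟨z i, hz i⟩).comp
      (I one).subtype, ?_⟩
    rintro ⟨w, hw⟩
    obtain ⟨b, hb⟩ := hgen i w hw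
    exact ⟨⟨b, by rw [h.eq_top]; trivial⟩, Subtype.ext hb⟩
  have hspan : ⊤ ≤ Submodule.span K (Set.range z) := by
    rintro w -
    refine h.mem_of_forall (K := K) hz hz' (Submodule.span K (Set.range z)) one
      (fun k _ => Submodule.subset_span ⟨k, rfl⟩) ?_
    rw [h.eq_top]
    trivial
  let Z : Module.Basis Λ K B := basisOfTopLeSpanOfCardEqFinrank z hspan hcard.symm
  have hZ : ⇑Z = z := coe_basisOfTopLeSpanOfCardEqFinrank z hspan hcard.symm
  have hmem : ∀ i w, w ∈ I i ↔ w ∈ Submodule.span K (Z '' Set.Ici i) := by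
    intro i w
    rw [hZ]
    constructor
    · exact h.mem_of_forall (K := K) hz hz' (Submodule.span K (z '' Set.Ici i)) i
        fun k hk => Submodule.subset_span ⟨k, hk, rfl⟩
    · have hle : Submodule.span K (z '' Set.Ici i) ≤ (I i).restrictScalars K := by
        rw [Submodule.span_le]
        rintro _ ⟨k, hk, rfl⟩
        exact hmono hk (hz k)
      exact fun hw => hle hw
  -- For `i ≤ k` the epimorphism I_i → I_k sends z_i to a generator of I_k killed by `b`. These
  -- generators span I_i, so `b` kills I_i.
  have hmul : ∀ i, ∀ w ∈ I i, ∀ b, b * z i = 0 → b * w = 0 := by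
    intro i w hw b hb
    let P : Submodule K B := LinearMap.ker (LinearMap.mulLeft K b)
    have hex : ∀ k, ∃ g, i ≤ k → (g ∈ I k ∧ g ∉ (⨆ j, ⨆ _ : k < j, I j) ∧ g ∈ P) := by
      intro k
      by_cases hik : i ≤ k
      · obtain ⟨f, hf⟩ := (h.surj_iff i k).2 hik
        refine ⟨f ⟨z i, hz i⟩, fun _ => ⟨(f _).2, fun hc => ?_, ?_⟩⟩
        · obtain ⟨⟨v, hv⟩, hfv⟩ := hf ⟨z k, hz k⟩
          obtain ⟨d, rfl⟩ := hgen i v hv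
          apply hz' k
          have h1 : (⟨d * z i, hv⟩ : I i) = d • ⟨z i, hz i⟩ := rfl
          rw [h1, map_smul] at hfv
          rw [show z k = d * f ⟨z i, hz i⟩ from (congrArg Subtype.val hfv).symm]
          exact Ideal.mul_mem_left _ d hc
        · have h1 : b • (⟨z i, hz i⟩ : I i) = 0 := Subtype.ext hb
          have h2 : b • f ⟨z i, hz i⟩ = 0 := by rw [← map_smul, h1, map_zero]
          exact congrArg Subtype.val h2
      · exact ⟨0, fun hk => (hik hk).elim⟩
    choose g hg using hex
    let z₂ : Λ → B := fun k => if i ≤ k then g k else z k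
    have h1 : ∀ k, z₂ k ∈ I k := by
      intro k
      by_cases hk : i ≤ k
      · simp only [z₂, if_pos hk]
        exact (hg k hk).1
      · simp only [z₂, if_neg hk]
        exact hz k
    have h2 : ∀ k, z₂ k ∉ (⨆ j, ⨆ _ : k < j, I j) := by
      intro k
      by_cases hk : i ≤ k
      · simp only [z₂, if_pos hk]
        exact (hg k hk).2.1
      · simp only [z₂, if_neg hk]
        exact hz' k
    refine h.mem_of_forall (K := K) h1 h2 P i (fun k hk => ?_) hw
    simp only [z₂, if_pos hk]
    exact (hg k hk).2.2
  have htwo : ∀ i, ∀ w ∈ I i, ∀ d, w * d ∈ I i := fun i w hw d => by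
    have := h.twoSided i
    exact Ideal.mul_mem_right d _ hw
  have hext : ∀ v w : B, (∀ b, b * v = 0 → b * w = 0) → ∃ c, v * c = w := by
    intro v w hvw
    obtain ⟨g, hg⟩ := exists_hom_of_injective hinj v w hvw
    exact ⟨g 1, by rw [← smul_eq_mul, ← map_smul, smul_eq_mul, mul_one, hg]⟩
  obtain ⟨m, -, hm⟩ := Finite.exists_le_maximal (α := Λ) (p := fun _ => True) (a := one) trivial
  have hmax : ∀ {k}, (∀ j, ¬ k < j) → ∀ b, ¬ IsUnit b → b * z k = 0 := by
    intro k hk b hb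
    have h1 := h.nonunit_mul_mem (K := K) (hz k) (hz' k) hb
    have h2 : (⨆ j, ⨆ _ : k < j, I j) = ⊥ := by
      rw [eq_bot_iff]
      exact iSup_le fun j => iSup_le fun hj => (hk j hj).elim
    rw [h2] at h1
    exact h1
  have hm' : ∀ j, ¬ m < j := fun j hj => hm.not_gt trivial hj
  -- For a maximal `k`, every non-unit kills both z_k and z_m, so z_m is a right multiple of z_k and
  -- lies in I_k. Hence `k ≤ m`, and there is only one maximal element.
  have hle_top : ∀ i, i ≤ m := by
    intro i
    obtain ⟨k, hik, hk⟩ := Finite.exists_le_maximal (α := Λ) (p := fun _ => True) (a := i) trivial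
    have hk' : ∀ j, ¬ k < j := fun j hj => hk.not_gt trivial hj
    obtain ⟨c, hc⟩ := hext (z k) (z m) fun b hb => by
      refine hmax hm' b fun hu => hzne k ?_
      exact hu.mul_right_eq_zero.1 hb
    have h1 : z m ∈ I k := by
      rw [← hc]
      exact htwo k _ (hz k) c
    rw [hmem, ← hZ, Module.Basis.self_mem_span_image] at h1
    rwa [hk.eq_of_le trivial h1] at hik
  have hright : ∀ w, w ≠ 0 → ∃ d, w * d = z m := by
    intro w hw
    refine hext w (z m) fun b hb => hmax hm' b fun hu => hw ?_
    exact hu.mul_right_eq_zero.1 hb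
  refine ⟨hone, m, Z, hle_top, hmem, ?_, ?_, ?_, htwo, ?_, ?_, ?_⟩
  · rw [hZ]
    exact hgen
  · rw [hZ]
    exact fun i w hw => hext _ _ (hmul i w hw)
  · intro i w hw
    rw [hZ] at hw
    obtain ⟨c, rfl⟩ := hext _ _ hw
    exact htwo i _ (hz i) c
  · intro i b hb
    rw [hZ]
    have h1 := h.nonunit_mul_mem (K := K) (hz i) (hz' i) hb
    have hle : ∀ r ∈ (⨆ j : {j // i < j}, I j), r ∈ Submodule.span K (z '' Set.Ioi i) := by
      intro r hr
      induction hr using Submodule.iSup_induction' with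
      | mem j b hb =>
        rw [hmem, hZ] at hb
        exact Submodule.span_mono (Set.image_mono fun k hk => lt_of_lt_of_le j.2 hk) hb
      | zero => exact zero_mem _
      | add b b' _ _ h h' => exact add_mem h h'
    rw [iSup_subtype'] at h1
    exact hle _ h1
  · intro w hw
    rw [hZ]
    have hne : Ideal.span {w} ≠ ⊥ := by
      rw [Ne, Ideal.span_singleton_eq_bot]
      exact hw
    -- Non-units kill a nonzero element `s` of a simple left ideal inside B w. So `s` is a right
    -- multiple of z_m, hence a scalar multiple, as I_m is the line of z_m.
    obtain ⟨N, hN, hNw⟩ := (IsAtomic.eq_bot_or_exists_atom_le (Ideal.span {w})).resolve_left hne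
    obtain ⟨s, hsN, hs0⟩ := Submodule.exists_mem_ne_zero_of_ne_bot hN.1
    obtain ⟨c, hc⟩ := hext (z m) s fun b hb => by
      by_contra hbs
      have h1 : Ideal.span {b * s} = N := by
        refine (hN.le_iff.1 ?_).resolve_left ?_
        · rw [Ideal.span_singleton_le_iff_mem]
          exact N.mul_mem_left b hsN
        · rw [Ideal.span_singleton_eq_bot]
          exact hbs
      rw [← h1] at hsN
      obtain ⟨d, hd⟩ := Submodule.mem_span_singleton.1 hsN
      refine hs0 (eq_zero_of_mul_mul_eq (n := b) (d := d) (fun hu => hzne m ?_) hd)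
      exact hu.mul_right_eq_zero.1 hb
    have hsm : s ∈ I m := by
      rw [← hc]
      exact htwo m _ (hz m) c
    have hIci : Set.Ici m = {m} := by
      ext k
      simp only [Set.mem_Ici, Set.mem_singleton_iff]
      exact ⟨fun hk => le_antisymm (hle_top k) hk, fun hk => hk.ge⟩
    rw [hmem, hZ, hIci, Set.image_singleton] at hsm
    obtain ⟨t, rfl⟩ := Submodule.mem_span_singleton.1 hsm
    have ht : t ≠ 0 := by
      rintro rfl
      exact hs0 (zero_smul _ _)
    obtain ⟨b, hb⟩ := Submodule.mem_span_singleton.1 (hNw hsN)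
    refine ⟨t⁻¹ • b, ?_⟩
    rw [smul_mul_assoc, show b * w = t • z m from hb, smul_smul, inv_mul_cancel₀ ht, one_smul]
  · rw [hZ]
    exact hright

end OrderedBasis

/-! ### Products with the elements of an adapted basis. -/

section OrderedBasis

variable {K : Type u} [Field K] {B : Type u} [Ring B] [Algebra K B] {Λ : Type v} [PartialOrder Λ]
  {one top : Λ} {I : Λ → Ideal B} {z : Module.Basis Λ K B}

theorem IsOrderedBasis.mem_self (h : IsOrderedBasis top I z) {i k : Λ} (hik : i ≤ k) :
    z k ∈ I i :=
  (h.mem_iff i _).2 (Submodule.subset_span ⟨k, hik, rfl⟩)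

theorem IsOrderedBasis.mem_inf_iff (h : IsOrderedBasis top I z) {i j : Λ} {w : B} :
    (w ∈ I i ∧ w ∈ I j) ↔ w ∈ Submodule.span K (z '' {k | i ≤ k ∧ j ≤ k}) := by
  rw [h.mem_iff, h.mem_iff, Module.Basis.mem_span_image, Module.Basis.mem_span_image,
    Module.Basis.mem_span_image]
  exact ⟨fun hw k hk => ⟨hw.1 hk, hw.2 hk⟩, fun hw => ⟨fun k hk => (hw hk).1, fun k hk =>
    (hw hk).2⟩⟩

theorem IsOrderedBasis.mem_above_of_not_le (h : IsOrderedBasis top I z) {i j : Λ} {w : B}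
    (hi : w ∈ I i) (hj : w ∈ I j) (hij : ¬ j ≤ i) : w ∈ Submodule.span K (z '' Set.Ioi i) := by
  refine Submodule.span_mono (Set.image_mono fun k hk => ?_) (h.mem_inf_iff.1 ⟨hi, hj⟩)
  exact lt_of_le_of_ne hk.1 fun h0 => hij (h0 ▸ hk.2)

theorem IsOrderedBasis.exists_sub_mem (h : IsOrderedBasis top I z) {i : Λ} {w : B}
    (hi : w ∈ I i) : ∃ t : K, w - t • z i ∈ Submodule.span K (z '' Set.Ioi i) := by
  rw [h.mem_iff, show Set.Ici i = insert i (Set.Ioi i) from Set.Ioi_insert.symm,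
    Set.image_insert_eq, Submodule.mem_span_insert] at hi
  obtain ⟨t, r, hr, rfl⟩ := hi
  exact ⟨t, by rwa [add_sub_cancel_left]⟩

theorem IsOrderedBasis.mul_mem_above (h : IsOrderedBasis top I z) {i : Λ} (b : B) {w : B}
    (hw : w ∈ Submodule.span K (z '' Set.Ioi i)) :
    b * w ∈ Submodule.span K (z '' Set.Ioi i) := by
  have hle : Submodule.span K (z '' Set.Ioi i) ≤
      (Submodule.span K (z '' Set.Ioi i)).comap (LinearMap.mulLeft K b) := by
    rw [Submodule.span_le]
    rintro _ ⟨k, hk, rfl⟩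
    have h1 := (h.mem_iff k _).1 ((I k).mul_mem_left b (h.mem_self le_rfl))
    exact Submodule.span_mono (Set.image_mono fun l hl => lt_of_lt_of_le hk hl) h1
  exact hle hw

/-- For `k > i` some `d` kills z_k but not z_i, as z_i is not in I_k. If c d z_i = z_top, then b - c
d kills z_i, hence all of I_i and in particular z_k; so b z_k = c d z_k = 0. -/
theorem IsOrderedBasis.mul_above_eq_zero (h : IsOrderedBasis top I z) {i : Λ} {b w : B}
    (hb : b * z i = z top) (hw : w ∈ Submodule.span K (z '' Set.Ioi i)) : b * w = 0 := by
  have hle : Submodule.span K (z '' Set.Ioi i) ≤ LinearMap.ker (LinearMap.mulLeft K b) := by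
    rw [Submodule.span_le]
    rintro _ ⟨k, hk, rfl⟩
    obtain ⟨d, hd, hd'⟩ : ∃ d, d * z k = 0 ∧ d * z i ≠ 0 := by
      by_contra! hc
      have h1 := h.mem_of_mul_eq_zero k (z i) hc
      rw [h.mem_iff, Module.Basis.self_mem_span_image] at h1
      exact absurd h1 (not_le_of_gt hk)
    obtain ⟨c, hc⟩ := h.exists_mul_left _ hd'
    have h1 := h.mul_eq_zero i (z k) (h.mem_self (le_of_lt hk)) (b - c * d) (by
      rw [sub_mul, hb, mul_assoc, hc, sub_self])
    rwa [sub_mul, mul_assoc, hd, mul_zero, sub_zero] at h1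
  exact hle hw

/-- On I_i, left multiplication by `b` is the coefficient of z_i times z_top. -/
theorem IsOrderedBasis.mem_above_of_mul_eq_zero (h : IsOrderedBasis top I z) {i : Λ} {b w : B}
    (hb : b * z i = z top) (hw : w ∈ I i) (hbw : b * w = 0) :
    w ∈ Submodule.span K (z '' Set.Ioi i) := by
  obtain ⟨t, ht⟩ := h.exists_sub_mem hw
  have h1 := h.mul_above_eq_zero hb ht
  rw [mul_sub, hbw, zero_sub, neg_eq_zero, mul_smul_comm, hb] at h1
  have ht0 : t = 0 := (smul_eq_zero.1 h1).resolve_right (z.ne_zero top)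
  rwa [ht0, zero_smul, sub_zero] at ht

theorem IsOrderedBasis.mul_top_eq_zero_iff [IsLocalRing B] (h : IsOrderedBasis top I z) (b : B) :
    b * z top = 0 ↔ ¬ IsUnit b := by
  constructor
  · intro hb hu
    exact z.ne_zero top (hu.mul_right_eq_zero.1 hb)
  · intro hb
    have h1 := h.nonunit_mul top b hb
    rwa [show Set.Ioi top = ∅ from Set.eq_empty_of_forall_notMem fun k hk =>
      not_lt_of_ge (h.le_top k) hk, Set.image_empty, Submodule.span_empty] at h1

theorem IsOrderedBasis.not_isUnit_iff [IsLocalRing B] (h : IsOrderedBasis top I z) {i : Λ}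
    {b : B} : ¬ IsUnit b ↔ b * z i ∈ Submodule.span K (z '' Set.Ioi i) := by
  refine ⟨h.nonunit_mul i b, fun hb hu => ?_⟩
  obtain ⟨c, hc⟩ := hu.exists_left_inv
  have h1 := h.mul_mem_above c hb
  rw [← mul_assoc, hc, one_mul, Module.Basis.self_mem_span_image] at h1
  exact lt_irrefl i h1

end OrderedBasis

/-! ### From the ideals to the elementwise description. -/

section Model

variable {K : Type u} [Field K] {A : Type u} [Ring A] [Algebra K A]
  {B : Type u} [Ring B] [Algebra K B] {Λ : Type v}

/-- The spaces `e_j A e_i` are identified with the intersections `I i ⊓ I j`, by maps `Θ j i` that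
are compatible with the multiplication: homomorphisms between the ideals `I i` are recorded by
the images of the generators `z i`. -/
structure IsIdealModel (I : Λ → Ideal B) (z : Λ → B) (e : Λ → A) (Θ : Λ → Λ → A →ₗ[K] B) :
    Prop where
  mem : ∀ j i, ∀ u ∈ corner K (e j) (e i), Θ j i u ∈ I i ∧ Θ j i u ∈ I j
  eq_zero : ∀ j i, ∀ u ∈ corner K (e j) (e i), Θ j i u = 0 → u = 0
  exists_eq : ∀ j i, ∀ w ∈ I i, w ∈ I j → ∃ u ∈ corner K (e j) (e i), Θ j i u = w
  mul : ∀ i j k, ∀ u ∈ corner K (e j) (e i), ∀ v ∈ corner K (e k) (e j), ∀ b,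
    b * z j = Θ j i u → Θ k i (v * u) = b * Θ k j v

theorem IsIdealModel.eq_of_eq {I : Λ → Ideal B} {z : Λ → B} {e : Λ → A}
    {Θ : Λ → Λ → A →ₗ[K] B} (m : IsIdealModel I z e Θ) {j i : Λ} {u v : A}
    (hu : u ∈ corner K (e j) (e i)) (hv : v ∈ corner K (e j) (e i)) (h : Θ j i u = Θ j i v) :
    u = v :=
  sub_eq_zero.1 (m.eq_zero j i _ (sub_mem hu hv) (by rw [map_sub, h, sub_self]))

variable [PartialOrder Λ] {one top : Λ} {I : Λ → Ideal B} {z : Module.Basis Λ K B} {e : Λ → A}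
  {Θ : Λ → Λ → A →ₗ[K] B}

/-- For `k` above `i`, `p` and `q`, the element of e_p A e_q represented by z_k is the product of
those represented by z_k in e_p A e_k and in e_k A e_q. -/
theorem IsIdealModel.mem_above (m : IsIdealModel I z e Θ) (h : IsOrderedBasis top I z)
    {i p q : Λ} {c : A} (hc : c ∈ corner K (e p) (e q))
    (hcz : Θ p q c ∈ Submodule.span K (z '' Set.Ioi i)) : c ∈ above K e i p q := by
  have h1 : Θ p q c ∈ Submodule.span K (z '' {k | i < k ∧ p ≤ k ∧ q ≤ k}) := by
    have h2 := h.mem_inf_iff.1 (m.mem p q c hc)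
    rw [Module.Basis.mem_span_image] at hcz h2 ⊢
    exact fun k hk => ⟨hcz hk, (h2 hk).2, (h2 hk).1⟩
  have hle : Submodule.span K (z '' {k | i < k ∧ p ≤ k ∧ q ≤ k}) ≤
      (above K e i p q).map (Θ p q) := by
    rw [Submodule.span_le]
    rintro _ ⟨k, ⟨hik, hpk, hqk⟩, rfl⟩
    obtain ⟨v, hv, hvz⟩ := m.exists_eq k q (z k) (h.mem_self hqk) (h.mem_self le_rfl)
    obtain ⟨u, hu, huz⟩ := m.exists_eq p k (z k) (h.mem_self le_rfl) (h.mem_self hpk)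
    refine ⟨u * v, Submodule.subset_span ⟨k, hik, u, hu, v, hv, rfl⟩, ?_⟩
    rw [m.mul q k p v hv u hu 1 (by rw [hvz, one_mul]), one_mul, huz]
  obtain ⟨c', hc', hcc⟩ := hle h1
  rwa [m.eq_of_eq hc (above_le_corner i p q hc') hcc.symm]

theorem IsIdealModel.finrank_corner [Fintype Λ] (m : IsIdealModel I z e Θ)
    (h : IsOrderedBasis top I z) (j i : Λ) :
    Module.finrank K (corner K (e j) (e i)) = Nat.card {k // i ≤ k ∧ j ≤ k} := by
  classical
  have h1 : (corner K (e j) (e i)).map (Θ j i) =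
      Submodule.span K (Set.range fun k : {k // i ≤ k ∧ j ≤ k} => z k) := by
    have h2 : (Set.range fun k : {k // i ≤ k ∧ j ≤ k} => z k) = z '' {k | i ≤ k ∧ j ≤ k} := by
      ext w
      simp
    rw [h2]
    ext w
    rw [← h.mem_inf_iff]
    constructor
    · rintro ⟨u, hu, rfl⟩
      exact m.mem j i u hu
    · rintro ⟨hi, hj⟩
      exact m.exists_eq j i w hi hj
  have hinj : Function.Injective ((Θ j i).comp (corner K (e j) (e i)).subtype) := by
    rw [← LinearMap.ker_eq_bot, eq_bot_iff]
    intro u hu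
    exact Subtype.ext (m.eq_zero j i u u.2 hu)
  have h3 := LinearMap.finrank_range_of_inj hinj
  rw [LinearMap.range_comp, Submodule.range_subtype, h1] at h3
  have h4 := finrank_span_eq_card (z.linearIndependent.comp
    (Subtype.val : {k // i ≤ k ∧ j ≤ k} → Λ) Subtype.val_injective)
  rw [← h3, Nat.card_eq_fintype_card]
  exact h4

/-- All `x i` and `y i` are represented by the socle generator z_top. Then c x_i = 0 iff Θ(c) has no
z_i-component, and y_i c = 0 iff a `b` with b z_i = Θ(c) is not a unit. -/
theorem IsIdealModel.exists_isCore [Fintype Λ] [IsLocalRing B] (m : IsIdealModel I z e Θ)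
    (h : IsOrderedBasis top I z) (he : CompleteOrthogonalIdempotents e) (hone : ∀ i, one ≤ i) :
    ∃ x y, IsCore K one top e x y := by
  have hI : ∀ w, w ∈ I one := fun w => (h.mem_iff one w).2 (by
    rw [show Set.Ici one = Set.univ from Set.eq_univ_of_forall hone, Set.image_univ,
      Module.Basis.span_eq]
    trivial)
  choose x hx hxz using fun i => m.exists_eq i top (z top) (h.mem_self le_rfl)
    (h.mem_self (h.le_top i))
  choose y hy hyz using fun i => m.exists_eq top i (z top) (h.mem_self (h.le_top i))
    (h.mem_self le_rfl)
  have hxy : ∀ j i, Θ j i (x j * y i) = z top := fun j i => by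
    rw [m.mul i top j _ (hy i) _ (hx j) 1 (by rw [hyz, one_mul]), one_mul, hxz]
  have hbz : ∀ i, ∃ b, b * z i = z top := fun i => h.exists_mul_left _ (z.ne_zero i)
  have hcx : ∀ i j, ∀ c ∈ corner K (e j) (e i), ∀ b, b * z i = z top →
      Θ j top (c * x i) = b * Θ j i c := fun i j c hc b hb =>
    m.mul top i j _ (hx i) c hc b (by rw [hb, hxz])
  have hyc : ∀ i j, ∀ c ∈ corner K (e i) (e j), ∀ b, b * z i = Θ i j c →
      Θ top j (y i * c) = b * z top := fun i j c hc b hb => by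
    rw [m.mul j i top c hc _ (hy i) b hb, hyz]
  refine ⟨x, y, he, hone, h.le_top, hx, hy, m.finrank_corner h, ?_, ?_, ?_, ?_, ?_, ?_, ?_⟩
  · intro h0
    have h1 := hxy one one
    rw [h0, map_zero] at h1
    exact z.ne_zero top h1.symm
  · intro j u huj hu
    obtain ⟨k, hk⟩ : ∃ k, e k * u ≠ 0 := by
      by_contra! hc
      apply hu
      rw [← one_mul u, ← he.complete, Finset.sum_mul]
      exact Finset.sum_eq_zero fun k _ => hc k
    have hku : e k * u ∈ corner K (e k) (e j) :=
      ⟨by rw [← mul_assoc, (he.idem k).eq], by rw [mul_assoc, huj]⟩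
    have hw : Θ k j (e k * u) ≠ 0 := fun h0 => hk (m.eq_zero k j _ hku h0)
    obtain ⟨d, hd⟩ := h.exists_mul_right _ hw
    obtain ⟨b, hb⟩ := h.generates k _ (m.mem k j _ hku).2
    obtain ⟨v, hv, hvz⟩ := m.exists_eq one k (z k * d)
      (h.mul_mem k _ (h.mem_self le_rfl) d) (hI _)
    refine ⟨v * e k, ?_⟩
    rw [mul_assoc]
    refine m.eq_of_eq (mul_mem_corner hv hku) (mul_mem_corner (hx one) (hy j)) ?_
    rw [hxy, m.mul j k one _ hku v hv b hb, hvz, ← mul_assoc, hb, hd]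
  · intro j u huj hu
    obtain ⟨k, hk⟩ : ∃ k, u * e k ≠ 0 := by
      by_contra! hc
      apply hu
      rw [← mul_one u, ← he.complete, Finset.mul_sum]
      exact Finset.sum_eq_zero fun k _ => hc k
    have hku : u * e k ∈ corner K (e j) (e k) :=
      ⟨by rw [← mul_assoc, huj], by rw [mul_assoc, (he.idem k).eq]⟩
    have hw : Θ j k (u * e k) ≠ 0 := fun h0 => hk (m.eq_zero j k _ hku h0)
    obtain ⟨b, hb⟩ := h.exists_mul_left _ hw
    obtain ⟨v, hv, hvz⟩ := m.exists_eq k one (b * z k) (hI _)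
      ((I k).mul_mem_left b (h.mem_self le_rfl))
    refine ⟨e k * v, ?_⟩
    rw [← mul_assoc]
    refine m.eq_of_eq (mul_mem_corner hku hv) (mul_mem_corner (hx j) (hy one)) ?_
    rw [hxy, m.mul one k j v hv _ hku b hvz.symm, hb]
  · intro i j
    obtain ⟨b, hb⟩ := hbz i
    constructor
    · rintro ⟨c, hc, hc0⟩
      by_contra hij
      apply hc0
      refine m.eq_zero j top _ (mul_mem_corner hc (hx i)) ?_
      have h1 := m.mem j i c hc
      rw [hcx i j c hc b hb, h.mul_above_eq_zero hb (h.mem_above_of_not_le h1.1 h1.2 hij)]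
    · intro hij
      obtain ⟨c, hc, hcz⟩ := m.exists_eq j i (z i) (h.mem_self le_rfl) (h.mem_self hij)
      refine ⟨c, hc, fun h0 => z.ne_zero top ?_⟩
      rw [← hb, ← hcz, ← hcx i j c hc b hb, h0, map_zero]
  · intro i j
    constructor
    · rintro ⟨c, hc, hc0⟩
      by_contra hij
      apply hc0
      refine m.eq_zero top j _ (mul_mem_corner (hy i) hc) ?_
      have h1 := m.mem i j c hc
      obtain ⟨b, hb⟩ := h.generates i _ h1.2
      rw [hyc i j c hc b hb, h.mul_top_eq_zero_iff, h.not_isUnit_iff (i := i), hb]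
      exact h.mem_above_of_not_le h1.2 h1.1 hij
    · intro hij
      obtain ⟨c, hc, hcz⟩ := m.exists_eq i j (z i) (h.mem_self hij) (h.mem_self le_rfl)
      refine ⟨c, hc, fun h0 => z.ne_zero top ?_⟩
      rw [← one_mul (z top), ← hyc i j c hc 1 (by rw [hcz, one_mul]), h0, map_zero]
  · intro i j c hc h0
    obtain ⟨b, hb⟩ := hbz i
    refine m.mem_above h hc (h.mem_above_of_mul_eq_zero hb (m.mem j i c hc).1 ?_)
    rw [← hcx i j c hc b hb, h0, map_zero]
  · intro i j c hc h0
    obtain ⟨b, hb⟩ := h.generates i _ (m.mem i j c hc).2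
    refine m.mem_above h hc ?_
    rw [← hb, ← h.not_isUnit_iff, ← h.mul_top_eq_zero_iff, ← hyc i j c hc b hb, h0, map_zero]

end Model

/-! ### Homomorphisms between the ideals as intersections. -/

section EndModel

variable {K : Type u} [Field K] {A : Type u} [Ring A] [Algebra K A]
  {B : Type u} [Ring B] [Algebra K B] {L : Type u} [AddCommGroup L] [Module K L] [Module B L]
  [IsScalarTower K B L]

theorem finite_end [Module.Finite K L] : Module.Finite K (Module.End B L) := by
  let T : Module.End B L →ₗ[K] (L →ₗ[K] L) :=
    { toFun := fun f => f.restrictScalars K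
      map_add' := fun _ _ => rfl
      map_smul' := fun _ _ => rfl }
  exact Module.Finite.of_injective T fun f g h => LinearMap.ext fun l => LinearMap.congr_fun h l

variable {Λ : Type v} [PartialOrder Λ] {one top : Λ} {e : Λ → A} {I : Λ → Ideal B}
  {z : Module.Basis Λ K B} {φ : A ≃ₐ[K] Module.End B L}

/-- A homomorphism e_i L → e_j L is recorded by the image of the generator corresponding to z_i.
This image is killed by the annihilator of z_i, so it lies in I_i ∩ I_j; conversely, w = z_i d in
the intersection is realized by right multiplication by `d`. -/
theorem IsOrderedBasis.exists_isIdealModel (h : IsOrderedBasis top I z)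
    (hid : ∀ i, e i * e i = e i) (ψ : ∀ i, LinearMap.range (φ (e i)) ≃ₗ[B] I i) :
    ∃ Θ : Λ → Λ → A →ₗ[K] B, IsIdealModel I z e Θ := by
  have hfix : ∀ i, ∀ l ∈ LinearMap.range (φ (e i)), φ (e i) l = l := fun i l hl =>
    (mem_range_iff_of_idem (ρ := (φ : A →ₐ[K] Module.End B L)) (hid i)).1 hl
  let l : Λ → L := fun i => ((ψ i).symm ⟨z i, h.mem_self le_rfl⟩ : LinearMap.range (φ (e i)))
  have hl : ∀ i, φ (e i) (l i) = l i := fun i => hfix i _ (Subtype.prop _)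
  let Ψ : ∀ j, L →ₗ[B] B := fun j =>
    (I j).subtype.comp ((ψ j).toLinearMap.comp (φ (e j)).rangeRestrict)
  have hΨmem : ∀ j x, Ψ j x ∈ I j := fun j x => Subtype.prop _
  have hΨinj : ∀ j x y, φ (e j) x = x → φ (e j) y = y → Ψ j x = Ψ j y → x = y := by
    intro j x y hx hy h0
    have h1 := congrArg Subtype.val ((ψ j).injective (Subtype.ext h0))
    rw [← hx, ← hy]
    exact h1
  have hΨl : ∀ j, Ψ j (l j) = z j := by
    intro j
    have h1 : (φ (e j)).rangeRestrict (l j) = (ψ j).symm ⟨z j, h.mem_self le_rfl⟩ :=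
      Subtype.ext (hl j)
    show ((ψ j) ((φ (e j)).rangeRestrict (l j)) : B) = z j
    rw [h1, LinearEquiv.apply_symm_apply]
  have hgen : ∀ i x, φ (e i) x = x → ∃ b : B, x = b • l i := by
    intro i x hx
    obtain ⟨b, hb⟩ := h.generates i _ (hΨmem i x)
    refine ⟨b, hΨinj i _ _ hx (by rw [map_smul, hl]) ?_⟩
    rw [map_smul, hΨl, smul_eq_mul, hb]
  let Θ : Λ → Λ → A →ₗ[K] B := fun j i =>
    { toFun := fun u => Ψ j (φ u (l i))
      map_add' := fun u v => by rw [map_add, LinearMap.add_apply, map_add]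
      map_smul' := fun t u => by
        rw [map_smul, LinearMap.smul_apply, LinearMap.map_smul_of_tower, RingHom.id_apply] }
  have hΘ : ∀ j i u, Θ j i u = Ψ j (φ u (l i)) := fun _ _ _ => rfl
  have hcor : ∀ j i, ∀ u ∈ corner K (e j) (e i), φ (e j) (φ u (l i)) = φ u (l i) :=
    fun j i u hu => by rw [← Module.End.mul_apply, ← map_mul, hu.1]
  refine ⟨Θ, ⟨fun j i u hu => ⟨?_, hΨmem j _⟩, fun j i u hu h0 => ?_, fun j i w hwi hwj => ?_,
    fun i j k u hu v hv b hb => ?_⟩⟩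
  · refine h.mem_of_mul_eq_zero i _ fun b hb => ?_
    have h1 : b • l i = 0 := hΨinj i _ _ (by rw [map_smul, hl]) (map_zero _) (by
      rw [map_smul, hΨl, map_zero, smul_eq_mul, hb])
    rw [hΘ, ← smul_eq_mul, ← map_smul, ← map_smul, h1, map_zero, map_zero]
  · have h1 : φ u (l i) = 0 := hΨinj j _ _ (hcor j i u hu) (map_zero _) (by
      rw [map_zero, ← hΘ, h0])
    apply φ.injective
    rw [map_zero]
    apply LinearMap.ext
    intro x
    obtain ⟨b, hb⟩ := hgen i (φ (e i) x) (by rw [← Module.End.mul_apply, ← map_mul, hid])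
    rw [← hu.2, map_mul, Module.End.mul_apply, hb, map_smul, h1, smul_zero, LinearMap.zero_apply]
  · obtain ⟨d, hd⟩ := h.right_generates i w hwi
    let R : I i →ₗ[B] I j := ((LinearMap.toSpanSingleton B B d).comp (I i).subtype).codRestrict _
      fun x => by
        obtain ⟨b, hb⟩ := h.generates i x x.2
        show (x : B) * d ∈ I j
        rw [← hb, mul_assoc, hd]
        exact (I j).mul_mem_left b hwj
    let F : Module.End B L := (Submodule.subtype _).comp ((ψ j).symm.toLinearMap.comp (R.comp
      ((ψ i).toLinearMap.comp (φ (e i)).rangeRestrict)))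
    refine ⟨φ.symm F, ⟨φ.injective ?_, φ.injective ?_⟩, ?_⟩
    · rw [map_mul, AlgEquiv.apply_symm_apply]
      exact LinearMap.ext fun x => hfix j _ (Subtype.prop _)
    · rw [map_mul, AlgEquiv.apply_symm_apply]
      apply LinearMap.ext
      intro x
      have h1 : (φ (e i)).rangeRestrict (φ (e i) x) = (φ (e i)).rangeRestrict x :=
        Subtype.ext (hfix i _ ⟨x, rfl⟩)
      show F (φ (e i) x) = F x
      simp only [F, LinearMap.comp_apply, h1]
    · rw [hΘ, AlgEquiv.apply_symm_apply]
      have h1 : (φ (e i)).rangeRestrict (l i) = (ψ i).symm ⟨z i, h.mem_self le_rfl⟩ :=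
        Subtype.ext (hl i)
      have h2 : F (l i) =
          ((ψ j).symm (R ⟨z i, h.mem_self le_rfl⟩) : LinearMap.range (φ (e j))) := by
        simp only [F, LinearMap.comp_apply, h1, LinearEquiv.coe_coe, LinearEquiv.apply_symm_apply,
          Submodule.subtype_apply]
      have h3 : (φ (e j)).rangeRestrict (F (l i)) = (ψ j).symm (R ⟨z i, h.mem_self le_rfl⟩) := by
        rw [h2]
        exact Subtype.ext (hfix j _ (Subtype.prop _))
      show ((ψ j) ((φ (e j)).rangeRestrict (F (l i))) : B) = w
      rw [h3, LinearEquiv.apply_symm_apply]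
      exact hd
  · have h1 : φ u (l i) = b • l j := hΨinj j _ _ (hcor j i u hu) (by rw [map_smul, hl]) (by
      rw [map_smul, hΨl, smul_eq_mul, hb, hΘ])
    rw [hΘ, hΘ, map_mul, Module.End.mul_apply, h1, map_smul, map_smul, smul_eq_mul]

theorem IsOrderedIdealFamily.exists_isCore [IsAlgClosed K] [Fintype Λ] [Module.Finite K B]
    (h : IsOrderedIdealFamily one I) (hB : IsLocalSelfInjectiveOfCard K Λ B)
    (he : CompleteOrthogonalIdempotents e)
    (ψ : ∀ i, Nonempty (LinearMap.range (φ (e i)) ≃ₗ[B] I i)) :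
    ∃ top x y, IsCore K one top e x y := by
  obtain ⟨hone, top, z, hz⟩ := h.exists_isOrderedBasis hB
  obtain ⟨Θ, m⟩ := hz.exists_isIdealModel (fun i => (he.idem i).eq) fun i => (ψ i).some
  have := hB.1
  obtain ⟨x, y, hxy⟩ := m.exists_isCore hz he hone
  exact ⟨top, x, y, hxy⟩

end EndModel

/-! ### Direct summands and indecomposable projective modules. -/

section Summands

variable {B : Type u} [Ring B]

theorem injective_of_summand {X M : Type u} [AddCommGroup X] [Module B X] [AddCommGroup M]
    [Module B M] (h : Module.Injective B M) {s : X →ₗ[B] M} {p : M →ₗ[B] X}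
    (hps : p ∘ₗ s = LinearMap.id) : Module.Injective B X := by
  refine ⟨fun Y Z _ _ _ _ f hf g => ?_⟩
  obtain ⟨t, ht⟩ := h.out f hf (s ∘ₗ g)
  exact ⟨p ∘ₗ t, fun y => by
    rw [LinearMap.comp_apply, ht]
    exact LinearMap.congr_fun hps (g y)⟩

theorem IsIndecomposable.nonempty_equiv_of_summand {X M : Type u} [AddCommGroup X] [Module B X]
    [AddCommGroup M] [Module B M] [Nontrivial X] (h : IsIndecomposable B M) {s : X →ₗ[B] M}
    {p : M →ₗ[B] X} (hps : p ∘ₗ s = LinearMap.id) : Nonempty (M ≃ₗ[B] X) := by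
  have hps' : ∀ x, p (s x) = x := fun x => LinearMap.congr_fun hps x
  have hc : IsCompl (LinearMap.range s) (LinearMap.ker p) := by
    constructor
    · rw [Submodule.disjoint_def]
      rintro _ ⟨x, rfl⟩ hx
      rw [LinearMap.mem_ker, hps'] at hx
      rw [hx, map_zero]
    · rw [codisjoint_iff, eq_top_iff]
      rintro m -
      rw [← add_sub_cancel (s (p m)) m]
      refine Submodule.add_mem_sup ⟨_, rfl⟩ ?_
      rw [LinearMap.mem_ker, map_sub, hps', sub_self]
  rcases h.2 _ _ hc with h0 | h0
  · obtain ⟨x, hx⟩ := exists_ne (0 : X)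
    have h1 : s x ∈ LinearMap.range s := ⟨x, rfl⟩
    rw [h0, Submodule.mem_bot] at h1
    exact (hx (by rw [← hps' x, h1, map_zero])).elim
  · exact ⟨LinearEquiv.ofBijective p ⟨LinearMap.ker_eq_bot.1 h0, fun x => ⟨s x, hps' x⟩⟩⟩

theorem exists_simple_element [IsLocalRing B] [IsArtinianRing B] {X : Type u} [AddCommGroup X]
    [Module B X] [Module.Finite B X] [Nontrivial X] :
    ∃ s : X, s ≠ 0 ∧ ∀ b : B, ¬ IsUnit b → b • s = 0 := by
  obtain ⟨N, hN, -⟩ := (IsAtomic.eq_bot_or_exists_atom_le (⊤ : Submodule B X)).resolve_left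
    top_ne_bot
  obtain ⟨s, hsN, hs0⟩ := Submodule.exists_mem_ne_zero_of_ne_bot hN.1
  refine ⟨s, hs0, fun b hb => ?_⟩
  by_contra hbs
  have h1 : Submodule.span B {b • s} = N := by
    refine (hN.le_iff.1 ?_).resolve_left ?_
    · rw [Submodule.span_singleton_le_iff_mem]
      exact N.smul_mem b hsN
    · rwa [Submodule.span_singleton_eq_bot]
  rw [← h1] at hsN
  obtain ⟨d, hd⟩ := Submodule.mem_span_singleton.1 hsN
  exact hs0 (eq_zero_of_mul_mul_eq hb hd)

/-- A simple quotient of `X` is also a quotient of B, with non-units acting as zero on its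
generator. A lift X → B must therefore hit a unit, so it splits. -/
theorem nonempty_equiv_of_projective [IsLocalRing B] [IsArtinianRing B] {X : Type u}
    [AddCommGroup X] [Module B X] [Module.Finite B X] (hX : IsIndecomposable B X)
    (hp : Module.Projective B X) : Nonempty (X ≃ₗ[B] B) := by
  have := hX.1
  obtain ⟨N, hN, -⟩ := (IsCoatomic.eq_top_or_exists_le_coatom (⊥ : Submodule B X)).resolve_left
    bot_ne_top
  obtain ⟨w, hw⟩ : ∃ w, w ∉ N := by
    by_contra! hc
    exact hN.1 (Submodule.eq_top_iff'.2 hc)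
  have : Nontrivial (X ⧸ N) := Submodule.Quotient.nontrivial_iff.2 hN.1
  obtain ⟨s, hs0, hs⟩ := exists_simple_element (B := B) (X := X ⧸ N)
  have hsimple : IsSimpleModule B (X ⧸ N) := isSimpleModule_iff_isCoatom.2 hN
  have hsurj : Function.Surjective (LinearMap.toSpanSingleton B (X ⧸ N) s) := by
    rw [← LinearMap.range_eq_top]
    refine (eq_bot_or_eq_top _).resolve_left fun h0 => hs0 ?_
    have h1 : LinearMap.toSpanSingleton B (X ⧸ N) s 1 ∈
      LinearMap.range (LinearMap.toSpanSingleton B (X ⧸ N) s) := ⟨1, rfl⟩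
    rw [h0, Submodule.mem_bot, LinearMap.toSpanSingleton_apply, one_smul] at h1
    exact h1
  obtain ⟨g, hg⟩ := Module.projective_lifting_property _ N.mkQ hsurj
  have hu : IsUnit (g w) := by
    by_contra hu
    apply hw
    rw [← Submodule.Quotient.mk_eq_zero N, ← Submodule.mkQ_apply, ← hg]
    exact hs _ hu
  obtain ⟨c, hc⟩ := hu.exists_left_inv
  refine hX.nonempty_equiv_of_summand (s := LinearMap.toSpanSingleton B X (c • w)) (p := g) ?_
  apply LinearMap.ext
  intro b
  rw [LinearMap.comp_apply, LinearMap.toSpanSingleton_apply, map_smul, map_smul, smul_eq_mul,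
    smul_eq_mul, hc, mul_one]
  rfl

end Summands

/-! ### Direct sum decompositions and idempotent endomorphisms. -/

section Ranges

variable {B : Type u} [Ring B] {L : Type u} [AddCommGroup L] [Module B L] {Λ : Type v} [Fintype Λ]
  {p : Λ → Module.End B L}

theorem isInternal_range [DecidableEq Λ] (hp : CompleteOrthogonalIdempotents p) :
    DirectSum.IsInternal fun i => LinearMap.range (p i) := by
  have hfix : ∀ i, ∀ x ∈ LinearMap.range (p i), p i x = x := by
    rintro i _ ⟨x, rfl⟩
    rw [← Module.End.mul_apply, (hp.idem i).eq]
  refine DirectSum.isInternal_submodule_of_iSupIndep_of_iSup_eq_top (fun i => ?_) ?_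
  · rw [Submodule.disjoint_def]
    intro x hx hx'
    have hle : (⨆ j, ⨆ _ : j ≠ i, LinearMap.range (p j)) ≤ LinearMap.ker (p i) := by
      refine iSup_le fun j => iSup_le fun hj => ?_
      rintro _ ⟨y, rfl⟩
      rw [LinearMap.mem_ker, ← Module.End.mul_apply, hp.ortho hj.symm, LinearMap.zero_apply]
    rw [← hfix i x hx]
    exact hle hx'
  · rw [eq_top_iff]
    rintro x -
    rw [← Module.End.one_apply (R := B) x, ← hp.complete, LinearMap.sum_apply]
    exact Submodule.sum_mem _ fun i _ => Submodule.mem_iSup_of_mem i ⟨x, rfl⟩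

theorem isMultiplicityFree_of_range (hp : CompleteOrthogonalIdempotents p)
    (hind : ∀ i, IsIndecomposable B (LinearMap.range (p i)))
    (hne : ∀ i j, Nonempty (LinearMap.range (p i) ≃ₗ[B] LinearMap.range (p j)) → i = j) :
    IsMultiplicityFree B L := by
  let t := (Fintype.equivFin Λ).symm
  exact ⟨_, fun a => LinearMap.range (p (t a)), isInternal_range
    ((CompleteOrthogonalIdempotents.equiv t).2 hp),
    fun a => hind _, fun a b hab => t.injective (hne _ _ hab)⟩

theorem exists_idempotents_of_directSum {M : Λ → Type u} [∀ i, AddCommGroup (M i)]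
    [∀ i, Module B (M i)] (f : L ≃ₗ[B] DirectSum Λ M) :
    ∃ p : Λ → Module.End B L, CompleteOrthogonalIdempotents p ∧
      ∀ i, Nonempty (LinearMap.range (p i) ≃ₗ[B] M i) := by
  classical
  let s : ∀ i, M i →ₗ[B] L := fun i => f.symm.toLinearMap ∘ₗ DirectSum.lof B Λ M i
  let q : ∀ i, L →ₗ[B] M i := fun i => DirectSum.component B Λ M i ∘ₗ f.toLinearMap
  have hqs : ∀ i x, q i (s i x) = x := fun i x => by
    simp only [q, s, LinearMap.comp_apply, LinearEquiv.coe_coe, LinearEquiv.apply_symm_apply]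
    exact DirectSum.component.lof_self B i x
  have hqs' : ∀ i j x, i ≠ j → q i (s j x) = 0 := fun i j x hij => by
    simp only [q, s, LinearMap.comp_apply, LinearEquiv.coe_coe, LinearEquiv.apply_symm_apply]
    rw [DirectSum.component.of, dif_neg hij.symm]
  refine ⟨fun i => s i ∘ₗ q i, ⟨⟨fun i => ?_, fun i j hij => ?_⟩, ?_⟩, fun i => ?_⟩
  · exact LinearMap.ext fun x => congrArg (s i) (hqs i (q i x))
  · apply LinearMap.ext
    intro x
    show s i (q i (s j (q j x))) = 0
    rw [hqs' i j _ hij, map_zero]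
  · apply LinearMap.ext
    intro x
    apply f.injective
    rw [LinearMap.sum_apply, map_sum, Module.End.one_apply]
    simp only [q, s, LinearMap.comp_apply, LinearEquiv.coe_coe, LinearEquiv.apply_symm_apply]
    exact DirectSum.sum_univ_of (f x)
  · refine ⟨LinearEquiv.ofBijective ((q i).comp (Submodule.subtype _)) ⟨?_, fun x => ?_⟩⟩
    · rw [← LinearMap.ker_eq_bot, eq_bot_iff]
      rintro ⟨_, x, rfl⟩ hx
      have h1 : q i (s i (q i x)) = 0 := hx
      rw [hqs] at h1
      exact Subtype.ext (show s i (q i x) = 0 by rw [h1, map_zero])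
    · exact ⟨⟨s i x, s i x, congrArg (s i) (hqs i x)⟩, hqs i x⟩

theorem nonempty_directSum_equiv {M : Λ → Type u} [∀ i, AddCommGroup (M i)]
    [∀ i, Module B (M i)] (hp : CompleteOrthogonalIdempotents p)
    (ψ : ∀ i, Nonempty (LinearMap.range (p i) ≃ₗ[B] M i)) :
    Nonempty (L ≃ₗ[B] DirectSum Λ M) := by
  classical
  have h1 := LinearEquiv.ofBijective (DirectSum.coeLinearMap fun i => LinearMap.range (p i))
    (isInternal_range hp)
  exact ⟨h1.symm.trans (DFinsupp.mapRange.linearEquiv fun i => (ψ i).some)⟩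

end Ranges

/-! ### Primitive idempotents of A and indecomposable summands of L. -/

section Labels

variable {K : Type u} [Field K] {A : Type u} [Ring A] [Algebra K A]
  {B : Type u} [Ring B] [Algebra K B] {L : Type u} [AddCommGroup L] [Module K L] [Module B L]
  [IsScalarTower K B L] {φ : A ≃ₐ[K] Module.End B L}

theorem isPrimitiveIdem_of_range {f : A} (hf : f * f = f)
    (h : IsIndecomposable B (LinearMap.range (φ f))) : IsPrimitiveIdem f := by
  refine ⟨?_, fun g hg hfg hgf => ?_⟩
  · rintro rfl
    obtain ⟨x, y, hxy⟩ := h.1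
    apply hxy
    obtain ⟨⟨_, x, rfl⟩, ⟨_, y, rfl⟩⟩ := x, y
    exact Subtype.ext (by simp)
  let N := (LinearMap.range (φ g)).comap (LinearMap.range (φ f)).subtype
  let N' := (LinearMap.ker (φ g)).comap (LinearMap.range (φ f)).subtype
  have hmul : ∀ a b x, φ a (φ b x) = φ (a * b) x := fun a b x => by
    rw [map_mul, Module.End.mul_apply]
  have hc : IsCompl N N' := by
    constructor
    · rw [Submodule.disjoint_def]
      rintro ⟨x, hx⟩ ⟨y, rfl⟩ hy
      have h1 : φ g (φ g y) = 0 := hy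
      rw [hmul, hg] at h1
      exact Subtype.ext h1
    · rw [codisjoint_iff, eq_top_iff]
      rintro ⟨_, x, rfl⟩ -
      have h1 : (⟨φ f x, x, rfl⟩ : LinearMap.range (φ f)) = ⟨φ g x, φ g x, by rw [hmul, hfg]⟩ +
          ⟨φ (f - g) x, φ (f - g) x, by rw [hmul, mul_sub, hf, hfg]⟩ := by
        refine Subtype.ext ?_
        show φ f x = φ g x + φ (f - g) x
        rw [map_sub, LinearMap.sub_apply, add_sub_cancel]
      rw [h1]
      refine Submodule.add_mem_sup ⟨x, rfl⟩ ?_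
      show φ g (φ (f - g) x) = 0
      rw [hmul, mul_sub, hg, hgf, sub_self, map_zero, LinearMap.zero_apply]
  rcases h.2 _ _ hc with h0 | h0
  · left
    apply φ.injective
    apply LinearMap.ext
    intro x
    have h1 : (⟨φ g x, φ g x, by rw [hmul, hfg]⟩ : LinearMap.range (φ f)) ∈ N := ⟨x, rfl⟩
    rw [h0, Submodule.mem_bot] at h1
    rw [map_zero]
    exact congrArg Subtype.val h1
  · right
    symm
    rw [← sub_eq_zero]
    apply φ.injective
    apply LinearMap.ext
    intro x
    have h1 : (⟨φ (f - g) x, φ (f - g) x, by rw [hmul, mul_sub, hf, hfg]⟩ :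
        LinearMap.range (φ f)) ∈ N' := by
      show φ g (φ (f - g) x) = 0
      rw [hmul, mul_sub, hg, hgf, sub_self, map_zero, LinearMap.zero_apply]
    rw [h0, Submodule.mem_bot] at h1
    rw [map_zero]
    exact congrArg Subtype.val h1

theorem nonempty_range_equiv {f g : A} (hf : f * f = f) (hg : g * g = g)
    (h : Nonempty (Ideal.span {f} ≃ₗ[A] Ideal.span {g})) :
    Nonempty (LinearMap.range (φ f) ≃ₗ[B] LinearMap.range (φ g)) := by
  obtain ⟨a, b, hfa, -, hgb, -, hab, hba⟩ := (nonempty_span_equiv_iff hf hg).1 h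
  have hmul : ∀ a b x, φ a (φ b x) = φ (a * b) x := fun a b x => by
    rw [map_mul, Module.End.mul_apply]
  refine ⟨LinearEquiv.ofLinearMap
    (((φ b).comp (Submodule.subtype _)).codRestrict _ fun x => ⟨φ b x, by
      rw [LinearMap.comp_apply, hmul, hgb]; rfl⟩)
    (((φ a).comp (Submodule.subtype _)).codRestrict _ fun x => ⟨φ a x, by
      rw [LinearMap.comp_apply, hmul, hfa]; rfl⟩) ?_ ?_⟩
  · apply LinearMap.ext
    rintro ⟨_, x, rfl⟩
    refine Subtype.ext ?_
    show φ b (φ a (φ g x)) = φ g x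
    rw [hmul, hmul, hba, hg]
  · apply LinearMap.ext
    rintro ⟨_, x, rfl⟩
    refine Subtype.ext ?_
    show φ a (φ b (φ f x)) = φ f x
    rw [hmul, hmul, hab, hf]

variable {Λ : Type v} [Fintype Λ] {e : Λ → A}

theorem isVertexLabelling_of_range (he : CompleteOrthogonalIdempotents e)
    (hind : ∀ i, IsIndecomposable B (LinearMap.range (φ (e i))))
    (hne : ∀ i j, Nonempty (LinearMap.range (φ (e i)) ≃ₗ[B] LinearMap.range (φ (e j))) → i = j) :
    IsVertexLabelling e :=
  ⟨he, fun i => (isIndecomposable_span_iff (he.idem i).eq).2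
    (isPrimitiveIdem_of_range (he.idem i).eq (hind i)),
    fun i j hij => hne i j (nonempty_range_equiv (he.idem i).eq (he.idem j).eq hij)⟩

/-- The endomorphism f s q f is a nonzero idempotent under the primitive idempotent `f`, so it
equals `f`. -/
theorem nonempty_range_equiv_of_summand {f : A} (hp : IsPrimitiveIdem f) (hf : f * f = f)
    {N : Type u} [AddCommGroup N] [Module B N] [Nontrivial N] {s : N →ₗ[B] L} {q : L →ₗ[B] N}
    (hqs : q ∘ₗ φ f ∘ₗ s = LinearMap.id) : Nonempty (N ≃ₗ[B] LinearMap.range (φ f)) := by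
  have hqs' : ∀ x, q (φ f (s x)) = x := fun x => LinearMap.congr_fun hqs x
  have hff : ∀ x, φ f (φ f x) = φ f x := fun x => by rw [← Module.End.mul_apply, ← map_mul, hf]
  let T : Module.End B L := φ f ∘ₗ s ∘ₗ q ∘ₗ φ f
  have hT : φ.symm T = f := by
    refine (hp.2 (φ.symm T) ?_ ?_ ?_).resolve_left ?_
    · apply φ.injective
      rw [map_mul, AlgEquiv.apply_symm_apply]
      apply LinearMap.ext
      intro x
      show φ f (s (q (φ f (φ f (s (q (φ f x))))))) = φ f (s (q (φ f x)))
      rw [hff, hqs']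
    · apply φ.injective
      rw [map_mul, AlgEquiv.apply_symm_apply]
      exact LinearMap.ext fun x => hff _
    · apply φ.injective
      rw [map_mul, AlgEquiv.apply_symm_apply]
      exact LinearMap.ext fun x => congrArg (fun y => φ f (s (q y))) (hff x)
    · intro h0
      obtain ⟨x, hx⟩ := exists_ne (0 : N)
      apply hx
      have h1 : T = 0 := by rw [← φ.apply_symm_apply T, h0, map_zero]
      have h2 : φ f (s (q (φ f (s x)))) = 0 := by
        have := LinearMap.congr_fun h1 (s x)
        exact this
      rw [hqs'] at h2
      rw [← hqs' x, h2, map_zero]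
  have hT' : ∀ x, φ f (s (q (φ f x))) = φ f x := fun x => by
    conv_rhs => rw [← hT, AlgEquiv.apply_symm_apply]
    rfl
  refine ⟨LinearEquiv.ofLinearMap ((φ f).rangeRestrict ∘ₗ s) (q ∘ₗ Submodule.subtype _) ?_ ?_⟩
  · apply LinearMap.ext
    rintro ⟨_, x, rfl⟩
    exact Subtype.ext (hT' x)
  · exact LinearMap.ext hqs'

/-- The Krull–Schmidt exchange argument: the identity of `N` is the sum of the maps q e_i s in a
local ring, so one of them is invertible. -/
theorem IsVertexLabelling.exists_nonempty_range_equiv (he : IsVertexLabelling e) {N : Type u}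
    [AddCommGroup N] [Module B N] [IsNoetherian B N] [IsArtinian B N] (hN : IsIndecomposable B N)
    (hL : IsDirectSummand B N L) : ∃ i, Nonempty (N ≃ₗ[B] LinearMap.range (φ (e i))) := by
  obtain ⟨s, q, hqs⟩ := hL
  have := hN.1
  have := hN.isLocalRing_end
  have hsum : ∑ i, (q ∘ₗ φ (e i) ∘ₗ s : Module.End B N) = 1 := by
    apply LinearMap.ext
    intro x
    rw [LinearMap.sum_apply]
    have h1 : ∑ i, φ (e i) (s x) = s x := by
      rw [← LinearMap.sum_apply, ← map_sum, he.1.complete, map_one, Module.End.one_apply]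
    have h2 : ∑ i, q (φ (e i) (s x)) = q (s x) := by rw [← map_sum, h1]
    exact h2.trans (LinearMap.congr_fun hqs x)
  obtain ⟨i, -, hi⟩ := IsLocalRing.exists_of_isUnit_sum (s := Finset.univ)
    (f := fun i => (q ∘ₗ φ (e i) ∘ₗ s : Module.End B N)) (by rw [hsum]; exact isUnit_one)
  obtain ⟨w, hw⟩ := hi.exists_left_inv
  exact ⟨i, nonempty_range_equiv_of_summand (he.isPrimitiveIdem i) (he.1.idem i).eq
    (s := s) (q := w ∘ₗ q) hw⟩

end Labels

/-! ### Indecomposable projectives and injectives over a local self-injective algebra. -/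

section GeneratorCogenerator

variable {B : Type u} [Ring B]

theorem IsDirectSummand.of_equiv {X Y M : Type u} [AddCommGroup X] [Module B X] [AddCommGroup Y]
    [Module B Y] [AddCommGroup M] [Module B M] (f : X ≃ₗ[B] Y) (h : IsDirectSummand B Y M) :
    IsDirectSummand B X M := by
  obtain ⟨s, p, hps⟩ := h
  refine ⟨s ∘ₗ f.toLinearMap, f.symm.toLinearMap ∘ₗ p, LinearMap.ext fun x => ?_⟩
  show f.symm (p (s (f x))) = x
  rw [show p (s (f x)) = f x from LinearMap.congr_fun hps (f x), LinearEquiv.symm_apply_apply]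

theorem isDirectSummand_range {M : Type u} [AddCommGroup M] [Module B M] {p : Module.End B M}
    (hp : p * p = p) : IsDirectSummand B (LinearMap.range p) M := by
  refine ⟨Submodule.subtype _, p.rangeRestrict, LinearMap.ext ?_⟩
  rintro ⟨_, x, rfl⟩
  exact Subtype.ext (LinearMap.congr_fun hp x)

/-- A map B → X sending the socle generator `z` to a nonzero element killed by all non-units is
injective, and it splits since B is injective. -/
theorem nonempty_equiv_of_injective [IsLocalRing B] [IsArtinianRing B] (hB : Module.Injective B B)
    {z : B} (hz : z ≠ 0) (hsoc : ∀ w, w ≠ 0 → ∃ b, b * w = z) {X : Type u} [AddCommGroup X]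
    [Module B X] [Module.Finite B X] (hX : IsIndecomposable B X) (hi : Module.Injective B X) :
    Nonempty (X ≃ₗ[B] B) := by
  have := hX.1
  obtain ⟨s, hs0, hs⟩ := exists_simple_element (B := B) (X := X)
  obtain ⟨g, hg⟩ := exists_hom_of_injective hi z s fun b hb =>
    hs b fun hu => hz (hu.mul_right_eq_zero.1 hb)
  have hinj : Function.Injective g := by
    rw [← LinearMap.ker_eq_bot, eq_bot_iff]
    intro w hw
    rw [Submodule.mem_bot]
    by_contra hw0
    obtain ⟨b, rfl⟩ := hsoc w hw0
    apply hs0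
    rw [← hg, ← smul_eq_mul, map_smul, LinearMap.mem_ker.1 hw, smul_zero]
  obtain ⟨r, hr⟩ := hB.out g hinj LinearMap.id
  exact hX.nonempty_equiv_of_summand (s := g) (p := r) (LinearMap.ext hr)

theorem isGeneratorCogenerator_of_isLocalRing [IsLocalRing B] [IsArtinianRing B]
    (hB : Module.Injective B B) {z : B} (hz : z ≠ 0) (hsoc : ∀ w, w ≠ 0 → ∃ b, b * w = z)
    {L : Type u} [AddCommGroup L] [Module B L] (hL : IsDirectSummand B B L) :
    IsGeneratorCogenerator B L := by
  intro X _ _ _ hX hpi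
  obtain ⟨f⟩ : Nonempty (X ≃ₗ[B] B) := hpi.elim (nonempty_equiv_of_projective hX)
    (nonempty_equiv_of_injective hB hz hsoc hX)
  exact hL.of_equiv f

theorem isBasic_of_isLocalRing [IsLocalRing B] [IsArtinianRing B] : IsBasic B := by
  have h1 : LinearMap.range (1 : Module.End B B) = ⊤ := LinearMap.range_id
  have h2 := (isLocalModule_self (B := B)).isIndecomposable
  refine isMultiplicityFree_of_range (p := fun _ : Unit => (1 : Module.End B B))
    ⟨⟨fun _ => mul_one _, fun i j hij => (hij rfl).elim⟩, by simp⟩ (fun _ => ?_)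
    fun _ _ _ => rfl
  exact (isLocalModule_self.congr (Submodule.topEquiv.symm.trans
    (LinearEquiv.ofEq _ _ h1.symm))).isIndecomposable

theorem IsOrderedIdealFamily.eq_of_equiv {Λ : Type v} [PartialOrder Λ] {one : Λ}
    {I : Λ → Ideal B} (h : IsOrderedIdealFamily one I) {i j : Λ}
    (f : I i ≃ₗ[B] I j) : i = j :=
  le_antisymm ((h.surj_iff i j).1 ⟨f.toLinearMap, f.surjective⟩)
    ((h.surj_iff j i).1 ⟨f.symm.toLinearMap, f.symm.surjective⟩)

end GeneratorCogenerator

/-! ### The element of f L that corresponds to 1. -/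

section Generator

variable {K : Type u} [Field K] {A : Type u} [Ring A] [Algebra K A]
  {B : Type u} [Ring B] [Algebra K B] {L : Type u} [AddCommGroup L]
  [Module K L] [Module B L] [IsScalarTower K B L] {φ : A ≃ₐ[K] Module.End B L}

theorem exists_isPairGenerator {f : A} (hf : f * f = f)
    (h : Nonempty (LinearMap.range (φ f) ≃ₗ[B] B)) :
    ∃ x₀, IsPairGenerator (φ : A →ₐ[K] Module.End B L) f x₀ := by
  obtain ⟨τ⟩ := h
  have hfix : ∀ l ∈ LinearMap.range (φ f), φ f l = l := fun l hl =>
    (mem_range_iff_of_idem (ρ := (φ : A →ₐ[K] Module.End B L)) hf).1 hl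
  have hgen : ∀ l, φ f l = l → ∃ b : B, b • (τ.symm 1 : L) = l := fun l hl => by
    refine ⟨τ ⟨l, l, hl⟩, ?_⟩
    rw [← Submodule.coe_smul, ← map_smul, smul_eq_mul, mul_one, LinearEquiv.symm_apply_apply]
  refine ⟨τ.symm 1, hf, hfix _ (Subtype.prop _), fun l => ?_, fun a ha => ?_, hgen, fun b hb => ?_⟩
  · refine ⟨φ.symm (LinearMap.toSpanSingleton B L l ∘ₗ τ.toLinearMap ∘ₗ (φ f).rangeRestrict), ?_⟩
    have h1 : (φ f).rangeRestrict (τ.symm 1 : L) = τ.symm 1 := Subtype.ext (hfix _ (Subtype.prop _))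
    show φ (φ.symm _) _ = l
    rw [AlgEquiv.apply_symm_apply, LinearMap.comp_apply, LinearMap.comp_apply, h1,
      LinearEquiv.coe_coe, LinearEquiv.apply_symm_apply, LinearMap.toSpanSingleton_apply, one_smul]
  · apply φ.injective
    apply LinearMap.ext
    intro l
    obtain ⟨b, hb⟩ := hgen (φ f l) (hfix _ ⟨l, rfl⟩)
    have ha' : φ a (τ.symm 1 : L) = 0 := ha
    rw [map_mul, Module.End.mul_apply, ← hb, map_smul, ha', smul_zero, map_zero,
      LinearMap.zero_apply]
  · rw [← Submodule.coe_smul, ← map_smul, smul_eq_mul, mul_one] at hb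
    exact τ.symm.map_eq_zero_iff.1 (Subtype.ext hb)

variable {Λ : Type v} [PartialOrder Λ] {one : Λ} {e : Λ → A} {I : Λ → Ideal B}

theorem IsOrderedIdealFamily.nonempty_equiv_self (h : IsOrderedIdealFamily one I)
    (ψ : Nonempty (LinearMap.range (φ (e one)) ≃ₗ[B] I one)) :
    Nonempty (LinearMap.range (φ (e one)) ≃ₗ[B] B) :=
  ⟨ψ.some.trans ((LinearEquiv.ofEq _ _ h.eq_top).trans Submodule.topEquiv)⟩

end Generator

/-! ### Consequences of the conditions on the ideals for L. -/

section OrderCondition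

variable {K : Type u} [Field K] {A : Type u} [Ring A] [Algebra K A]
  {B : Type u} [Ring B] [Algebra K B] [Module.Finite K B] {L : Type u} [AddCommGroup L]
  [Module K L] [Module B L] [IsScalarTower K B L] {Λ : Type v} [Fintype Λ] [PartialOrder Λ]
  {one : Λ} {e : Λ → A} {I : Λ → Ideal B} {φ : A ≃ₐ[K] Module.End B L}

theorem IsOrderedIdealFamily.isMultiplicityFree (h : IsOrderedIdealFamily one I)
    (he : CompleteOrthogonalIdempotents e)
    (ψ : ∀ i, Nonempty (LinearMap.range (φ (e i)) ≃ₗ[B] I i)) : IsMultiplicityFree B L := by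
  have : IsArtinianRing B := IsArtinianRing.of_finite K B
  refine isMultiplicityFree_of_range (he.map (φ : A →+* Module.End B L)) (fun i => ?_) ?_
  · have := Module.Finite.equiv (ψ i).some.symm
    exact ((h.isLocal i).congr (ψ i).some.symm).isIndecomposable
  · rintro i j ⟨f⟩
    exact h.eq_of_equiv (((ψ i).some.symm.trans f).trans (ψ j).some)

theorem IsOrderedIdealFamily.isVertexLabelling (h : IsOrderedIdealFamily one I)
    (he : CompleteOrthogonalIdempotents e)
    (ψ : ∀ i, Nonempty (LinearMap.range (φ (e i)) ≃ₗ[B] I i)) : IsVertexLabelling e := by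
  have : IsArtinianRing B := IsArtinianRing.of_finite K B
  refine isVertexLabelling_of_range (φ := φ) he (fun i => ?_) ?_
  · have := Module.Finite.equiv (ψ i).some.symm
    exact ((h.isLocal i).congr (ψ i).some.symm).isIndecomposable
  · rintro i j ⟨f⟩
    exact h.eq_of_equiv (((ψ i).some.symm.trans f).trans (ψ j).some)

theorem IsOrderedIdealFamily.isGeneratorCogenerator [IsAlgClosed K] (h : IsOrderedIdealFamily one I)
    (hB : IsLocalSelfInjectiveOfCard K Λ B) (he : CompleteOrthogonalIdempotents e)
    (ψ : ∀ i, Nonempty (LinearMap.range (φ (e i)) ≃ₗ[B] I i)) : IsGeneratorCogenerator B L := by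
  have : IsArtinianRing B := IsArtinianRing.of_finite K B
  have := hB.1
  obtain ⟨hone, top, z, hz⟩ := h.exists_isOrderedBasis hB
  refine isGeneratorCogenerator_of_isLocalRing hB.2.1 (z.ne_zero top) hz.exists_mul_left ?_
  obtain ⟨f⟩ := h.nonempty_equiv_self (ψ one)
  exact (isDirectSummand_range (by rw [← map_mul, (he.idem one).eq])).of_equiv f.symm

end OrderCondition

/-! ### Maps into a generator-cogenerator. -/

section Cogenerator

variable {K : Type u} [Field K] {B : Type u} [Ring B] [Algebra K B]

/-- A homomorphism to the dual of B amounts to a linear form, its value at 1, and linear forms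
extend. -/
theorem injective_stdDual : Module.Injective B (StdDual K B B) := by
  refine Module.Baer.injective fun I g => ?_
  let η : I.restrictScalars K →ₗ[K] K :=
    { toFun := fun x => (g x).form 1
      map_add' := fun x y => congrArg (fun ξ : StdDual K B B => ξ.form 1) (map_add g x y)
      map_smul' := fun t x => by
        have h1 : g (t • (x : I)) = t • g x := LinearMap.map_smul_of_tower g t (x : I)
        exact congrArg (fun ξ : StdDual K B B => ξ.form 1) h1 }
  obtain ⟨ν, hν⟩ := LinearMap.exists_extend η
  refine ⟨LinearMap.toSpanSingleton B (StdDual K B B) (StdDual.of ν), fun x hx => ?_⟩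
  apply LinearMap.ext
  intro b
  have h1 : ν (b * x) = (g ⟨b * x, I.mul_mem_left b hx⟩).form 1 :=
    LinearMap.congr_fun hν ⟨b * x, I.mul_mem_left b hx⟩
  have h2 : g ⟨b * x, I.mul_mem_left b hx⟩ = b • g ⟨x, hx⟩ := map_smul g b ⟨x, hx⟩
  show ν (b * x) = (g ⟨x, hx⟩).form b
  rw [h1, h2, StdDual.smul_form, MulOpposite.smul_eq_mul_unop, MulOpposite.unop_op, one_mul]

theorem exists_hom_stdDual_ne_zero {C : Type u} [AddCommGroup C] [Module K C] [Module B C]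
    [IsScalarTower K B C] [Nontrivial C] : ∃ g : C →ₗ[B] StdDual K B B, g ≠ 0 := by
  obtain ⟨c, hc⟩ := exists_ne (0 : C)
  obtain ⟨ν, hν⟩ : ∃ ν : Module.Dual K C, ν c ≠ 0 := by
    by_contra! h0
    exact hc ((Module.forall_dual_apply_eq_zero_iff K c).1 h0)
  let g : C →ₗ[B] StdDual K B B :=
    { toFun := fun x => StdDual.of (ν ∘ₗ (LinearMap.toSpanSingleton B C x).restrictScalars K)
      map_add' := fun x y => LinearMap.ext fun b =>
        (congrArg ν (smul_add b x y)).trans (map_add ν _ _)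
      map_smul' := fun b x => LinearMap.ext fun b' => congrArg ν (mul_smul b' b x).symm }
  refine ⟨g, fun h0 => hν ?_⟩
  have h1 : (g c).form 1 = 0 := by rw [h0]; rfl
  have h2 : ν ((1 : B) • c) = 0 := h1
  rwa [one_smul] at h2

/-- The dual of B is injective and receives a nonzero map from `C`. A minimal injective submodule of
it with this property is indecomposable, hence a summand of `L`. -/
theorem IsGeneratorCogenerator.exists_ne_zero [Module.Finite K B] {L : Type u}
    [AddCommGroup L] [Module B L]
    (h : IsGeneratorCogenerator B L) {C : Type u} [AddCommGroup C] [Module K C] [Module B C]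
    [IsScalarTower K B C] [Nontrivial C] : ∃ g : C →ₗ[B] L, g ≠ 0 := by
  have : Module.Finite B (StdDual K B B) := Module.Finite.of_restrictScalars_finite K B _
  have : IsArtinianRing B := IsArtinianRing.of_finite K B
  obtain ⟨X, ⟨hX, f, hf⟩, hmin⟩ := exists_minimal_of_wellFoundedLT
    (fun X : Submodule B (StdDual K B B) => Module.Injective B X ∧ ∃ f : C →ₗ[B] X, f ≠ 0)
    ⟨⊤, injective_of_summand (injective_stdDual (K := K) (B := B))
        (s := Submodule.topEquiv.toLinearMap) (p := Submodule.topEquiv.symm.toLinearMap)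
        (LinearMap.ext fun _ => rfl), by
      obtain ⟨g, hg⟩ := exists_hom_stdDual_ne_zero (K := K) (B := B) (C := C)
      exact ⟨Submodule.topEquiv.symm.toLinearMap ∘ₗ g, fun h0 => hg (LinearMap.ext fun c =>
        congrArg Subtype.val (LinearMap.congr_fun h0 c))⟩⟩
  -- A summand in which the map from `C` has a nonzero component satisfies the conditions again, so
  -- by minimality it is all of `X`.
  have key : ∀ N N' : Submodule B X, IsCompl N N' → ∀ q : X →ₗ[B] N,
      q ∘ₗ N.subtype = LinearMap.id → q ∘ₗ f ≠ 0 → N' = ⊥ := by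
    intro N N' hc q hq hqf
    have hN : Module.Injective B N := injective_of_summand hX hq
    let t := Submodule.equivMapOfInjective X.subtype X.injective_subtype N
    have hle := hmin (y := N.map X.subtype) ⟨injective_of_summand hN (s := t.symm.toLinearMap)
      (p := t.toLinearMap) (LinearMap.ext t.apply_symm_apply), t.toLinearMap ∘ₗ q ∘ₗ f,
      fun h0 => hqf (LinearMap.ext fun c => t.injective (by
        rw [LinearMap.zero_apply, map_zero]
        exact LinearMap.congr_fun h0 c))⟩ (Submodule.map_subtype_le _ _)
    have htop : N = ⊤ := by
      rw [eq_top_iff]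
      rintro ⟨x, hx⟩ -
      obtain ⟨y, hy, hyx⟩ := hle hx
      rwa [show (⟨x, hx⟩ : X) = y from Subtype.ext hyx.symm]
    rw [htop] at hc
    exact disjoint_top.1 hc.disjoint.symm
  have hnt : Nontrivial X := by
    obtain ⟨c, hc⟩ : ∃ c, f c ≠ 0 := by
      by_contra! h0
      exact hf (LinearMap.ext h0)
    exact ⟨⟨_, _, hc⟩⟩
  have hind : IsIndecomposable B X := by
    refine ⟨hnt, fun N N' hc => ?_⟩
    by_cases h1 : N.projectionOnto N' hc ∘ₗ f = 0
    · left
      refine key N' N hc.symm (N'.projectionOnto N hc.symm) (LinearMap.ext fun x =>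
        Submodule.projectionOnto_apply_left hc.symm x) fun h2 => hf (LinearMap.ext fun c => ?_)
      have h3 : f c ∈ N' := (Submodule.projectionOnto_apply_eq_zero_iff hc).1
        (LinearMap.congr_fun h1 c)
      have h4 : f c ∈ N := (Submodule.projectionOnto_apply_eq_zero_iff hc.symm).1
        (LinearMap.congr_fun h2 c)
      exact (Submodule.disjoint_def.1 hc.disjoint) _ h4 h3
    · right
      exact key N N' hc (N.projectionOnto N' hc) (LinearMap.ext fun x =>
        Submodule.projectionOnto_apply_left hc x) h1
  obtain ⟨s, p, hps⟩ := h X inferInstance hind (Or.inr hX)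
  refine ⟨s ∘ₗ f, fun h0 => hf (LinearMap.ext fun c => ?_)⟩
  have h1 : s (f c) = 0 := LinearMap.congr_fun h0 c
  have h2 : p (s (f c)) = f c := LinearMap.congr_fun hps (f c)
  rw [← h2, h1, map_zero, LinearMap.zero_apply]

end Cogenerator

section Summand

variable {B : Type u} [Ring B] {M : Type u} [AddCommGroup M] [Module B M]

theorem projective_of_isInternal {k : ℕ} {N : Fin k → Submodule B M} (hN : DirectSum.IsInternal N)
    (hM : Module.Projective B M) (a : Fin k) : Module.Projective B (N a) := by
  let E := LinearEquiv.ofBijective (DirectSum.coeLinearMap N) hN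
  refine Module.Projective.of_split (N a).subtype
    (DirectSum.component B (Fin k) (fun a => N a) a ∘ₗ E.symm.toLinearMap) ?_
  apply LinearMap.ext
  intro x
  have h1 : E (DirectSum.lof B (Fin k) (fun a => N a) a x) = x := DirectSum.coeLinearMap_lof N a x
  show DirectSum.component B (Fin k) (fun a => N a) a (E.symm x) = x
  rw [← h1, LinearEquiv.symm_apply_apply, DirectSum.component.lof_self]

end Summand

/-! ### The summand e_1 L is isomorphic to B. -/

section Generator

variable {K : Type u} [Field K] {A : Type u} [Ring A] [Algebra K A]
  {B : Type u} [Ring B] [Algebra K B] [Module.Finite K B] {L : Type u} [AddCommGroup L]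
  [Module K L] [Module B L] [IsScalarTower K B L] {φ : A ≃ₐ[K] Module.End B L}

/-- Otherwise the cokernel of `a` in f L has a nonzero map to `L`, which yields a nonzero `u` with u
f = u and u a = 0. -/
theorem IsGeneratorCogenerator.range_le (hL : IsGeneratorCogenerator B L) {f a : A} (hf : f * f = f)
    (hfa : f * a = a) (h : ∀ u, u * f = u → u * a = 0 → u = 0) :
    LinearMap.range (φ f) ≤ LinearMap.range (φ a) := by
  let D := (LinearMap.range (φ a)).comap (LinearMap.range (φ f)).subtype
  by_contra hle
  have hnt : Nontrivial (LinearMap.range (φ f) ⧸ D) := by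
    rw [Submodule.Quotient.nontrivial_iff]
    intro h0
    apply hle
    intro x hx
    have h1 : (⟨x, hx⟩ : LinearMap.range (φ f)) ∈ D := by rw [h0]; trivial
    exact h1
  obtain ⟨g, hg⟩ := hL.exists_ne_zero (K := K) (C := LinearMap.range (φ f) ⧸ D)
  let U : Module.End B L := g ∘ₗ D.mkQ ∘ₗ (φ f).rangeRestrict
  have hU : φ.symm U = 0 := by
    refine h _ (φ.injective ?_) (φ.injective ?_)
    · rw [map_mul, AlgEquiv.apply_symm_apply]
      apply LinearMap.ext
      intro x
      have h1 : (φ f).rangeRestrict (φ f x) = (φ f).rangeRestrict x :=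
        Subtype.ext (show φ f (φ f x) = φ f x by rw [← Module.End.mul_apply, ← map_mul, hf])
      show g (D.mkQ ((φ f).rangeRestrict (φ f x))) = g (D.mkQ ((φ f).rangeRestrict x))
      rw [h1]
    · rw [map_mul, AlgEquiv.apply_symm_apply, map_zero]
      apply LinearMap.ext
      intro x
      have h1 : (φ f).rangeRestrict (φ a x) ∈ D := ⟨x, by
        rw [← hfa, map_mul]
        show φ f (φ a x) = φ f (φ f (φ a x))
        simp only [← Module.End.mul_apply, ← map_mul, hfa]⟩
      show g (D.mkQ ((φ f).rangeRestrict (φ a x))) = 0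
      rw [Submodule.mkQ_apply, (Submodule.Quotient.mk_eq_zero D).2 h1, map_zero]
  have hU' : U = 0 := by rw [← φ.apply_symm_apply U, hU, map_zero]
  apply hg
  apply LinearMap.ext
  intro c
  obtain ⟨⟨_, x, rfl⟩, rfl⟩ := D.mkQ_surjective c
  exact LinearMap.congr_fun hU' x

variable {Λ : Type v} [Fintype Λ] [PartialOrder Λ] {one top : Λ} {e x y : Λ → A}

/-- The action of a_i maps e_1 L onto e_i L by `range_le`. If e_i L is projective this splits, and
primitivity of e_1 makes the splitting an isomorphism. -/
theorem IsCore.eq_one_of_projective (hc : IsCore K one top e x y) (he : IsVertexLabelling e)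
    (hL : IsGeneratorCogenerator B L) {i : Λ}
    (hi : Module.Projective B (LinearMap.range (φ (e i)))) : i = one := by
  obtain ⟨a, ha, hya⟩ := hc.exists_a i
  have hid := fun i => (he.1.idem i).eq
  have hmul : ∀ a b x, φ a (φ b x) = φ (a * b) x := fun a b x => by
    rw [map_mul, Module.End.mul_apply]
  have hya0 : y i * a ≠ 0 := fun h0 => hc.mul_ne_zero (by rw [← hya, h0, mul_zero])
  have hle := hL.range_le (φ := φ) (hid i) ha.1 fun u hu hua => hc.eq_zero_of_mul_a hya0 ha hu hua
  let T : LinearMap.range (φ (e one)) →ₗ[B] LinearMap.range (φ (e i)) :=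
    (φ a ∘ₗ Submodule.subtype _).codRestrict _ fun l => ⟨φ a l, by
      rw [LinearMap.comp_apply, hmul, ha.1]; rfl⟩
  have hT : Function.Surjective T := by
    rintro ⟨l, hl⟩
    obtain ⟨w, rfl⟩ := hle hl
    refine ⟨⟨φ (e one) w, w, rfl⟩, Subtype.ext ?_⟩
    show φ a (φ (e one) w) = φ a w
    rw [hmul, ha.2]
  obtain ⟨h, hh⟩ := Module.projective_lifting_property T LinearMap.id hT
  let S : Module.End B L := Submodule.subtype _ ∘ₗ h ∘ₗ (φ (e i)).rangeRestrict
  have h1 : e one * φ.symm S = φ.symm S := by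
    apply φ.injective
    rw [map_mul, AlgEquiv.apply_symm_apply]
    apply LinearMap.ext
    intro l
    obtain ⟨w, hw⟩ := (h ((φ (e i)).rangeRestrict l)).2
    show φ (e one) (h ((φ (e i)).rangeRestrict l) : L) = (h ((φ (e i)).rangeRestrict l) : L)
    rw [← hw, hmul, hid]
  have h2 : φ.symm S * e i = φ.symm S := by
    apply φ.injective
    rw [map_mul, AlgEquiv.apply_symm_apply]
    apply LinearMap.ext
    intro l
    have h3 : (φ (e i)).rangeRestrict (φ (e i) l) = (φ (e i)).rangeRestrict l :=
      Subtype.ext (show φ (e i) (φ (e i) l) = φ (e i) l by rw [hmul, hid])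
    show (h ((φ (e i)).rangeRestrict (φ (e i) l)) : L) = h ((φ (e i)).rangeRestrict l)
    rw [h3]
  have h3 : a * φ.symm S = e i := by
    apply φ.injective
    rw [map_mul, AlgEquiv.apply_symm_apply]
    apply LinearMap.ext
    intro l
    exact congrArg Subtype.val (LinearMap.congr_fun hh ((φ (e i)).rangeRestrict l))
  have h4 : φ.symm S * a = e one := by
    refine ((he.isPrimitiveIdem one).2 _ ?_ ?_ ?_).resolve_left fun h0 => ?_
    · rw [mul_assoc, ← mul_assoc a, h3, ha.1]
    · rw [← mul_assoc, h1]
    · rw [mul_assoc, ha.2]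
    · apply (he.isPrimitiveIdem i).1
      rw [← hid i, ← h3, mul_assoc, ← mul_assoc _ a, h0, zero_mul, mul_zero]
  exact he.2.2 i one ((nonempty_span_equiv_iff (hid i) (hid one)).2
    ⟨a, φ.symm S, ha.1, ha.2, h1, h2, h3, h4⟩)

/-- Each indecomposable summand of B is projective, hence some e_i L, and then i = 1. Since B is
basic it has only one such summand. -/
theorem IsCore.nonempty_range_equiv_self (hc : IsCore K one top e x y) (he : IsVertexLabelling e)
    (hB : IsBasic B) (hL : IsGeneratorCogenerator B L) :
    Nonempty (LinearMap.range (φ (e one)) ≃ₗ[B] B) := by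
  have : IsArtinianRing B := IsArtinianRing.of_finite K B
  obtain ⟨k, N, hN, hind, hne⟩ := hB
  have h1 : ∀ a, Nonempty (N a ≃ₗ[B] LinearMap.range (φ (e one))) := by
    intro a
    have hp := projective_of_isInternal hN inferInstance a
    obtain ⟨i, ⟨f⟩⟩ := he.exists_nonempty_range_equiv (φ := φ) (hind a)
      (hL (N a) inferInstance (hind a) (Or.inl hp))
    have hi := hc.eq_one_of_projective he hL (Module.Projective.of_equiv f)
    rw [hi] at f
    exact ⟨f⟩
  have hsub : ∀ a b : Fin k, a = b := fun a b => hne a b ⟨(h1 a).some.trans (h1 b).some.symm⟩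
  have htop : iSup N = ⊤ := hN.submodule_iSup_eq_top
  by_cases hk : Nonempty (Fin k)
  · obtain ⟨a⟩ := hk
    have ha : N a = ⊤ := by
      rw [eq_top_iff, ← htop]
      exact iSup_le fun b => by rw [hsub b a]
    exact ⟨(h1 a).some.symm.trans ((LinearEquiv.ofEq _ _ ha).trans Submodule.topEquiv)⟩
  · rw [not_nonempty_iff] at hk
    rw [iSup_of_empty] at htop
    have hB0 : (1 : B) = 0 := by
      have h2 : (1 : B) ∈ (⊤ : Submodule B B) := trivial
      rwa [← htop] at h2
    exfalso
    apply (he.isPrimitiveIdem one).1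
    apply φ.injective
    apply LinearMap.ext
    intro l
    rw [← one_smul B (φ (e one) l), hB0, zero_smul, map_zero, LinearMap.zero_apply]

end Generator

/-! ### The equivalence, with and without a fixed labelling. -/

section Equivalence

variable {K : Type u} [Field K] {A : Type u} [Ring A] [Algebra K A]
  {B : Type u} [Ring B] [Algebra K B] [Module.Finite K B] {L : Type u} [AddCommGroup L]
  [Module K L] [Module B L] [IsScalarTower K B L] {φ : A ≃ₐ[K] Module.End B L}
  {Λ : Type v} [Fintype Λ] [PartialOrder Λ] {one : Λ} {e : Λ → A}

theorem SatisfiesOrderCondition.exists_labelling (h : SatisfiesOrderCondition K one B L)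
    (φ : A ≃ₐ[K] Module.End B L) :
    ∃ e : Λ → A, IsVertexLabelling e ∧ ∃ I : Λ → Ideal B, IsOrderedIdealFamily one I ∧
      ∀ i, Nonempty (LinearMap.range (φ (e i)) ≃ₗ[B] I i) := by
  obtain ⟨hloc, I, hI, ⟨f⟩⟩ := h
  obtain ⟨p, hp, ψ⟩ := exists_idempotents_of_directSum f
  have he : CompleteOrthogonalIdempotents (φ.symm ∘ p) := hp.map (φ.symm : Module.End B L →+* A)
  have ψ' : ∀ i, Nonempty (LinearMap.range (φ ((φ.symm ∘ p) i)) ≃ₗ[B] I i) := fun i => by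
    rw [Function.comp_apply, AlgEquiv.apply_symm_apply]
    exact ψ i
  exact ⟨φ.symm ∘ p, hI.isVertexLabelling he ψ', I, hI, ψ'⟩

variable [IsAlgClosed K]

theorem IsOneQuasiHereditary.exists_isPairGenerator [Module.Finite K L]
    (h : IsOneQuasiHereditary K one e) (hB : IsBasic B) (hL : IsGeneratorCogenerator B L) :
    ∃ x₀, IsPairGenerator (φ : A →ₐ[K] Module.End B L) (e one) x₀ := by
  have := finite_end (K := K) (B := B) (L := L)
  have : Module.Finite K A := Module.Finite.equiv φ.symm.toLinearEquiv
  obtain ⟨top, x, y, hc⟩ := h.isCore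
  exact OneQH.exists_isPairGenerator (h.1.1.1.idem one).eq
    (hc.nonempty_range_equiv_self h.1.1 hB hL)

theorem isOneQuasiHereditary_iff [Module.Finite K L] (hB : IsBasic B) (he : IsVertexLabelling e) :
    (IsMultiplicityFree B L ∧ IsGeneratorCogenerator B L ∧ IsOneQuasiHereditary K one e) ↔
      (IsLocalSelfInjectiveOfCard K Λ B ∧ ∃ I : Λ → Ideal B, IsOrderedIdealFamily one I ∧
        ∀ i, Nonempty (LinearMap.range (φ (e i)) ≃ₗ[B] I i)) := by
  have := finite_end (K := K) (B := B) (L := L)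
  have : Module.Finite K A := Module.Finite.equiv φ.symm.toLinearEquiv
  constructor
  · rintro ⟨-, hL, h⟩
    obtain ⟨top, x, y, hc⟩ := h.isCore
    obtain ⟨x₀, g⟩ := h.exists_isPairGenerator (φ := φ) hB hL
    exact (hc.of_isPairGenerator he g).1
  · rintro ⟨hloc, I, hI, ψ⟩
    obtain ⟨top, x, y, hc⟩ := hI.exists_isCore hloc he.1 ψ
    exact ⟨hI.isMultiplicityFree he.1 ψ, hI.isGeneratorCogenerator hloc he.1 ψ,
      hc.isOneQuasiHereditary he⟩

theorem satisfiesOrderCondition_iff [Module.Finite K L] (φ : A ≃ₐ[K] Module.End B L)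
    (hB : IsBasic B) :
    (IsMultiplicityFree B L ∧ IsGeneratorCogenerator B L ∧
        ∃ e : Λ → A, IsOneQuasiHereditary K one e) ↔ SatisfiesOrderCondition K one B L := by
  constructor
  · rintro ⟨hm, hL, e, h⟩
    obtain ⟨hloc, I, hI, ψ⟩ := (isOneQuasiHereditary_iff (φ := φ) hB h.1.1).1 ⟨hm, hL, h⟩
    exact ⟨hloc, I, hI, nonempty_directSum_equiv (h.1.1.1.map (φ : A →+* Module.End B L)) ψ⟩
  · intro h
    obtain ⟨e, he, hI⟩ := h.exists_labelling φ
    obtain ⟨hm, hL, h'⟩ := (isOneQuasiHereditary_iff (φ := φ) hB he).2 ⟨h.1, hI⟩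
    exact ⟨hm, hL, e, h'⟩

end Equivalence

/-! ### Recovering (B, L) from A and an idempotent. -/

section Reconstruction

variable {K : Type u} [Field K] {A : Type u} [Ring A] [Algebra K A] {f : A}
  {B : Type u} [Ring B] [Algebra K B] {L : Type u} [AddCommGroup L] [Module K L] [Module B L]
  [IsScalarTower K B L] {ρ : A →ₐ[K] Module.End B L} {x₀ : L}
  {B' : Type u} [Ring B'] [Algebra K B'] {L' : Type u} [AddCommGroup L'] [Module K L']
  [Module B' L'] [IsScalarTower K B' L'] {ρ' : A →ₐ[K] Module.End B' L'} {x₀' : L'}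

/-- The module `L` and the algebra `B` are determined by `A` and `f`, as `A f` and `f A f`. -/
theorem IsPairGenerator.exists_equiv_pair (g : IsPairGenerator ρ f x₀)
    (g' : IsPairGenerator ρ' f x₀') :
    ∃ (σ : B ≃ₐ[K] B') (F : L ≃+ L'), ∀ b l, F (b • l) = σ b • F l := by
  obtain ⟨θ, hθ⟩ := g.exists_equiv
  obtain ⟨θ', hθ'⟩ := g'.exists_equiv
  let T : Ideal.span {f} →+ L :=
    { toFun := fun a => ρ a x₀
      map_zero' := by simp
      map_add' := fun a b => by simp }
  let T' : Ideal.span {f} →+ L' :=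
    { toFun := fun a => ρ' a x₀'
      map_zero' := by simp
      map_add' := fun a b => by simp }
  have hT : Function.Bijective T := by
    refine ⟨(injective_iff_map_eq_zero T).2 fun a ha => Subtype.ext ?_, fun l => ?_⟩
    · exact g.eq_zero (coe_mul_of_mem_span g.idem a) ha
    · obtain ⟨a, ha, hal⟩ := g.exists_left' l
      exact ⟨toSpan a ha, hal⟩
  have hT' : Function.Bijective T' := by
    refine ⟨(injective_iff_map_eq_zero T').2 fun a ha => Subtype.ext ?_, fun l => ?_⟩
    · exact g'.eq_zero (coe_mul_of_mem_span g'.idem a) ha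
    · obtain ⟨a, ha, hal⟩ := g'.exists_left' l
      exact ⟨toSpan a ha, hal⟩
  let F : L ≃+ L' := (AddEquiv.ofBijective T hT).symm.trans (AddEquiv.ofBijective T' hT')
  have hF : ∀ a, a * f = a → F (ρ a x₀) = ρ' a x₀' := by
    intro a ha
    have h1 : ρ a x₀ = AddEquiv.ofBijective T hT (toSpan a ha) := rfl
    show AddEquiv.ofBijective T' hT' ((AddEquiv.ofBijective T hT).symm (ρ a x₀)) = _
    rw [h1, AddEquiv.symm_apply_apply]
    rfl
  let s : B ≃ₗ[K] B' := θ.symm.trans θ'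
  have hs : ∀ b l, F (b • l) = s b • F l := by
    intro b l
    obtain ⟨a, ha, rfl⟩ := g.exists_left' l
    have h1 : b • ρ a x₀ = ρ (a * θ.symm b) x₀ := by
      rw [map_mul, Module.End.mul_apply, ← hθ, LinearEquiv.apply_symm_apply, map_smul]
    have h2 : ρ' (a * θ.symm b) x₀' = s b • ρ' a x₀' := by
      rw [map_mul, Module.End.mul_apply, ← hθ', map_smul]
      rfl
    rw [h1, hF _ (by rw [mul_assoc, (θ.symm b).2.2]), h2, hF a ha]
  have hx : F x₀ = x₀' := by
    have := hF f g.idem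
    rwa [g.fix, g'.fix] at this
  have huniq : ∀ b b' : B', b • x₀' = b' • x₀' → b = b' := fun b b' h =>
    sub_eq_zero.1 (g'.right_inj _ (by rw [sub_smul, h, sub_self]))
  refine ⟨AlgEquiv.ofLinearEquiv s (huniq _ _ ?_) (fun b b' => huniq _ _ ?_), F, hs⟩
  · rw [← hx, ← hs, one_smul, one_smul]
  · rw [← hx, ← hs, mul_smul, mul_smul, hs, hs]

/-- The canonical action of `A` on the left ideal generated by `f`, by endomorphisms over its own
endomorphism algebra. -/
theorem exists_isPairGenerator_span (hf : f * f = f) :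
    ∃ ρ : A →ₐ[K] Module.End (Module.End A (Ideal.span {f})) (Ideal.span {f}),
      ∃ x₀, IsPairGenerator ρ f x₀ := by
  let ρ : A →ₐ[K] Module.End (Module.End A (Ideal.span {f})) (Ideal.span {f}) :=
    Algebra.lsmul K _ _
  have hρ : ∀ a (z : Ideal.span {f}), ρ a z = a • z := fun _ _ => rfl
  refine ⟨ρ, toSpan f hf, hf, ?_, fun l => ⟨l, ?_⟩, fun a ha => ?_, fun l hl => ?_, fun b hb => ?_⟩
  · exact Subtype.ext hf
  · exact Subtype.ext (coe_mul_of_mem_span hf l)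
  · exact congrArg Subtype.val ha
  · refine ⟨(LinearMap.toSpanSingleton A _ l).comp (Ideal.span {f}).subtype, ?_⟩
    exact hl
  · apply LinearMap.ext
    intro l
    have h1 : l = (l : A) • toSpan f hf := Subtype.ext (coe_mul_of_mem_span hf l).symm
    have h2 : b (toSpan f hf) = 0 := hb
    rw [h1, map_smul, h2, smul_zero, LinearMap.zero_apply]

end Reconstruction

/-! ### The bijection between isomorphism classes. -/

section Bijection

variable {K : Type u} [Field K] {Λ : Type v} [Fintype Λ] [PartialOrder Λ] {one : Λ}

theorem nonempty_endAlg_equiv {X Y : OrderedPair K one}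
    (h : ∃ (σ : X.alg ≃ₐ[K] Y.alg) (f : X.mod ≃+ Y.mod), ∀ b x, f (b • x) = σ b • f x) :
    Nonempty (EndAlg X.alg X.mod ≃ₐ[K] EndAlg Y.alg Y.mod) := by
  obtain ⟨σ, f, hf⟩ := h
  have hf' : ∀ b y, f.symm (b • y) = σ.symm b • f.symm y := fun b y => f.injective (by
    rw [hf, AddEquiv.apply_symm_apply, AddEquiv.apply_symm_apply, AlgEquiv.apply_symm_apply])
  have hK : ∀ (t : K) x, f (t • x) = t • f x := fun t x => by
    rw [← algebraMap_smul X.alg t x, hf, AlgEquiv.commutes, algebraMap_smul]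
  let T : EndAlg X.alg X.mod ≃ₗ[K] EndAlg Y.alg Y.mod :=
    { toFun := fun g =>
        { toFun := fun y => f (g (f.symm y))
          map_add' := fun y y' => by rw [map_add, map_add, map_add]
          map_smul' := fun b y => by
            rw [hf', map_smul, hf, AlgEquiv.apply_symm_apply, RingHom.id_apply] }
      map_add' := fun g g' => LinearMap.ext fun y => map_add f _ _
      map_smul' := fun t g => LinearMap.ext fun y => hK t _
      invFun := fun g =>
        { toFun := fun x => f.symm (g (f x))
          map_add' := fun y y' => by rw [map_add, map_add, map_add]
          map_smul' := fun b y => by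
            rw [hf, map_smul, hf', AlgEquiv.symm_apply_apply, RingHom.id_apply] }
      left_inv := fun g => LinearMap.ext fun x => by
        show f.symm (f (g (f.symm (f x)))) = g x
        rw [AddEquiv.symm_apply_apply, AddEquiv.symm_apply_apply]
      right_inv := fun g => LinearMap.ext fun x => by
        show f (f.symm (g (f (f.symm x)))) = g x
        rw [AddEquiv.apply_symm_apply, AddEquiv.apply_symm_apply] }
  refine ⟨AlgEquiv.ofLinearEquiv T ?_ fun g g' => ?_⟩
  · exact LinearMap.ext fun y => f.apply_symm_apply y
  · apply LinearMap.ext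
    intro y
    show f (g (g' (f.symm y))) = f (g (f.symm (f (g' (f.symm y)))))
    rw [AddEquiv.symm_apply_apply]

theorem OrderedPair.isBasic (X : OrderedPair K one) : IsBasic X.alg := by
  have := X.satisfies.1.1
  have : IsArtinianRing X.alg := IsArtinianRing.of_finite K X.alg
  exact isBasic_of_isLocalRing

variable [IsAlgClosed K]

/-- The endomorphism algebra of a pair. -/
noncomputable def OrderedPair.endAlg (X : OrderedPair K one) : OneQHAlgebra K one :=
  have := finite_end (K := K) (B := X.alg) (L := X.mod)
  ⟨EndAlg X.alg X.mod,
    ((satisfiesOrderCondition_iff AlgEquiv.refl X.isBasic).2 X.satisfies).2.2⟩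

theorem OrderedPair.exists_equiv_of_endAlg {X Y : OrderedPair K one}
    (χ : EndAlg X.alg X.mod ≃ₐ[K] EndAlg Y.alg Y.mod) :
    ∃ (σ : X.alg ≃ₐ[K] Y.alg) (f : X.mod ≃+ Y.mod), ∀ b x, f (b • x) = σ b • f x := by
  obtain ⟨-, hX, e, h⟩ := (satisfiesOrderCondition_iff AlgEquiv.refl X.isBasic).2 X.satisfies
  obtain ⟨-, hY, -⟩ := (satisfiesOrderCondition_iff AlgEquiv.refl Y.isBasic).2 Y.satisfies
  obtain ⟨x, hx⟩ := h.exists_isPairGenerator (φ := AlgEquiv.refl) X.isBasic hX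
  -- The same idempotent e_1 serves for both pairs, with the algebra acting on the second module
  -- through `χ`.
  obtain ⟨y, hy⟩ := h.exists_isPairGenerator (φ := χ) Y.isBasic hY
  exact hx.exists_equiv_pair hy

/-- The pair is L = A e_1 over B = End_A(A e_1), and the double centralizer property of
`IsCore.of_isPairGenerator` returns A. -/
theorem OneQHAlgebra.exists_orderedPair (A : OneQHAlgebra K one) :
    ∃ X : OrderedPair K one, Nonempty (A.carrier ≃ₐ[K] EndAlg X.alg X.mod) := by
  obtain ⟨e, h⟩ := A.isOneQH
  obtain ⟨top, x, y, hc⟩ := h.isCore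
  obtain ⟨ρ, x₀, g⟩ := exists_isPairGenerator_span (K := K) (h.1.1.1.idem one).eq
  have h1 : Module.Finite K (Ideal.span {e one}) :=
    Module.Finite.of_injective ((Ideal.span {e one}).subtype.restrictScalars K)
      Subtype.val_injective
  have h2 : Module.Finite K (Module.End A.carrier (Ideal.span {e one})) := finite_end
  obtain ⟨⟨hloc, I, hI, ψ⟩, hbij⟩ := hc.of_isPairGenerator h.1.1 g
  exact ⟨⟨Module.End A.carrier (Ideal.span {e one}), Ideal.span {e one}, hloc, I, hI,
    nonempty_directSum_equiv (p := fun i => ρ (e i)) (h.1.1.1.map ρ.toRingHom) ψ⟩,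
    ⟨AlgEquiv.ofBijective ρ hbij⟩⟩

end Bijection

end OneQH

theorem theoremA (K : Type u) [Field K] [IsAlgClosed K]
    {Λ : Type v} [Fintype Λ] [PartialOrder Λ] (one : Λ) :
    -- the equivalence, for `A ≅ End_B(L)^op`
    (∀ (A B L : Type u) [Ring A] [Algebra K A] [Ring B] [Algebra K B] [Module.Finite K B]
      [AddCommGroup L] [Module K L] [Module B L] [IsScalarTower K B L] [Module.Finite K L]
      (φ : A ≃ₐ[K] OneQH.EndAlg B L), OneQH.IsBasic B →
      ((OneQH.IsMultiplicityFree B L ∧ OneQH.IsGeneratorCogenerator B L ∧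
          ∃ e : Λ → A, OneQH.IsOneQuasiHereditary K one e) ↔
        OneQH.SatisfiesOrderCondition K one B L) ∧
      -- the vertex `i` of `A` corresponds to the direct summand `L(i)` of `L`
      ∀ e : Λ → A, OneQH.IsVertexLabelling e →
        ((OneQH.IsMultiplicityFree B L ∧ OneQH.IsGeneratorCogenerator B L ∧
            OneQH.IsOneQuasiHereditary K one e) ↔
          (OneQH.IsLocalSelfInjectiveOfCard K Λ B ∧
            ∃ I : Λ → Ideal B, OneQH.IsOrderedIdealFamily one I ∧
              ∀ i, Nonempty (LinearMap.range (φ (e i)) ≃ₗ[B] I i)))) ∧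
    -- the bijection between isomorphism classes, `[B, L] ↦ [End_B(L)^op]`
    ∃ Ψ : OneQH.OrderedPair.IsoClass.{u, v} K one ≃ OneQH.OneQHAlgebra.IsoClass.{u, v} K one,
      ∀ (X : OneQH.OrderedPair K one) (A : OneQH.OneQHAlgebra K one),
        Ψ X.isoClass = A.isoClass ↔ Nonempty (A.carrier ≃ₐ[K] OneQH.EndAlg X.alg X.mod) := by
  refine ⟨fun A B L _ _ _ _ _ _ _ _ _ _ φ hB =>
    ⟨OneQH.satisfiesOrderCondition_iff φ hB, fun e he => OneQH.isOneQuasiHereditary_iff hB he⟩, ?_⟩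
  let Ψ : OneQH.OrderedPair.IsoClass.{u, v} K one → OneQH.OneQHAlgebra.IsoClass.{u, v} K one :=
    Quotient.lift (fun X => X.endAlg.isoClass) fun X Y h =>
      Quotient.sound (OneQH.nonempty_endAlg_equiv h)
  have hΨ : ∀ (X : OneQH.OrderedPair K one) (A : OneQH.OneQHAlgebra K one),
      Ψ X.isoClass = A.isoClass ↔ Nonempty (A.carrier ≃ₐ[K] OneQH.EndAlg X.alg X.mod) := by
    intro X A
    have h1 : Ψ X.isoClass = X.endAlg.isoClass := rfl
    rw [h1]
    constructor
    · intro h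
      obtain ⟨χ⟩ := Quotient.exact h
      exact ⟨χ.symm⟩
    · rintro ⟨χ⟩
      exact Quotient.sound ⟨χ.symm⟩
  refine ⟨Equiv.ofBijective Ψ ⟨?_, ?_⟩, hΨ⟩
  · rintro ⟨X⟩ ⟨Y⟩ h
    obtain ⟨χ⟩ := (hΨ X Y.endAlg).1 h
    exact Quotient.sound (OneQH.OrderedPair.exists_equiv_of_endAlg χ.symm)
  · rintro ⟨A⟩
    obtain ⟨X, hX⟩ := A.exists_orderedPair
    exact ⟨X.isoClass, (hΨ X A).2 hX⟩
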